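/- Let $\mathbb D=\{z\in\mathbb C: |z|<1\}$ and $d\iota(z)=\frac{dz}{\pi(1-|z|^2)^2}$, where $dz$ is Lebesgue measure. For an integer $\nu\ge 2$ let $\mathcal H_\nu$ be the Hilbert space of holomorphic functions on $\mathbb D$ with $\|f\|_\nu^2=(\nu-1)\int_{\mathbb D}|f(z)|^2(1-|z|^2)^\nu\,d\iota(z)<\infty$. Its reproducing kernel is $K^\nu_w(z)=(1-z\bar w)^{-\nu}$, and $SU(1,1)$ acts on it unitarily by $$(g\cdot f)(z)=(-bz+\bar a)^{-\nu}f\Big(\frac{az-\bar b}{-bz+\bar a}\Big),\qquad g=\begin{pmatrix}a&b\\ \bar b&\bar a\end{pmatrix}.$$ For a bounded operator $A$ on $\mathcal H_\nu$ let $R_\nu(A)(z)=(AK^\nu_z)(z)\,(1-|z|^2)^\nu$. For $1\le p\le\infty$ and $f\in L^p(\mathbb D,d\iota)$ let $R_\nu^*(f)$ be the bounded operator on $\mathcal H_\nu$ determined by the adjoint relation $\langle g,R_\nu^*(f)h\rangle_\nu=\int_{\mathbb D}R_\nu(g\otimes h^*)\,\overline{f}\,d\iota$ for $g,h\in\mathcal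 H_\nu$, where $(g\otimes h^*)(u)=\langle u,h\rangle_\nu\, g$ and $\langle\cdot,\cdot\rangle_\nu$ is linear in the first variable. Let $B_\nu=R_\nu R_\nu^*$ be the Berezin transform. Let $\mu\ge2$ and $k\ge0$ be integers. For an integer $\nu\ge2$ let $P_k:\mathcal H_\mu\otimes\mathcal H_\nu\to\mathcal H_{\mu+\nu+2k}$ be the projection onto the summand $\mathcal H_{\mu+\nu+2k}$ of the Hilbert space tensor product, i.e. an $SU(1,1)$-equivariant bounded map with $P_kP_k^*=1$ (unique up to a scalar of modulus one). Put $\mathcal T^\nu_{\mu,k}(A)=P_k(A\otimes 1)P_k^*$, $\;E^\nu_{\mu,k}=R_{\mu+\nu+2k}\,\mathcal T^\nu_{\mu,k}\,R_\mu^*\;$ and $$E_{\mu,k}=\frac{(\mu)_k}{k!}\sum_{j=0}^k(-1)^j\binom kj B_{\mu+j},$$ where $(x)_k=x(x+1)\cdots(x+k-1)$. Then these objects are well defined (in particular $R_m^*(f)$ exists for all integers $m\ge 2$, all $1\le p\le\infty$ and all $f\in L^p(\mathbb D,d\iota)$, and $P_k$ exists for all integers $\nu\ge 2$), and for every $1\le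 p\le\infty$ the maps $B_m$ ($m\ge2$) and $E^\nu_{\mu,k}$ ($\nu\ge2$) are bounded linear operators on $L^p(\mathbb D,d\iota)$ such that $$E^\nu_{\mu,k}=\frac{(\mu)_k(\nu)_k}{k!\,(\mu+\nu+k-1)_k}\sum_{j=0}^k(-1)^j\binom kj\frac{(\nu+k-j)_k}{(\nu)_k}\,B_{\mu+j}\qquad\text{for all integers }\nu\ge2,$$ and, as $\nu\to\infty$ through the integers, $\|E^\nu_{\mu,k}-E_{\mu,k}\|_{L^p\to L^p}\to0$. -/

import Mathlib

open MeasureTheory Metric Filter Topology UniformSpace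
open scoped ENNReal ComplexConjugate InnerProductSpace TensorProduct

noncomputable section

/-- The open unit disc `𝔻` in `ℂ`. -/
def disc : Set ℂ := ball (0 : ℂ) 1

/-- The invariant measure `dι(z) = dz / (π (1 - |z|²)²)` of the disc, as a measure on `ℂ` carried by
the disc. -/
def invMeasure : Measure ℂ :=
  (volume.restrict disc).withDensity fun z =>
    ENNReal.ofReal (1 / (Real.pi * (1 - ‖z‖ ^ 2) ^ 2))

/-- The normalising factor `ν - 1` of the weight `ν ≥ 2`. (For `ν ≤ 1`, where the weighted space
below is zero, it is given the harmless value `1`.) -/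
def weightConst (ν : ℕ) : ℝ := if 2 ≤ ν then (ν : ℝ) - 1 else 1

/-- The measure `dι_ν(z) = (ν - 1) (1 - |z|²)^ν dz / (π (1 - |z|²)²)` on the disc. -/
def weightMeasure (ν : ℕ) : Measure ℂ :=
  (volume.restrict disc).withDensity fun z =>
    ENNReal.ofReal (weightConst ν * (1 - ‖z‖ ^ 2) ^ ν / (Real.pi * (1 - ‖z‖ ^ 2) ^ 2))

/-- The holomorphic functions on the disc that are square integrable for `dι_ν`. A function on the
disc is encoded by its extension by zero to `ℂ`. -/
def bergmanSubmodule (ν : ℕ) : Submodule ℂ (ℂ → ℂ) where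
  carrier := {f | DifferentiableOn ℂ f disc ∧ (∀ z, z ∉ disc → f z = 0) ∧
    MemLp f 2 (weightMeasure ν)}
  add_mem' := by
    rintro f g ⟨hf, hf0, hf2⟩ ⟨hg, hg0, hg2⟩
    exact ⟨hf.add hg, fun z hz => by simp [hf0 z hz, hg0 z hz], hf2.add hg2⟩
  zero_mem' := ⟨differentiableOn_const 0, fun _ _ => rfl, MemLp.zero⟩
  smul_mem' := by
    rintro c f ⟨hf, hf0, hf2⟩
    exact ⟨hf.const_smul c, fun z hz => by simp [hf0 z hz], hf2.const_smul c⟩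

/-- The Hilbert space `ℋ_ν`. -/
def Bergman (ν : ℕ) : Type := bergmanSubmodule ν

namespace Bergman

variable {ν : ℕ}

instance instAddCommGroup : AddCommGroup (Bergman ν) :=
  inferInstanceAs (AddCommGroup (bergmanSubmodule ν))

instance instModule : Module ℂ (Bergman ν) :=
  inferInstanceAs (Module ℂ (bergmanSubmodule ν))

instance instCoeFun : CoeFun (Bergman ν) fun _ => ℂ → ℂ := ⟨fun f => f.1⟩

lemma memLp (f : Bergman ν) : MemLp f 2 (weightMeasure ν) := f.2.2.2

lemma differentiableOn (f : Bergman ν) : DifferentiableOn ℂ f disc := f.2.1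

lemma eq_zero (f : Bergman ν) {z : ℂ} (hz : z ∉ disc) : f z = 0 := f.2.2.1 z hz

lemma add_apply (f g : Bergman ν) (z : ℂ) : (f + g) z = f z + g z := rfl

lemma smul_apply (c : ℂ) (f : Bergman ν) (z : ℂ) : (c • f) z = c * f z := rfl

lemma sub_apply (f g : Bergman ν) (z : ℂ) : (f - g) z = f z - g z := rfl

lemma ext {f g : Bergman ν} (h : ∀ z ∈ disc, f z = g z) : f = g := by
  apply Subtype.ext
  funext z
  by_cases hz : z ∈ disc
  · exact h z hz
  · exact (f.eq_zero hz).trans (g.eq_zero hz).symm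

end Bergman

lemma isOpen_disc : IsOpen disc := isOpen_ball

lemma one_sub_pos {z : ℂ} (hz : z ∈ disc) : 0 < 1 - ‖z‖ ^ 2 := by
  have h : ‖z‖ < 1 := by simpa [disc] using hz
  have := norm_nonneg z
  nlinarith

lemma weightConst_pos (ν : ℕ) : 0 < weightConst ν := by
  unfold weightConst
  split_ifs with h
  · have : (2 : ℝ) ≤ ν := by exact_mod_cast h
    linarith
  · exact one_pos

lemma measurable_weight (ν : ℕ) : Measurable fun z : ℂ =>
    ENNReal.ofReal (weightConst ν * (1 - ‖z‖ ^ 2) ^ ν / (Real.pi * (1 - ‖z‖ ^ 2) ^ 2)) := by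
  fun_prop

lemma ae_weight_iff (ν : ℕ) (p : ℂ → Prop) :
    (∀ᵐ z ∂weightMeasure ν, p z) ↔ ∀ᵐ z ∂(volume.restrict disc), p z := by
  unfold weightMeasure
  rw [ae_withDensity_iff (measurable_weight ν)]
  have hd : ∀ᵐ z ∂(volume.restrict disc), z ∈ disc :=
    ae_restrict_mem isOpen_disc.measurableSet
  constructor
  · intro h
    filter_upwards [h, hd] with z hz hzd
    apply hz
    have := one_sub_pos hzd
    have := weightConst_pos ν
    have := Real.pi_pos
    simp only [ne_eq, ENNReal.ofReal_eq_zero, not_le]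
    positivity
  · intro h
    filter_upwards [h] with z hz _ using hz

/-- A holomorphic function on the disc that vanishes almost everywhere is zero. -/
lemma Bergman.ext_ae {ν : ℕ} {f g : Bergman ν} (h : f.1 =ᵐ[weightMeasure ν] g.1) : f = g := by
  have h' := (ae_weight_iff ν _).1 h
  exact Bergman.ext fun z hz => Measure.eqOn_open_of_ae_eq h' isOpen_disc
    f.differentiableOn.continuousOn g.differentiableOn.continuousOn hz

namespace Bergman

variable {ν : ℕ}

lemma integrable_inner (f g : Bergman ν) :
    Integrable (fun z => conj (f z) * g z) (weightMeasure ν) := by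
  have := f.memLp.star.integrable_mul g.memLp
  exact this

/-- The inner product `∫ conj(f) g dι_ν`, conjugate linear in the first variable. -/
abbrev core (ν : ℕ) : InnerProductSpace.Core ℂ (Bergman ν) where
  inner f g := ∫ z, conj (f z) * g z ∂(weightMeasure ν)
  conj_inner_symm f g := by
    rw [← integral_conj]
    simp [mul_comm]
  re_inner_nonneg f := by
    have : ∀ z, conj (f z) * f z = ((‖f z‖ ^ 2 : ℝ) : ℂ) := fun z => by
      rw [mul_comm, Complex.mul_conj, Complex.normSq_eq_norm_sq]
    simp only [this]
    rw [integral_complex_ofReal]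
    simpa using integral_nonneg fun z => sq_nonneg ‖f z‖
  add_left f g h := by
    rw [← integral_add (integrable_inner f h) (integrable_inner g h)]
    simp [add_apply, add_mul]
  smul_left f g c := by
    rw [← integral_const_mul]
    simp [smul_apply, mul_assoc]
  definite f hf := by
    have h1 : ∀ z, conj (f z) * f z = ((‖f z‖ ^ 2 : ℝ) : ℂ) := fun z => by
      rw [mul_comm, Complex.mul_conj, Complex.normSq_eq_norm_sq]
    have hi : Integrable (fun z => ‖f z‖ ^ 2) (weightMeasure ν) := f.memLp.integrable_norm_pow (by simp)
    have h2 : ∫ z, conj (f z) * f z ∂(weightMeasure ν) = 0 := hf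
    simp only [h1] at h2
    rw [integral_complex_ofReal, Complex.ofReal_eq_zero,
      integral_eq_zero_iff_of_nonneg (fun z => sq_nonneg ‖f z‖) hi] at h2
    apply ext_ae
    filter_upwards [h2] with z hz
    have : ‖f z‖ ^ 2 = 0 := hz
    have : f z = 0 := by simpa using this
    exact this

instance instNormedAddCommGroup : NormedAddCommGroup (Bergman ν) :=
  (core ν).toNormedAddCommGroup

instance instInnerProductSpace : InnerProductSpace ℂ (Bergman ν) :=
  InnerProductSpace.ofCore (core ν).toCore

lemma inner_def (f g : Bergman ν) :
    ⟪f, g⟫_ℂ = ∫ z, conj (f z) * g z ∂(weightMeasure ν) := rfl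

end Bergman

namespace Bergman

variable {ν : ℕ}

/-- Area sub-mean value estimate for holomorphic functions. -/
lemma _root_.enorm_le_lintegral_ball {F : ℂ → ℂ} (hFm : Measurable F) {z : ℂ} {δ : ℝ} (hδ : 0 < δ)
    (hF : DifferentiableOn ℂ F (ball z δ)) :
    ENNReal.ofReal (Real.pi * δ ^ 2) * ‖F z‖ₑ ≤ ∫⁻ w in ball z δ, ‖F w‖ₑ := by
  have hmean : ∀ r ∈ Set.Ioo 0 δ, ENNReal.ofReal (2 * Real.pi) * ‖F z‖ₑ ≤
      ∫⁻ θ in Set.Ioo (-Real.pi) Real.pi, ‖F (circleMap z r θ)‖ₑ := by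
    intro r hr
    have hd : DiffContOnCl ℂ F (ball z |r|) := by
      rw [abs_of_pos hr.1]
      apply DifferentiableOn.diffContOnCl
      rw [closure_ball _ hr.1.ne']
      exact hF.mono (closedBall_subset_ball hr.2)
    have h1 := hd.circleAverage
    have hper : Function.Periodic (fun θ => F (circleMap z r θ)) (2 * Real.pi) := fun θ => by
      simp [periodic_circleMap z r θ]
    have h2 := hper.intervalIntegral_add_eq (-Real.pi) 0
    rw [zero_add, show -Real.pi + 2 * Real.pi = Real.pi by ring] at h2
    have h3 : (2 * Real.pi : ℝ) • F z = ∫ θ in Set.Ioo (-Real.pi) Real.pi, F (circleMap z r θ) := by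
      rw [← integral_Ioc_eq_integral_Ioo,
        ← intervalIntegral.integral_of_le (by linarith [Real.pi_pos]), h2, ← h1,
        Real.circleAverage_def, smul_smul, mul_inv_cancel₀ (by positivity), one_smul]
    calc ENNReal.ofReal (2 * Real.pi) * ‖F z‖ₑ = ‖(2 * Real.pi : ℝ) • F z‖ₑ := by
          rw [enorm_smul, Real.enorm_eq_ofReal (by positivity)]
      _ ≤ _ := by rw [h3]; exact enorm_integral_le_lintegral_enorm _
  have hmeas : Measurable ((ball z δ).indicator fun w => ‖F w‖ₑ) :=
    hFm.enorm.indicator isOpen_ball.measurableSet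
  rw [← lintegral_indicator isOpen_ball.measurableSet,
    ← lintegral_add_left_eq_self _ z, ← Complex.lintegral_comp_polarCoord_symm,
    polarCoord_target, Measure.volume_eq_prod, ← Measure.prod_restrict,
    lintegral_prod]
  · have hle : ∫⁻ r in Set.Ioo (0 : ℝ) δ, ENNReal.ofReal (2 * Real.pi) * ‖F z‖ₑ * ENNReal.ofReal r ≤
        ∫⁻ r in Set.Ioi (0 : ℝ), ∫⁻ θ in Set.Ioo (-Real.pi) Real.pi, ENNReal.ofReal r •
          ((ball z δ).indicator fun w => ‖F w‖ₑ) (z + Complex.polarCoord.symm (r, θ)) := by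
      refine le_trans ?_ (lintegral_mono_set (s := Set.Ioo 0 δ) (t := Set.Ioi 0) fun _ hx => hx.1)
      refine setLIntegral_mono' measurableSet_Ioo fun r hr => ?_
      have hin : ∀ θ, ((ball z δ).indicator fun w => ‖F w‖ₑ)
          (z + Complex.polarCoord.symm (r, θ)) = ‖F (circleMap z r θ)‖ₑ := by
        intro θ
        have he : z + Complex.polarCoord.symm (r, θ) = circleMap z r θ := by
          rw [Complex.polarCoord_symm_apply, circleMap, Complex.exp_mul_I]
          push_cast
          rfl
        rw [he, Set.indicator_of_mem]
        rw [mem_ball, Complex.dist_eq, circleMap_sub_center, norm_circleMap_zero, abs_of_pos hr.1]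
        exact hr.2
      simp only [hin, smul_eq_mul]
      rw [lintegral_const_mul']
      · rw [mul_comm]
        gcongr
        exact hmean r hr
      · exact ENNReal.ofReal_ne_top
    refine le_trans (le_of_eq ?_) hle
    rw [lintegral_const_mul _ (by fun_prop), ← ofReal_integral_eq_lintegral_ofReal]
    · rw [← integral_Ioc_eq_integral_Ioo, ← intervalIntegral.integral_of_le hδ.le, integral_id,
        mul_right_comm, ← ENNReal.ofReal_mul (by positivity)]
      congr 2
      ring
    · exact (continuous_id.integrableOn_Icc).mono_set Set.Ioo_subset_Icc_self
    · filter_upwards [ae_restrict_mem measurableSet_Ioo] with r hr using hr.1.le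
  · refine Measurable.aemeasurable ?_
    refine (by fun_prop : Measurable fun p : ℝ × ℝ => ENNReal.ofReal p.1).smul (hmeas.comp ?_)
    have h1 : Measurable fun p : ℝ × ℝ => Complex.polarCoord.symm p := by
      simp only [Complex.polarCoord_symm_apply]
      fun_prop
    exact h1.const_add z

end Bergman

namespace Bergman

variable {ν : ℕ}

lemma measurable (f : Bergman ν) : Measurable f.1 := by
  classical
  have h : f.1 = disc.indicator f.1 := by
    funext z
    by_cases hz : z ∈ disc
    · rw [Set.indicator_of_mem hz]
    · rw [Set.indicator_of_notMem hz]
      exact f.eq_zero hz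
  rw [h, ← Set.piecewise_eq_indicator]
  exact f.differentiableOn.continuousOn.measurable_piecewise continuousOn_const
    isOpen_disc.measurableSet

lemma norm_sq_eq (f : Bergman ν) : ‖f‖ ^ 2 = ∫ z, ‖f z‖ ^ 2 ∂(weightMeasure ν) := by
  have h1 : ∀ z, conj (f z) * f z = ((‖f z‖ ^ 2 : ℝ) : ℂ) := fun z => by
    rw [mul_comm, Complex.mul_conj, Complex.normSq_eq_norm_sq]
  have h2 := inner_self_eq_norm_sq_to_K (𝕜 := ℂ) f
  rw [inner_def] at h2
  simp only [h1] at h2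
  rw [integral_complex_ofReal] at h2
  exact (Complex.ofReal_injective (h2.trans (by push_cast; rfl))).symm

lemma ofReal_norm_sq (f : Bergman ν) :
    ENNReal.ofReal (‖f‖ ^ 2) = ∫⁻ z, ‖f z ^ 2‖ₑ ∂(weightMeasure ν) := by
  rw [norm_sq_eq, ofReal_integral_eq_lintegral_ofReal (f.memLp.integrable_norm_pow (by simp))
    (ae_of_all _ fun z => sq_nonneg _)]
  refine lintegral_congr fun z => ?_
  rw [← norm_pow, ofReal_norm]

/-- Point evaluations are bounded, uniformly on smaller discs. -/
lemma exists_bound (ν : ℕ) {r : ℝ} (hr0 : 0 ≤ r) (hr : r < 1) :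
    ∃ C : ℝ, ∀ f : Bergman ν, ∀ z ∈ closedBall (0 : ℂ) r, ‖f z‖ ≤ C * ‖f‖ := by
  set δ := (1 - r) / 2 with hδ
  set s := (1 + r) / 2 with hs
  have hδ0 : 0 < δ := by linarith
  have hs1 : s < 1 := by linarith
  have hs0 : 0 < s := by linarith
  have hs2 : 0 < 1 - s ^ 2 := by nlinarith
  set c : ℝ := weightConst ν * (1 - s ^ 2) ^ ν / Real.pi with hc
  have hc0 : 0 < c := by have := weightConst_pos ν; positivity
  refine ⟨√(1 / (c * (Real.pi * δ ^ 2))), fun f z hz => ?_⟩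
  have hz' : ‖z‖ ≤ r := by simpa using hz
  have hsub : ball z δ ⊆ ball 0 s := by
    apply ball_subset_ball'
    rw [dist_zero_right]
    linarith
  have hsub1 : ball z δ ⊆ disc := hsub.trans (ball_subset_ball hs1.le)
  have h1 := enorm_le_lintegral_ball (F := fun w => f w ^ 2) (f.measurable.pow_const 2) hδ0
    ((f.differentiableOn.pow 2).mono hsub1)
  have h2 : ENNReal.ofReal c * ∫⁻ w in ball z δ, ‖f w ^ 2‖ₑ ≤ ENNReal.ofReal (‖f‖ ^ 2) := by
    rw [ofReal_norm_sq, weightMeasure, lintegral_withDensity_eq_lintegral_mul _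
      (measurable_weight ν) (f.measurable.pow_const 2).enorm,
      ← lintegral_const_mul _ (f.measurable.pow_const 2).enorm]
    refine le_trans ?_ (lintegral_mono_set hsub1)
    refine setLIntegral_mono' isOpen_ball.measurableSet fun w hw => ?_
    rw [Pi.mul_apply]
    gcongr
    have hw1 : ‖w‖ < s := by simpa using hsub hw
    have hw0 := norm_nonneg w
    have h3 : 1 - s ^ 2 ≤ 1 - ‖w‖ ^ 2 := by nlinarith
    have h4 : 1 - ‖w‖ ^ 2 ≤ 1 := by nlinarith
    have h5 : 0 < 1 - ‖w‖ ^ 2 := by linarith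
    have h6 := (weightConst_pos ν).le
    rw [hc]
    have h7 : Real.pi * (1 - ‖w‖ ^ 2) ^ 2 ≤ Real.pi :=
      mul_le_of_le_one_right Real.pi_pos.le (pow_le_one₀ h5.le h4)
    have h8 := Real.pi_pos
    gcongr
  have h3 : ENNReal.ofReal (c * (Real.pi * δ ^ 2) * ‖f z‖ ^ 2) ≤ ENNReal.ofReal (‖f‖ ^ 2) := by
    refine le_trans (le_of_eq ?_) ((mul_le_mul_right h1 (ENNReal.ofReal c)).trans h2)
    rw [mul_assoc, ENNReal.ofReal_mul hc0.le, ENNReal.ofReal_mul (by positivity), ← norm_pow,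
      ofReal_norm]
  rw [ENNReal.ofReal_le_ofReal_iff (by positivity)] at h3
  rw [← Real.sqrt_sq (norm_nonneg f), ← Real.sqrt_mul (by positivity)]
  apply Real.le_sqrt_of_sq_le
  have : 0 < c * (Real.pi * δ ^ 2) := by positivity
  rw [one_div, ← div_eq_inv_mul, le_div_iff₀ this]
  linarith

lemma exists_bound_of_isCompact (ν : ℕ) {K : Set ℂ} (hK : IsCompact K) (hKd : K ⊆ disc) :
    ∃ C : ℝ, ∀ f : Bergman ν, ∀ z ∈ K, ‖f z‖ ≤ C * ‖f‖ := by
  rcases K.eq_empty_or_nonempty with rfl | hne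
  · exact ⟨0, by simp⟩
  obtain ⟨w, hw, hmax⟩ := hK.exists_isMaxOn hne continuous_norm.continuousOn
  obtain ⟨C, hC⟩ := exists_bound ν (norm_nonneg w) (by simpa [disc] using hKd hw)
  exact ⟨C, fun f z hz => hC f z (by simpa using hmax hz)⟩

instance instCompleteSpace : CompleteSpace (Bergman ν) := by
  refine Metric.complete_of_cauchySeq_tendsto fun u hu => ?_
  have hloc : ∀ K ⊆ disc, IsCompact K → UniformCauchySeqOn (fun n => (u n).1) atTop K := by
    intro K hKd hK
    obtain ⟨C, hC⟩ := exists_bound_of_isCompact ν hK hKd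
    rw [Metric.uniformCauchySeqOn_iff]
    intro ε hε
    obtain ⟨N, hN⟩ := Metric.cauchySeq_iff.1 hu (ε / (|C| + 1)) (by positivity)
    refine ⟨N, fun m hm n hn z hz => ?_⟩
    have h1 := hC (u m - u n) z hz
    have h2 := hN m hm n hn
    rw [dist_eq_norm] at h2 ⊢
    calc ‖(u m) z - (u n) z‖ ≤ C * ‖u m - u n‖ := h1
      _ ≤ (|C| + 1) * ‖u m - u n‖ := by
          gcongr
          linarith [le_abs_self C]
      _ < (|C| + 1) * (ε / (|C| + 1)) := by gcongr
      _ = ε := by field_simp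
  have hpt : ∀ z, ∃ y, Tendsto (fun n => (u n) z) atTop (𝓝 y) := by
    intro z
    by_cases hz : z ∈ disc
    · exact cauchySeq_tendsto_of_complete
        ((hloc {z} (by simpa using hz) isCompact_singleton).cauchySeq rfl)
    · exact ⟨0, by simp [(u _).eq_zero hz]⟩
  choose g hg using hpt
  have hdiff : DifferentiableOn ℂ g disc := by
    have : TendstoLocallyUniformlyOn (fun n => (u n).1) g atTop disc := by
      rw [tendstoLocallyUniformlyOn_iff_forall_isCompact isOpen_disc]
      exact fun K hKd hK => (hloc K hKd hK).tendstoUniformlyOn_of_tendsto fun z _ => hg z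
    exact this.differentiableOn (Eventually.of_forall fun n => (u n).differentiableOn) isOpen_disc
  have hmem : ∀ n, MemLp (u n).1 2 (weightMeasure ν) := fun n => (u n).memLp
  have hnorm : ∀ f : Bergman ν, eLpNorm f.1 2 (weightMeasure ν) = ENNReal.ofReal ‖f‖ := by
    intro f
    rw [f.memLp.eLpNorm_eq_integral_rpow_norm (by simp) (by simp)]
    congr 1
    simp only [ENNReal.toReal_ofNat, Real.rpow_two]
    rw [← norm_sq_eq, ← Real.rpow_two, ← Real.rpow_mul (norm_nonneg f)]
    norm_num
  have hgm : Measurable g := measurable_of_tendsto_metrizable (fun n => (u n).measurable)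
    (tendsto_pi_nhds.2 hg)
  have hlim : ∀ ε > 0, ∃ N, ∀ n ≥ N, eLpNorm ((u n).1 - g) 2 (weightMeasure ν) ≤
      ENNReal.ofReal ε := by
    intro ε hε
    obtain ⟨N, hN⟩ := Metric.cauchySeq_iff.1 hu ε hε
    refine ⟨N, fun n hn => ?_⟩
    refine (Lp.eLpNorm_lim_le_liminf_eLpNorm (f := fun m => (u n).1 - (u m).1)
      (fun m => ((u n).measurable.sub (u m).measurable).aestronglyMeasurable) _
      (ae_of_all _ fun z => (tendsto_const_nhds.sub (hg z)))).trans ?_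
    refine liminf_le_of_le (by isBoundedDefault) fun b hb => ?_
    obtain ⟨m, hm, hmN⟩ := (hb.and (eventually_ge_atTop N)).exists
    refine hm.trans ?_
    have := hnorm (u n - u m)
    refine (le_of_eq this).trans (ENNReal.ofReal_le_ofReal ?_)
    rw [← dist_eq_norm]
    exact (hN n hn m hmN).le
  have hg2 : MemLp g 2 (weightMeasure ν) := by
    obtain ⟨N, hN⟩ := hlim 1 one_pos
    have h1 : MemLp ((u N).1 - g) 2 (weightMeasure ν) :=
      ⟨((u N).measurable.sub hgm).aestronglyMeasurable,
        (hN N le_rfl).trans_lt ENNReal.ofReal_lt_top⟩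
    simpa using (hmem N).sub h1
  let G : Bergman ν := ⟨g, hdiff, fun z hz => tendsto_nhds_unique (hg z)
    (by simp [(u _).eq_zero hz]), hg2⟩
  refine ⟨G, Metric.tendsto_atTop.2 fun ε hε => ?_⟩
  obtain ⟨N, hN⟩ := hlim (ε / 2) (by positivity)
  refine ⟨N, fun n hn => ?_⟩
  have h1 : ENNReal.ofReal ‖u n - G‖ ≤ ENNReal.ofReal (ε / 2) := (hnorm (u n - G)) ▸ hN n hn
  rw [ENNReal.ofReal_le_ofReal_iff (by positivity)] at h1
  rw [dist_eq_norm]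
  linarith

end Bergman

lemma isFiniteMeasure_weightMeasure {ν : ℕ} (hν : 2 ≤ ν) : IsFiniteMeasure (weightMeasure ν) := by
  refine isFiniteMeasure_withDensity (ne_of_lt ?_)
  calc ∫⁻ z in disc, ENNReal.ofReal
        (weightConst ν * (1 - ‖z‖ ^ 2) ^ ν / (Real.pi * (1 - ‖z‖ ^ 2) ^ 2))
      ≤ ∫⁻ _z in disc, ENNReal.ofReal (weightConst ν / Real.pi) := by
        refine setLIntegral_mono' isOpen_disc.measurableSet fun z hz => ENNReal.ofReal_le_ofReal ?_
        have h0 := one_sub_pos hz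
        have h1 : 1 - ‖z‖ ^ 2 ≤ 1 := by nlinarith [sq_nonneg ‖z‖]
        have h2 := Real.pi_pos
        have h3 := (weightConst_pos ν).le
        rw [div_le_div_iff₀ (by positivity) h2]
        have h4 : (1 - ‖z‖ ^ 2) ^ ν ≤ (1 - ‖z‖ ^ 2) ^ 2 := pow_le_pow_of_le_one h0.le h1 hν
        calc weightConst ν * (1 - ‖z‖ ^ 2) ^ ν * Real.pi
            ≤ weightConst ν * (1 - ‖z‖ ^ 2) ^ 2 * Real.pi := by gcongr
          _ = weightConst ν * (Real.pi * (1 - ‖z‖ ^ 2) ^ 2) := by ring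
    _ < ⊤ := by
        rw [setLIntegral_const]
        exact ENNReal.mul_lt_top ENNReal.ofReal_lt_top measure_ball_lt_top

/-- The function `z ↦ K^ν(z, w) = (1 - z w̄)^{-ν}` on the disc. -/
def kernelFun (ν : ℕ) (w : ℂ) : ℂ → ℂ := disc.indicator fun z => ((1 - z * conj w) ^ ν)⁻¹

lemma kernelFun_mem {ν : ℕ} (hν : 2 ≤ ν) {w : ℂ} (hw : w ∈ disc) :
    kernelFun ν w ∈ bergmanSubmodule ν := by
  have hw1 : ‖w‖ < 1 := by simpa [disc] using hw
  have hlow : ∀ z ∈ disc, 1 - ‖w‖ ≤ ‖1 - z * conj w‖ := by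
    intro z hz
    have hz1 : ‖z‖ < 1 := by simpa [disc] using hz
    have h1 : ‖(1 : ℂ)‖ - ‖z * conj w‖ ≤ ‖1 - z * conj w‖ := norm_sub_norm_le _ _
    rw [norm_one, norm_mul, RCLike.norm_conj] at h1
    nlinarith [norm_nonneg w, norm_nonneg z]
  have hdiff : DifferentiableOn ℂ (kernelFun ν w) disc := by
    have h : DifferentiableOn ℂ (fun z => ((1 - z * conj w) ^ ν)⁻¹) disc := by
      refine DifferentiableOn.inv (by fun_prop) fun z hz => pow_ne_zero _ fun h0 => ?_
      have := hlow z hz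
      rw [h0, norm_zero] at this
      linarith
    exact h.congr fun z hz => Set.indicator_of_mem hz _
  have hmeas : Measurable (kernelFun ν w) :=
    Measurable.indicator (by fun_prop) isOpen_disc.measurableSet
  have := isFiniteMeasure_weightMeasure hν
  refine ⟨hdiff, fun z hz => Set.indicator_of_notMem hz _,
    MemLp.of_bound hmeas.aestronglyMeasurable (((1 - ‖w‖) ^ ν)⁻¹) (ae_of_all _ fun z => ?_)⟩
  have h1 : 0 < 1 - ‖w‖ := by linarith
  by_cases hz : z ∈ disc
  · rw [kernelFun, Set.indicator_of_mem hz, norm_inv, norm_pow]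
    gcongr
    exact hlow z hz
  · rw [kernelFun, Set.indicator_of_notMem hz, norm_zero]
    positivity

open Classical in
/-- The reproducing kernel `K_w^ν = K^ν(·, w)` as an element of `ℋ_ν`, for `ν ≥ 2` and `w` in the
disc. -/
def kernelVec (ν : ℕ) (w : ℂ) : Bergman ν :=
  if h : 2 ≤ ν ∧ w ∈ disc then ⟨kernelFun ν w, kernelFun_mem h.1 h.2⟩ else 0

/-- The integral kernel `A(x, y) = (A K_y)(x)` of a bounded operator on `ℋ_ν`. -/
def opKernel (ν : ℕ) (A : Bergman ν →L[ℂ] Bergman ν) (x y : ℂ) : ℂ := (A (kernelVec ν y)) x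

/-- The covariant symbol map `R_ν(A)(z) = A(z, z) (1 - |z|²)^ν`. -/
def covSymbol (ν : ℕ) (A : Bergman ν →L[ℂ] Bergman ν) (z : ℂ) : ℂ :=
  opKernel ν A z z * (1 - (‖z‖ : ℂ) ^ 2) ^ ν

/-- `A = R_ν^*(f)`: the operator `A` satisfies the adjoint relation
`Tr(B A^*) = ∫ R_ν(B) conj(f) dι` for every rank one operator `B = g ⊗ h^*` on `ℋ_ν`, for which
`Tr(B A^*) = ⟨g, A h⟩`. As the operators of finite rank are dense, this determines `A`. -/
def IsSymbolAdjoint (ν : ℕ) (f : ℂ → ℂ) (A : Bergman ν →L[ℂ] Bergman ν) : Prop :=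
  ∀ g h : Bergman ν,
    Integrable (fun z => covSymbol ν (InnerProductSpace.rankOne ℂ g h) z * conj (f z)) invMeasure ∧
    ⟪A h, g⟫_ℂ = ∫ z, covSymbol ν (InnerProductSpace.rankOne ℂ g h) z * conj (f z) ∂invMeasure

open Classical in
/-- The operator `R_ν^*(f)` on `ℋ_ν` (and `0` if there is no such bounded operator). -/
def symbolAdjoint (ν : ℕ) (f : ℂ → ℂ) : Bergman ν →L[ℂ] Bergman ν :=
  if h : ∃ A, IsSymbolAdjoint ν f A then h.choose else 0

/-- The Berezin transform `B_ν = R_ν R_ν^*`. -/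
def berezin (ν : ℕ) (f : ℂ → ℂ) : ℂ → ℂ := covSymbol ν (symbolAdjoint ν f)

/-- The Hilbert space tensor product `ℋ_μ ⊗ ℋ_ν`. -/
abbrev BergmanTensor (μ ν : ℕ) : Type := Completion (Bergman μ ⊗[ℂ] Bergman ν)

/-- `f' = g · f` in `ℋ_ν` for the element `g` of `SU(1,1)` with first row `(a, b)`. -/
def IsTranslate (ν : ℕ) (a b : ℂ) (f f' : Bergman ν) : Prop :=
  ∀ z ∈ disc, f' z =
    ((-b * z + conj a) ^ ν)⁻¹ * f ((a * z - conj b) / (-b * z + conj a))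

/-- `P` is the projection of `ℋ_μ ⊗ ℋ_ν` onto its summand `ℋ_{μ+ν+2k}`: an `SU(1,1)`-equivariant
bounded map whose adjoint is an isometry, i.e. `P P^* = 1`. (It is unique up to a scalar of modulus
one, which cancels in the channel below.) -/
structure IsTensorProjection (μ ν k : ℕ)
    (P : BergmanTensor μ ν →L[ℂ] Bergman (μ + ν + 2 * k)) : Prop where
  comp_adjoint : P ∘L ContinuousLinearMap.adjoint P = ContinuousLinearMap.id ℂ _
  equivariant : ∀ a b : ℂ, ‖a‖ ^ 2 - ‖b‖ ^ 2 = 1 →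
    ∀ (u u' : Bergman μ) (v v' : Bergman ν), IsTranslate μ a b u u' → IsTranslate ν a b v v' →
      IsTranslate (μ + ν + 2 * k) a b
        (P ((u ⊗ₜ[ℂ] v : Bergman μ ⊗[ℂ] Bergman ν) : BergmanTensor μ ν))
        (P ((u' ⊗ₜ[ℂ] v' : Bergman μ ⊗[ℂ] Bergman ν) : BergmanTensor μ ν))

/-- The quantum channel `A ↦ P (A ⊗ 1) P^*`. -/
def channel {μ ν k : ℕ} (P : BergmanTensor μ ν →L[ℂ] Bergman (μ + ν + 2 * k))
    (A : Bergman μ →L[ℂ] Bergman μ) :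
    Bergman (μ + ν + 2 * k) →L[ℂ] Bergman (μ + ν + 2 * k) :=
  P ∘L (A.rTensor (Bergman ν)).completion ∘L ContinuousLinearMap.adjoint P

/-- The map `f ↦ R_{μ+ν+2k} (P (R_μ^*(f) ⊗ 1) P^*)`. -/
def channelSymbol {μ ν k : ℕ} (P : BergmanTensor μ ν →L[ℂ] Bergman (μ + ν + 2 * k))
    (f : ℂ → ℂ) : ℂ → ℂ :=
  covSymbol (μ + ν + 2 * k) (channel P (symbolAdjoint μ f))

/-- The space `L^p(𝔻, dι)`. -/
abbrev DiscLp (p : ℝ≥0∞) : Type := Lp ℂ p invMeasure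

/-- The bounded operator `S` on `L^p(𝔻, dι)` is given by the map `T` on functions. -/
def IsGivenBy (p : ℝ≥0∞) [Fact (1 ≤ p)] (S : DiscLp p →L[ℂ] DiscLp p)
    (T : (ℂ → ℂ) → ℂ → ℂ) : Prop :=
  ∀ f : DiscLp p, S f =ᵐ[invMeasure] T f

/-- The Pochhammer symbol `(x)_k = x (x + 1) ⋯ (x + k - 1)`. -/
def poch (x : ℂ) (k : ℕ) : ℂ := (ascPochhammer ℂ k).eval x

end

/-! Everything reduces to knowing `P^*` on reproducing kernels. View the tensor product as functions
of (x, y). Then `P^* K_z` is a scalar κ times `kernelTensor μ ν k z`, the function (y - x)^k (1 - x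
z̄)^(-μ-k) (1 - y z̄)^(-ν-k), with |κ|² the inverse of `kernelTensorConst` γ = ‖(y - x)^k‖². These
functions have, up to the factor γ, the Gram matrix of the kernels of weight μ+ν+2k
(`inner_kernelTensor`), which gives the existence of P.

Conversely, equivariance forces this form for any P. Rotations show that P(x^i ⊗ y^j)(0) vanishes
unless i + j = k and that P kills total degree below k. Differentiating along hyperbolic elements at
degree k - 1 gives a two-term recursion, which the pairings of (y - x)^k with the monomials also
satisfy. Translating 0 to z gives the formula at every point
(`IsTensorProjection.exists_adjoint_kernelVec`).

Now choose g in SU(1,1) whose Möbius map sends z to 0. Since `A ⊗ 1` acts on the first factor only,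
orthogonality of the monomials in y makes the channel symbol at z a combination of the diagonal
coefficients of `A = R_μ^*(f)` at the vectors g·x^i. Each is an integral of f against t^μ (1 - t)^i,
where t = (1 - |z|²)(1 - |w|²)/|1 - z w̄|² is the invariant kernel
(`norm_discTranslate_monoVec_sq`). As B_m is integration against t^m, expanding (1 - t)^i leaves a
combination of the B_{μ+l}, and two Vandermonde sums evaluate its coefficients
(`channel_coefficient_eq`).

On L^p, B_m is bounded by the Schur test, and `R_m^*(f)` exists by splitting f into an integrable
and a bounded part. The formula for E^ν has a fixed finite number of terms, so norm convergence is
convergence of the scalar coefficients. -/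

/-! ### Polar integration on the disc -/

/-- Polar coordinates for an integrable function on the plane. -/
theorem integral_eq_integral_circleMap {G : ℂ → ℂ} (hGm : Measurable G) (hG : Integrable G) :
    ∫ z, G z = ∫ r in Set.Ioi (0 : ℝ), ∫ θ in Set.Ioo (-Real.pi) Real.pi,
      (r : ℂ) * G (circleMap 0 r θ) := by
  have he : ∀ p : ℝ × ℝ, Complex.polarCoord.symm p = circleMap 0 p.1 p.2 := fun p => by
    rw [Complex.polarCoord_symm_apply, circleMap, Complex.exp_mul_I]
    push_cast
    ring
  have hm : Measurable fun p : ℝ × ℝ => Complex.polarCoord.symm p := by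
    simp only [Complex.polarCoord_symm_apply]
    fun_prop
  have hm1 : Measurable fun p : ℝ × ℝ => p.1 • G (Complex.polarCoord.symm p) :=
    measurable_fst.smul (hGm.comp hm)
  have hi : IntegrableOn (fun p : ℝ × ℝ => p.1 • G (Complex.polarCoord.symm p))
      polarCoord.target := by
    refine ⟨hm1.aestronglyMeasurable, ?_⟩
    have h1 := hG.2
    rw [HasFiniteIntegral, ← Complex.lintegral_comp_polarCoord_symm] at h1
    refine lt_of_le_of_lt (le_of_eq ?_) h1
    refine setLIntegral_congr_fun polarCoord.open_target.measurableSet fun p hp => ?_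
    have : 0 < p.1 := hp.1
    simp only [enorm_smul, smul_eq_mul, Real.enorm_eq_ofReal this.le]
  rw [← Complex.integral_comp_polarCoord_symm, polarCoord_target, Measure.volume_eq_prod,
    setIntegral_prod]
  · simp only [he, Complex.real_smul]
  · rw [← Measure.volume_eq_prod]
    exact hi

theorem integral_weightMeasure_polar {ν : ℕ} {g : ℂ → ℂ} (hgm : Measurable g)
    (hg : Integrable g (weightMeasure ν)) :
    ∫ z, g z ∂weightMeasure ν = ∫ r in Set.Ioo (0 : ℝ) 1,
      ((weightConst ν * (1 - r ^ 2) ^ ν / (Real.pi * (1 - r ^ 2) ^ 2) * r : ℝ) : ℂ) *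
        ∫ θ in Set.Ioo (-Real.pi) Real.pi, g (circleMap 0 r θ) := by
  set w : ℂ → ℝ := fun z => weightConst ν * (1 - ‖z‖ ^ 2) ^ ν / (Real.pi * (1 - ‖z‖ ^ 2) ^ 2)
    with hw
  have hw0 : ∀ z ∈ disc, 0 ≤ w z := fun z hz => by
    have := one_sub_pos hz
    have := weightConst_pos ν
    have := Real.pi_pos
    positivity
  have hwm : Measurable w := by fun_prop
  set G : ℂ → ℂ := disc.indicator fun z => (w z : ℂ) * g z with hGdef
  have hGm : Measurable G := ((Complex.measurable_ofReal.comp hwm).mul hgm).indicator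
    isOpen_disc.measurableSet
  have hG : Integrable G := by
    rw [hGdef, integrable_indicator_iff isOpen_disc.measurableSet]
    unfold weightMeasure at hg
    rw [integrable_withDensity_iff_integrable_smul' (measurable_weight ν) (by simp)] at hg
    refine IntegrableOn.congr_fun hg (fun z hz => ?_) isOpen_disc.measurableSet
    exact (congrArg (· • g z) (ENNReal.toReal_ofReal (hw0 z hz))).trans (Complex.real_smul)
  have h1 : ∫ z, g z ∂weightMeasure ν = ∫ z, G z := by
    unfold weightMeasure
    rw [integral_withDensity_eq_integral_toReal_smul (measurable_weight ν) (by simp),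
      hGdef, integral_indicator isOpen_disc.measurableSet]
    refine setIntegral_congr_fun isOpen_disc.measurableSet fun z hz => ?_
    exact (congrArg (· • g z) (ENNReal.toReal_ofReal (hw0 z hz))).trans (Complex.real_smul)
  rw [h1, integral_eq_integral_circleMap hGm hG]
  have hsub : Set.Ioo (0 : ℝ) 1 ⊆ Set.Ioi 0 := fun r hr => hr.1
  rw [setIntegral_eq_of_subset_of_forall_sdiff_eq_zero measurableSet_Ioi hsub]
  · refine setIntegral_congr_fun measurableSet_Ioo fun r hr => ?_
    rw [← integral_const_mul]
    refine integral_congr_ae (ae_of_all _ fun θ => ?_)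
    have hz : circleMap 0 r θ ∈ disc := by
      simp [disc, abs_of_pos hr.1, hr.2]
    have hn : ‖circleMap 0 r θ‖ = r := by simp [abs_of_pos hr.1]
    simp only [hGdef, Set.indicator_of_mem hz, hw, hn]
    push_cast
    ring
  · rintro r ⟨hr, hr'⟩
    have hr0 : 0 < r := hr
    have : ∀ θ, G (circleMap 0 r θ) = 0 := fun θ => by
      refine Set.indicator_of_notMem (fun h => hr' ⟨hr, ?_⟩) _
      simpa [disc, abs_of_pos hr0] using h
    simp [this]

theorem integral_conj_circleMap_pow_mul (n m : ℕ) (r : ℝ) :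
    ∫ θ in (-Real.pi)..Real.pi, conj (circleMap 0 r θ) ^ n * circleMap 0 r θ ^ m =
      if m = n then 2 * Real.pi * (r : ℂ) ^ (2 * n) else 0 := by
  have h1 : ∀ θ : ℝ, conj (circleMap 0 r θ) ^ n * circleMap 0 r θ ^ m =
      (r : ℂ) ^ (n + m) * Complex.exp (((m : ℂ) - n) * Complex.I * θ) := by
    intro θ
    simp only [circleMap_zero, map_mul, Complex.conj_ofReal, ← Complex.exp_conj, mul_pow,
      ← Complex.exp_nat_mul, Complex.conj_I]
    rw [show ((m : ℂ) - n) * Complex.I * θ = n * (θ * -Complex.I) + m * (θ * Complex.I) by ring,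
      Complex.exp_add]
    ring
  simp only [h1, intervalIntegral.integral_const_mul]
  split_ifs with h
  · subst h
    simp
    ring
  · have hc : ((m : ℂ) - n) * Complex.I ≠ 0 :=
      mul_ne_zero (sub_ne_zero.2 (by exact_mod_cast h)) Complex.I_ne_zero
    rw [integral_exp_mul_complex hc]
    -- The exponents at the two endpoints differ by the integer multiple (m - n) of 2πi, so the
    -- primitive takes the same value at both.
    have h2 : Complex.exp (((m : ℂ) - n) * Complex.I * (Real.pi : ℝ)) =
        Complex.exp (((m : ℂ) - n) * Complex.I * ((-Real.pi : ℝ) : ℂ)) := by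
      rw [Complex.exp_eq_exp_iff_exists_int]
      refine ⟨(m : ℤ) - n, ?_⟩
      push_cast
      ring
    rw [h2]
    simp

/-- Termwise integration is legitimate because on the circle of radius r the power series is
dominated by its absolute values at the point r; orthogonality then leaves one term. -/
theorem integral_conj_circleMap_pow_mul_of_hasSum {f : ℂ → ℂ} {c : ℕ → ℂ}
    (hf : ∀ z ∈ disc, HasSum (fun m => c m * z ^ m) (f z)) (n : ℕ) {r : ℝ} (hr : r ∈ Set.Ioo (0 : ℝ) 1) :
    ∫ θ in (-Real.pi)..Real.pi, conj (circleMap 0 r θ) ^ n * f (circleMap 0 r θ) =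
      2 * Real.pi * (r : ℂ) ^ (2 * n) * c n := by
  have hmem : ∀ θ, circleMap 0 r θ ∈ disc := fun θ => by simp [disc, abs_of_pos hr.1, hr.2]
  have hs : Summable fun m => ‖c m‖ * r ^ m := by
    have := (hf r (by simpa [disc, abs_of_pos hr.1] using hr.2)).summable.norm
    simpa [abs_of_pos hr.1] using this
  have h1 := intervalIntegral.hasSum_integral_of_dominated_convergence (μ := volume)
    (a := -Real.pi) (b := Real.pi)
    (F := fun m θ => conj (circleMap 0 r θ) ^ n * (c m * circleMap 0 r θ ^ m))
    (f := fun θ => conj (circleMap 0 r θ) ^ n * f (circleMap 0 r θ))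
    (fun m _ => r ^ n * (‖c m‖ * r ^ m))
    (fun m => by
      have := continuous_circleMap 0 r
      exact (by fun_prop : Continuous fun θ => conj (circleMap 0 r θ) ^ n *
        (c m * circleMap 0 r θ ^ m)).aestronglyMeasurable)
    (fun m => ae_of_all _ fun θ _ => by simp [abs_of_pos hr.1])
    (ae_of_all _ fun θ _ => hs.mul_left _)
    (by simp)
    (ae_of_all _ fun θ _ => (hf _ (hmem θ)).mul_left _)
  refine h1.unique ?_
  have h2 : ∀ m, ∫ θ in (-Real.pi)..Real.pi, conj (circleMap 0 r θ) ^ n *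
      (c m * circleMap 0 r θ ^ m) = if m = n then 2 * Real.pi * (r : ℂ) ^ (2 * n) * c n else 0 := by
    intro m
    have : ∀ θ, conj (circleMap 0 r θ) ^ n * (c m * circleMap 0 r θ ^ m) =
        c m * (conj (circleMap 0 r θ) ^ n * circleMap 0 r θ ^ m) := fun θ => by ring
    simp only [this, intervalIntegral.integral_const_mul, integral_conj_circleMap_pow_mul]
    split_ifs with h
    · rw [h]; ring
    · simp
  simp only [h2]
  exact hasSum_ite_eq n _

/-- This is the Beta integral in the variable r². The induction trades a power of r² for a power of
1 - r² by integrating an exact derivative whose primitive vanishes at 0 and 1. -/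
theorem integral_pow_mul_one_sub_sq_pow (n m : ℕ) :
    ∫ r in (0 : ℝ)..1, 2 * r * r ^ (2 * n) * (1 - r ^ 2) ^ m =
      (n.factorial * m.factorial / (n + m + 1).factorial : ℝ) := by
  induction n generalizing m with
  | zero =>
    have h : ∀ x ∈ Set.uIcc (0 : ℝ) 1, HasDerivAt (fun r : ℝ => -(1 - r ^ 2) ^ (m + 1) / (m + 1))
        (2 * x * x ^ (2 * 0) * (1 - x ^ 2) ^ m) x := by
      intro x _
      have h1 := (((hasDerivAt_pow 2 x).const_sub 1).fun_pow (m + 1)).fun_neg.div_const ((m : ℝ) + 1)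
      refine h1.congr_deriv ?_
      push_cast
      simp
      field_simp
    rw [intervalIntegral.integral_eq_sub_of_hasDerivAt h
      (by apply Continuous.intervalIntegrable; fun_prop), zero_add, Nat.factorial_succ]
    have := m.factorial_ne_zero
    push_cast
    simp
    field_simp
  | succ n ih =>
    have h : ∀ x ∈ Set.uIcc (0 : ℝ) 1, HasDerivAt
        (fun r : ℝ => r ^ (2 * (n + 1)) * (1 - r ^ 2) ^ (m + 1))
        ((n + 1) * (2 * x * x ^ (2 * n) * (1 - x ^ 2) ^ (m + 1)) -
          (m + 1) * (2 * x * x ^ (2 * (n + 1)) * (1 - x ^ 2) ^ m)) x := by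
      intro x _
      have h1 := (hasDerivAt_pow (2 * (n + 1)) x).fun_mul
        (((hasDerivAt_pow 2 x).const_sub 1).fun_pow (m + 1))
      refine h1.congr_deriv ?_
      rw [show 2 * (n + 1) - 1 = 2 * n + 1 by omega]
      simp
      ring
    have h2 := intervalIntegral.integral_eq_sub_of_hasDerivAt h
      (by apply Continuous.intervalIntegrable; fun_prop)
    rw [intervalIntegral.integral_sub (by apply Continuous.intervalIntegrable; fun_prop)
      (by apply Continuous.intervalIntegrable; fun_prop), intervalIntegral.integral_const_mul,
      intervalIntegral.integral_const_mul, ih (m + 1)] at h2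
    simp only [one_pow, sub_self, ne_eq, Nat.add_eq_zero_iff, one_ne_zero, and_false,
      not_false_eq_true, zero_pow, mul_zero, mul_eq_zero, OfNat.ofNat_ne_zero, zero_mul,
      false_or] at h2
    have h3 : ((m : ℝ) + 1) ≠ 0 := by positivity
    rw [show n + 1 + m + 1 = n + (m + 1) + 1 by ring, Nat.factorial_succ n]
    rw [Nat.factorial_succ m] at h2
    push_cast at h2 ⊢
    have := (n + (m + 1) + 1).factorial_ne_zero
    field_simp at h2 ⊢
    rw [mul_zero, mul_eq_zero] at h2
    have h4 := h2.resolve_left h3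
    linarith

/-! ### Bounded holomorphic functions and monomials in the weighted space -/

theorem mem_disc_iff {z : ℂ} : z ∈ disc ↔ ‖z‖ < 1 := by simp [disc]

theorem zero_mem_disc : (0 : ℂ) ∈ disc := by simp [disc]

/-- A bounded holomorphic function on the disc. -/
def IsBoundedHolomorphic (f : ℂ → ℂ) : Prop :=
  DifferentiableOn ℂ f disc ∧ ∃ C : ℝ, ∀ z ∈ disc, ‖f z‖ ≤ C

theorem indicator_mem_bergmanSubmodule {ν : ℕ} (hν : 2 ≤ ν) {f : ℂ → ℂ}
    (hf : IsBoundedHolomorphic f) : disc.indicator f ∈ bergmanSubmodule ν := by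
  obtain ⟨hd, C, hC⟩ := hf
  have := isFiniteMeasure_weightMeasure hν
  have hd' : DifferentiableOn ℂ (disc.indicator f) disc :=
    hd.congr fun z hz => Set.indicator_of_mem hz _
  have hm : Measurable (disc.indicator f) := by
    classical
    rw [← Set.piecewise_eq_indicator]
    exact hd.continuousOn.measurable_piecewise continuousOn_const isOpen_disc.measurableSet
  refine ⟨hd', fun z hz => Set.indicator_of_notMem hz _,
    MemLp.of_bound hm.aestronglyMeasurable C (ae_of_all _ fun z => ?_)⟩
  by_cases hz : z ∈ disc
  · rw [Set.indicator_of_mem hz]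
    exact hC z hz
  · rw [Set.indicator_of_notMem hz, norm_zero]
    exact (norm_nonneg _).trans (hC 0 zero_mem_disc)

open Classical in
/-- A bounded holomorphic function as an element of `ℋ_ν` (and `0` for other functions). -/
noncomputable def Bergman.ofFun (ν : ℕ) (f : ℂ → ℂ) : Bergman ν :=
  if h : 2 ≤ ν ∧ IsBoundedHolomorphic f then
    ⟨disc.indicator f, indicator_mem_bergmanSubmodule h.1 h.2⟩ else 0

theorem Bergman.ofFun_apply {ν : ℕ} (hν : 2 ≤ ν) {f : ℂ → ℂ} (hf : IsBoundedHolomorphic f) {z : ℂ}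
    (hz : z ∈ disc) : Bergman.ofFun ν f z = f z := by
  have h : Bergman.ofFun ν f = (⟨disc.indicator f, indicator_mem_bergmanSubmodule hν hf⟩ :
      bergmanSubmodule ν) := dif_pos ⟨hν, hf⟩
  exact (congrFun (congrArg Subtype.val h) z).trans (Set.indicator_of_mem hz _)

theorem kernelVec_apply {ν : ℕ} (hν : 2 ≤ ν) {w z : ℂ} (hw : w ∈ disc) (hz : z ∈ disc) :
    kernelVec ν w z = ((1 - z * conj w) ^ ν)⁻¹ := by
  have h : kernelVec ν w = (⟨kernelFun ν w, kernelFun_mem hν hw⟩ : bergmanSubmodule ν) :=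
    dif_pos ⟨hν, hw⟩
  exact (congrFun (congrArg Subtype.val h) z).trans
    (Set.indicator_of_mem hz fun z => ((1 - z * conj w) ^ ν)⁻¹)

theorem isBoundedHolomorphic_pow (n : ℕ) : IsBoundedHolomorphic fun z => z ^ n := by
  refine ⟨by fun_prop, 1, fun z hz => ?_⟩
  rw [norm_pow]
  exact pow_le_one₀ (norm_nonneg z) (mem_disc_iff.1 hz).le

theorem IsBoundedHolomorphic.mul {f g : ℂ → ℂ} (hf : IsBoundedHolomorphic f)
    (hg : IsBoundedHolomorphic g) : IsBoundedHolomorphic fun z => f z * g z := by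
  obtain ⟨hf, C, hC⟩ := hf
  obtain ⟨hg, D, hD⟩ := hg
  refine ⟨hf.mul hg, C * D, fun z hz => ?_⟩
  rw [norm_mul]
  have := hC z hz
  exact mul_le_mul this (hD z hz) (norm_nonneg _) ((norm_nonneg _).trans this)

theorem IsBoundedHolomorphic.pow {f : ℂ → ℂ} (hf : IsBoundedHolomorphic f) (n : ℕ) :
    IsBoundedHolomorphic fun z => f z ^ n := by
  induction n with
  | zero => exact ⟨by simp, 1, fun z _ => by simp⟩
  | succ n ih => simpa only [pow_succ] using ih.mul hf

theorem norm_one_sub_mul_conj_ge {z w : ℂ} (hz : z ∈ disc) :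
    1 - ‖w‖ ≤ ‖1 - z * conj w‖ := by
  have h1 : ‖(1 : ℂ)‖ - ‖z * conj w‖ ≤ ‖1 - z * conj w‖ := norm_sub_norm_le _ _
  rw [norm_one, norm_mul, RCLike.norm_conj] at h1
  nlinarith [norm_nonneg w, mem_disc_iff.1 hz]

theorem one_sub_mul_conj_ne_zero {z w : ℂ} (hz : z ∈ disc) (hw : w ∈ disc) :
    1 - z * conj w ≠ 0 := by
  intro h
  have := norm_one_sub_mul_conj_ge (w := w) hz
  rw [h, norm_zero] at this
  linarith [mem_disc_iff.1 hw]

theorem isBoundedHolomorphic_kernel {w : ℂ} (hw : w ∈ disc) :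
    IsBoundedHolomorphic fun z => (1 - z * conj w)⁻¹ := by
  refine ⟨DifferentiableOn.inv (by fun_prop) fun z hz => one_sub_mul_conj_ne_zero hz hw,
    (1 - ‖w‖)⁻¹, fun z hz => ?_⟩
  rw [norm_inv]
  have := mem_disc_iff.1 hw
  exact inv_anti₀ (by linarith) (norm_one_sub_mul_conj_ge hz)

/-- The monomial `z ^ n` in `ℋ_ν`. -/
noncomputable def monoVec (ν n : ℕ) : Bergman ν := Bergman.ofFun ν fun z => z ^ n

theorem monoVec_apply {ν : ℕ} (hν : 2 ≤ ν) (n : ℕ) {z : ℂ} (hz : z ∈ disc) :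
    monoVec ν n z = z ^ n := Bergman.ofFun_apply hν (isBoundedHolomorphic_pow n) hz

/-- Angular integration isolates the n-th Taylor coefficient and radial integration is a Beta
integral. Because f is arbitrary, no norm convergence of Taylor series is needed. -/
theorem inner_monoVec_of_hasSum {ν : ℕ} (hν : 2 ≤ ν) (f : Bergman ν) {c : ℕ → ℂ}
    (hf : ∀ z ∈ disc, HasSum (fun m => c m * z ^ m) (f z)) (n : ℕ) :
    ⟪monoVec ν n, f⟫_ℂ = c n / ((n + ν - 1).choose n : ℕ) := by
  -- The shift by 2 absorbs the factor (1 - r²)^(-2) of the invariant measure.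
  obtain ⟨m, rfl⟩ : ∃ m, ν = m + 2 := ⟨ν - 2, by omega⟩
  refine (integral_weightMeasure_polar
    ((Complex.continuous_conj.measurable.comp (Bergman.measurable _)).mul f.measurable)
    (Bergman.integrable_inner (monoVec (m + 2) n) f)).trans ?_
  have h1 : ∀ r ∈ Set.Ioo (0 : ℝ) 1, ((weightConst (m + 2) * (1 - r ^ 2) ^ (m + 2) /
      (Real.pi * (1 - r ^ 2) ^ 2) * r : ℝ) : ℂ) * ∫ θ in Set.Ioo (-Real.pi) Real.pi,
        conj (monoVec (m + 2) n (circleMap 0 r θ)) * f (circleMap 0 r θ) =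
      ((2 * r * r ^ (2 * n) * (1 - r ^ 2) ^ m : ℝ) : ℂ) * ((m + 1) * c n) := by
    intro r hr
    have hmem : ∀ θ, circleMap 0 r θ ∈ disc := fun θ => by simp [disc, abs_of_pos hr.1, hr.2]
    have h2 : (0 : ℝ) < 1 - r ^ 2 := by nlinarith [hr.1, hr.2]
    have h3 := integral_conj_circleMap_pow_mul_of_hasSum hf n hr
    rw [intervalIntegral.integral_of_le (by linarith [Real.pi_pos]),
      integral_Ioc_eq_integral_Ioo] at h3
    simp only [monoVec_apply hν n (hmem _), map_pow, h3]
    rw [weightConst, if_pos hν]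
    push_cast
    have h4 : (1 - (r : ℂ) ^ 2) ≠ 0 := by exact_mod_cast h2.ne'
    have h5 : (Real.pi : ℂ) ≠ 0 := by exact_mod_cast Real.pi_ne_zero
    field_simp
    ring
  refine (setIntegral_congr_fun measurableSet_Ioo h1).trans ?_
  rw [integral_mul_const, integral_complex_ofReal,
    ← integral_Ioc_eq_integral_Ioo, ← intervalIntegral.integral_of_le zero_le_one,
    integral_pow_mul_one_sub_sq_pow, show n + (m + 2) - 1 = n + m + 1 by omega,
    Nat.choose_eq_factorial_div_factorial (by omega), show n + m + 1 - n = m + 1 by omega]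
  have h6 : n.factorial * (m + 1).factorial ∣ (n + m + 1).factorial := by
    have := Nat.factorial_mul_factorial_dvd_factorial (n := n + m + 1) (k := n) (by omega)
    rwa [show n + m + 1 - n = m + 1 by omega] at this
  rw [Nat.cast_div h6 (by exact_mod_cast (Nat.mul_pos n.factorial_pos (m + 1).factorial_pos).ne'), Nat.factorial_succ m]
  have := n.factorial_ne_zero
  have := m.factorial_ne_zero
  have := (n + m + 1).factorial_ne_zero
  have : (m : ℂ) + 1 ≠ 0 := by exact_mod_cast m.succ_ne_zero
  push_cast
  field_simp

theorem inner_monoVec_monoVec {ν : ℕ} (hν : 2 ≤ ν) (n m : ℕ) :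
    ⟪monoVec ν n, monoVec ν m⟫_ℂ = if n = m then (((n + ν - 1).choose n : ℕ) : ℂ)⁻¹ else 0 := by
  rw [inner_monoVec_of_hasSum hν _ (c := fun i => if i = m then 1 else 0) ?_ n]
  · split_ifs <;> simp
  · intro z hz
    rw [monoVec_apply hν m hz]
    convert hasSum_ite_eq m (z ^ m) using 2 with i
    split_ifs with h <;> simp [h]

theorem norm_monoVec_le_one {ν : ℕ} (hν : 2 ≤ ν) (n : ℕ) : ‖monoVec ν n‖ ≤ 1 := by
  have h := inner_self_eq_norm_sq_to_K (𝕜 := ℂ) (monoVec ν n)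
  rw [inner_monoVec_monoVec hν, if_pos rfl] at h
  have h2 : ‖monoVec ν n‖ ^ 2 = (((n + ν - 1).choose n : ℕ) : ℝ)⁻¹ := by
    apply Complex.ofReal_injective
    rw [Complex.ofReal_pow]
    push_cast
    exact h.symm
  have h3 : 1 ≤ (((n + ν - 1).choose n : ℕ) : ℝ) := by
    exact_mod_cast Nat.choose_pos (by omega)
  have h4 := inv_le_one_of_one_le₀ h3
  have := norm_nonneg (monoVec ν n)
  nlinarith

/-! ### The reproducing kernel and total families -/

theorem hasSum_choose_mul_pow {ν : ℕ} (hν : 1 ≤ ν) {x : ℂ} (hx : ‖x‖ < 1) :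
    HasSum (fun n => (((n + ν - 1).choose n : ℕ) : ℂ) * x ^ n) ((1 - x) ^ ν)⁻¹ := by
  obtain ⟨m, rfl⟩ : ∃ m, ν = m + 1 := ⟨ν - 1, by omega⟩
  have h := hasSum_choose_mul_geometric_of_norm_lt_one m hx
  rw [one_div] at h
  refine h.congr_fun fun n => ?_
  rw [show n + (m + 1) - 1 = n + m by omega, Nat.choose_symm_add]

/-- Evaluation at a point as a continuous linear functional. -/
noncomputable def Bergman.evalL (ν : ℕ) {z : ℂ} (hz : z ∈ disc) : Bergman ν →L[ℂ] ℂ :=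
  LinearMap.mkContinuousOfExistsBound
    { toFun := fun f => f z
      map_add' := fun _ _ => rfl
      map_smul' := fun _ _ => rfl } (by
    obtain ⟨C, hC⟩ := Bergman.exists_bound_of_isCompact ν (isCompact_singleton (x := z))
      (by simpa using hz)
    exact ⟨C, fun f => hC f z rfl⟩)

theorem Bergman.evalL_apply (ν : ℕ) {z : ℂ} (hz : z ∈ disc) (f : Bergman ν) :
    Bergman.evalL ν hz f = f z := rfl

/-- Monomials have norm at most one, so the series converges in norm by comparison with the scalar
binomial series at w̄; its limit is identified by point evaluations, which are continuous. -/
theorem hasSum_kernelVec {ν : ℕ} (hν : 2 ≤ ν) {w : ℂ} (hw : w ∈ disc) :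
    HasSum (fun n => ((((n + ν - 1).choose n : ℕ) : ℂ) * conj w ^ n) • monoVec ν n)
      (kernelVec ν w) := by
  have hw1 := mem_disc_iff.1 hw
  have hs : Summable fun n => ((((n + ν - 1).choose n : ℕ) : ℂ) * conj w ^ n) • monoVec ν n := by
    refine Summable.of_norm_bounded (hasSum_choose_mul_pow (ν := ν) (by omega)
      (x := conj w) (by simpa using hw1)).summable.norm fun n => ?_
    rw [norm_smul]
    exact mul_le_of_le_one_right (norm_nonneg _) (norm_monoVec_le_one hν n)
  obtain ⟨S, hS⟩ := hs
  suffices S = kernelVec ν w by rwa [← this]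
  refine Bergman.ext fun z hz => ?_
  have h1 := (Bergman.evalL ν hz).hasSum hS
  rw [kernelVec_apply hν hw hz]
  refine h1.unique ?_
  convert hasSum_choose_mul_pow (ν := ν) (by omega) (x := z * conj w) ?_ using 2 with n
  · rw [map_smul, Bergman.evalL_apply, monoVec_apply hν n hz, smul_eq_mul]
    ring
  · rw [norm_mul, RCLike.norm_conj]
    nlinarith [mem_disc_iff.1 hz, norm_nonneg z, norm_nonneg w]

theorem Bergman.exists_hasSum {ν : ℕ} (f : Bergman ν) :
    ∃ c : ℕ → ℂ, ∀ z ∈ disc, HasSum (fun m => c m * z ^ m) (f z) := by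
  refine ⟨fun n => (n.factorial : ℂ)⁻¹ * iteratedDeriv n f 0, fun z hz => ?_⟩
  refine (Complex.hasSum_taylorSeries_on_ball (c := 0) (r := 1) f.differentiableOn hz).congr_fun
    fun n => ?_
  rw [sub_zero, smul_eq_mul, smul_eq_mul]
  ring

/-- The reproducing property. -/
theorem inner_kernelVec {ν : ℕ} (hν : 2 ≤ ν) {w : ℂ} (hw : w ∈ disc) (f : Bergman ν) :
    ⟪kernelVec ν w, f⟫_ℂ = f w := by
  obtain ⟨c, hc⟩ := f.exists_hasSum
  have h1 := (innerSL ℂ f).hasSum (hasSum_kernelVec hν hw)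
  have h2 := h1.star
  have h3 : ⟪kernelVec ν w, f⟫_ℂ = conj ⟪f, kernelVec ν w⟫_ℂ := (inner_conj_symm _ _).symm
  rw [h3]
  refine h2.unique ?_
  refine (hc w hw).congr_fun fun n => ?_
  have h4 : ((n + ν - 1).choose n : ℂ) ≠ 0 := by
    exact_mod_cast (Nat.choose_pos (by omega)).ne'
  -- The squared norm of z^n is the inverse of the coefficient of z^n in the kernel, so the two
  -- cancel and the Taylor series of f remains.
  have h5 := inner_monoVec_of_hasSum hν f hc n
  rw [← inner_conj_symm] at h5
  simp [h5]
  field_simp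

/-- A map of a total family of vectors that preserves inner products extends to an isometry. -/
theorem exists_linearIsometry_of_inner_eq {ι E F : Type*} [NormedAddCommGroup E]
    [InnerProductSpace ℂ E] [NormedAddCommGroup F] [InnerProductSpace ℂ F] [CompleteSpace F]
    (k : ι → E) (ψ : ι → F) (hk : Dense (Submodule.span ℂ (Set.range k) : Set E))
    (h : ∀ i j, ⟪ψ i, ψ j⟫_ℂ = ⟪k i, k j⟫_ℂ) :
    ∃ W : E →ₗᵢ[ℂ] F, ∀ i, W (k i) = ψ i := by
  set e := Finsupp.linearCombination ℂ k with he
  set f := Finsupp.linearCombination ℂ ψ with hf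
  have hdense : DenseRange e := by
    rwa [← Finsupp.range_linearCombination, ← he] at hk
  have hinner : ∀ x, ⟪f x, f x⟫_ℂ = ⟪e x, e x⟫_ℂ := fun x => by
    rw [hf, he, Finsupp.linearCombination_apply, Finsupp.linearCombination_apply]
    simp only [Finsupp.sum, sum_inner, inner_sum, inner_smul_left, inner_smul_right, h]
  have hnorm : ∀ x, ‖f x‖ = ‖e x‖ := fun x => by
    rw [@norm_eq_sqrt_re_inner ℂ, @norm_eq_sqrt_re_inner ℂ, hinner]
  have hb : ∃ C, ∀ x, ‖f x‖ ≤ C * ‖e x‖ := ⟨1, fun x => by rw [one_mul, hnorm]⟩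
  have hext : ∀ x, f.extendOfNorm e (e x) = f x := LinearMap.extendOfNorm_eq hdense hb
  refine ⟨⟨(f.extendOfNorm e).toLinearMap, fun x => ?_⟩, fun i => ?_⟩
  · refine hdense.induction_on (p := fun x => ‖f.extendOfNorm e x‖ = ‖x‖) x ?_ fun y => ?_
    · exact isClosed_eq (f.extendOfNorm e).continuous.norm continuous_norm
    · rw [hext, hnorm]
  · have := hext (Finsupp.single i 1)
    simpa [he, hf] using this

/-- A vector orthogonal to all kernels vanishes at every point. -/
theorem dense_span_kernelVec {ν : ℕ} (hν : 2 ≤ ν) :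
    Dense (Submodule.span ℂ (kernelVec ν '' disc) : Set (Bergman ν)) := by
  rw [Submodule.dense_iff_topologicalClosure_eq_top, Submodule.topologicalClosure_eq_top_iff,
    Submodule.eq_bot_iff]
  intro f hf
  refine Bergman.ext fun z hz => ?_
  have h1 := (Submodule.mem_orthogonal _ f).1 hf _ (Submodule.subset_span ⟨z, hz, rfl⟩)
  rw [inner_kernelVec hν hz] at h1
  exact h1

theorem dense_span_monoVec {ν : ℕ} (hν : 2 ≤ ν) :
    Dense (Submodule.span ℂ (Set.range (monoVec ν)) : Set (Bergman ν)) := by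
  rw [Submodule.dense_iff_topologicalClosure_eq_top, Submodule.topologicalClosure_eq_top_iff,
    Submodule.eq_bot_iff]
  intro f hf
  obtain ⟨c, hc⟩ := f.exists_hasSum
  have h1 : ∀ n, c n = 0 := fun n => by
    have h2 := (Submodule.mem_orthogonal _ f).1 hf _ (Submodule.subset_span ⟨n, rfl⟩)
    rw [inner_monoVec_of_hasSum hν f hc, div_eq_zero_iff] at h2
    exact h2.resolve_right (by exact_mod_cast (Nat.choose_pos (by omega)).ne')
  refine Bergman.ext fun z hz => ?_
  have h2 := hc z hz
  simp only [h1, zero_mul] at h2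
  exact h2.unique hasSum_zero

theorem continuousLinearMap_ext_kernelVec {ν : ℕ} (hν : 2 ≤ ν) {F : Type*} [NormedAddCommGroup F]
    [NormedSpace ℂ F] {S T : Bergman ν →L[ℂ] F}
    (h : ∀ w ∈ disc, S (kernelVec ν w) = T (kernelVec ν w)) : S = T :=
  ContinuousLinearMap.ext_on (dense_span_kernelVec hν) (by rintro _ ⟨w, hw, rfl⟩; exact h w hw)

theorem kernelVec_zero {ν : ℕ} (hν : 2 ≤ ν) : kernelVec ν 0 = monoVec ν 0 :=
  Bergman.ext fun z hz => by
    rw [kernelVec_apply hν zero_mem_disc hz, monoVec_apply hν 0 hz]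
    simp

/-! ### Möbius transformations and the unitary action -/

/-- The automorphy factor `ā - b z`. -/
noncomputable def autFactor (a b z : ℂ) : ℂ := -b * z + conj a

/-- The Möbius transformation `z ↦ (a z - b̄) / (ā - b z)`. -/
noncomputable def mobius (a b z : ℂ) : ℂ := (a * z - conj b) / (-b * z + conj a)

section mobius

variable {a b : ℂ}

theorem conj_mul_sub_conj_mul (h : ‖a‖ ^ 2 - ‖b‖ ^ 2 = 1) : a * conj a - b * conj b = 1 := by
  rw [Complex.mul_conj, Complex.mul_conj, Complex.normSq_eq_norm_sq, Complex.normSq_eq_norm_sq]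
  exact_mod_cast h

theorem autFactor_ne_zero (h : ‖a‖ ^ 2 - ‖b‖ ^ 2 = 1) {z : ℂ} (hz : z ∈ disc) :
    autFactor a b z ≠ 0 := by
  intro h0
  have h1 : conj a = b * z := by
    rw [autFactor] at h0
    linear_combination h0
  have h2 : ‖a‖ = ‖b‖ * ‖z‖ := by rw [← norm_mul, ← h1, RCLike.norm_conj]
  have h3 := mem_disc_iff.1 hz
  have h4 : ‖b‖ * ‖z‖ ≤ ‖b‖ := mul_le_of_le_one_right (norm_nonneg b) h3.le
  nlinarith [norm_nonneg a, norm_nonneg b]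

/-- This transformation law underlies all the equivariance below: it gives unitarity of the action,
covariance of the kernel tensors and invariance of the Berezin kernel. -/
theorem one_sub_mobius_mul_conj (h : ‖a‖ ^ 2 - ‖b‖ ^ 2 = 1) {z w : ℂ} (hz : z ∈ disc)
    (hw : w ∈ disc) : 1 - mobius a b z * conj (mobius a b w) =
      (1 - z * conj w) / (autFactor a b z * conj (autFactor a b w)) := by
  have h1 := autFactor_ne_zero h hz
  have h2 : conj (autFactor a b w) ≠ 0 := by simpa using autFactor_ne_zero h hw
  have h3 := conj_mul_sub_conj_mul h
  rw [eq_div_iff (mul_ne_zero h1 h2)]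
  have h4 : mobius a b z * autFactor a b z = a * z - conj b := div_mul_cancel₀ _ h1
  have h5 : conj (mobius a b w) * conj (autFactor a b w) = conj a * conj w - b := by
    rw [← map_mul]
    have : mobius a b w * autFactor a b w = a * w - conj b :=
      div_mul_cancel₀ _ (autFactor_ne_zero h hw)
    simp [this]
  calc (1 - mobius a b z * conj (mobius a b w)) * (autFactor a b z * conj (autFactor a b w))
      = autFactor a b z * conj (autFactor a b w) - (mobius a b z * autFactor a b z) *
        (conj (mobius a b w) * conj (autFactor a b w)) := by ring
    _ = 1 - z * conj w := by
      rw [h4, h5]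
      simp only [autFactor, map_add, map_mul, map_neg, Complex.conj_conj]
      linear_combination (1 - z * conj w) * h3

theorem one_sub_norm_mobius_sq (h : ‖a‖ ^ 2 - ‖b‖ ^ 2 = 1) {z : ℂ} (hz : z ∈ disc) :
    1 - ‖mobius a b z‖ ^ 2 = (1 - ‖z‖ ^ 2) / ‖autFactor a b z‖ ^ 2 := by
  have h1 := one_sub_mobius_mul_conj h hz hz
  simp only [Complex.mul_conj, Complex.normSq_eq_norm_sq] at h1
  exact_mod_cast h1

theorem mobius_mem_disc (h : ‖a‖ ^ 2 - ‖b‖ ^ 2 = 1) {z : ℂ} (hz : z ∈ disc) :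
    mobius a b z ∈ disc := by
  have h1 := one_sub_norm_mobius_sq h hz
  have h2 : 0 < (1 - ‖z‖ ^ 2) / ‖autFactor a b z‖ ^ 2 :=
    div_pos (one_sub_pos hz) (pow_pos (norm_pos_iff.2 (autFactor_ne_zero h hz)) 2)
  rw [mem_disc_iff]
  nlinarith [norm_nonneg (mobius a b z)]

/-- The row (ā, -b) is the first row of the inverse matrix, so every statement about (a, b) also
applies to the inverse element. -/
theorem norm_sq_sub_inv (h : ‖a‖ ^ 2 - ‖b‖ ^ 2 = 1) : ‖conj a‖ ^ 2 - ‖-b‖ ^ 2 = 1 := by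
  rwa [RCLike.norm_conj, norm_neg]

theorem autFactor_inv_mobius (h : ‖a‖ ^ 2 - ‖b‖ ^ 2 = 1) {z : ℂ} (hz : z ∈ disc) :
    autFactor (conj a) (-b) (mobius a b z) = (autFactor a b z)⁻¹ := by
  have h4 : mobius a b z * autFactor a b z = a * z - conj b :=
    div_mul_cancel₀ _ (autFactor_ne_zero h hz)
  refine eq_inv_of_mul_eq_one_left ?_
  rw [autFactor, neg_neg, Complex.conj_conj, add_mul, mul_assoc, h4, autFactor]
  linear_combination conj_mul_sub_conj_mul h

theorem mobius_inv_mobius (h : ‖a‖ ^ 2 - ‖b‖ ^ 2 = 1) {z : ℂ} (hz : z ∈ disc) :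
    mobius (conj a) (-b) (mobius a b z) = z := by
  have h4 : mobius a b z * autFactor a b z = a * z - conj b :=
    div_mul_cancel₀ _ (autFactor_ne_zero h hz)
  rw [mobius, ← autFactor, autFactor_inv_mobius h hz, div_inv_eq_mul, sub_mul, mul_assoc, h4,
    autFactor, map_neg]
  linear_combination z * conj_mul_sub_conj_mul h

theorem mobius_mobius_inv (h : ‖a‖ ^ 2 - ‖b‖ ^ 2 = 1) {z : ℂ} (hz : z ∈ disc) :
    mobius a b (mobius (conj a) (-b) z) = z := by
  have := mobius_inv_mobius (norm_sq_sub_inv h) hz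
  simpa using this

theorem inner_kernelVec_kernelVec {ν : ℕ} (hν : 2 ≤ ν) {z w : ℂ} (hz : z ∈ disc) (hw : w ∈ disc) :
    ⟪kernelVec ν z, kernelVec ν w⟫_ℂ = ((1 - z * conj w) ^ ν)⁻¹ := by
  rw [inner_kernelVec hν hz, kernelVec_apply hν hw hz]

/-- The action of `SU(1,1)` on `ℋ_ν` is by isometries. -/
theorem exists_discTranslate {ν : ℕ} (hν : 2 ≤ ν) (h : ‖a‖ ^ 2 - ‖b‖ ^ 2 = 1) :
    ∃ U : Bergman ν →ₗᵢ[ℂ] Bergman ν, ∀ f, IsTranslate ν a b f (U f) := by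
  have hker : ∀ s ∈ disc, ∀ t ∈ disc, ((1 - mobius a b s * conj (mobius a b t)) ^ ν)⁻¹ =
      autFactor a b s ^ ν * conj (autFactor a b t) ^ ν * ((1 - s * conj t) ^ ν)⁻¹ := by
    intro s hs t ht
    rw [one_sub_mobius_mul_conj h hs ht, div_pow, inv_div, mul_pow, div_eq_mul_inv]
  -- The action sends the kernel at g(t) to a multiple of the kernel at t. Prescribing U on kernels
  -- in this way makes the isometry property a comparison of Gram matrices and avoids a change of
  -- variables.
  obtain ⟨U, hU⟩ := exists_linearIsometry_of_inner_eq (E := Bergman ν) (F := Bergman ν)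
    (fun t : disc => kernelVec ν (mobius a b t))
    (fun t : disc => conj (autFactor a b t) ^ ν • kernelVec ν t) (by
      suffices hr : (Set.range fun t : disc => kernelVec ν (mobius a b t)) = kernelVec ν '' disc by
        rw [hr]
        exact dense_span_kernelVec hν
      ext f
      constructor
      · rintro ⟨t, rfl⟩
        exact ⟨_, mobius_mem_disc h t.2, rfl⟩
      · rintro ⟨s, hs, rfl⟩
        exact ⟨⟨_, mobius_mem_disc (norm_sq_sub_inv h) hs⟩, by
          simp only [mobius_mobius_inv h hs]⟩) (by
      rintro ⟨s, hs⟩ ⟨t, ht⟩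
      rw [inner_smul_left, inner_smul_right, inner_kernelVec_kernelVec hν hs ht,
        inner_kernelVec_kernelVec hν (mobius_mem_disc h hs) (mobius_mem_disc h ht), hker s hs t ht]
      simp only [map_pow, Complex.conj_conj]
      ring)
  refine ⟨U, fun f z hz => ?_⟩
  -- Both sides of the action formula at z are continuous in f, so it suffices to compare them on
  -- kernels.
  have h1 : (Bergman.evalL ν hz) ∘L U.toContinuousLinearMap =
      (autFactor a b z ^ ν)⁻¹ • Bergman.evalL ν (mobius_mem_disc h hz) := by
    refine continuousLinearMap_ext_kernelVec hν fun s hs => ?_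
    have ht := mobius_mem_disc (norm_sq_sub_inv h) hs
    rw [← mobius_mobius_inv h hs]
    set t := mobius (conj a) (-b) s
    have h2 := hU ⟨t, ht⟩
    change (U (kernelVec ν (mobius a b t))) z =
      (autFactor a b z ^ ν)⁻¹ * kernelVec ν (mobius a b t) (mobius a b z)
    rw [h2, Bergman.smul_apply, kernelVec_apply hν ht hz,
      kernelVec_apply hν (mobius_mem_disc h ht) (mobius_mem_disc h hz), hker z hz t ht]
    have := pow_ne_zero ν (autFactor_ne_zero h hz)
    field_simp
  exact congrArg (fun L : Bergman ν →L[ℂ] ℂ => L f) h1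

open Classical in
/-- The action of the element of `SU(1,1)` with first row `(a, b)` on `ℋ_ν`. -/
noncomputable def discTranslate (ν : ℕ) (a b : ℂ) : Bergman ν →ₗᵢ[ℂ] Bergman ν :=
  if h : 2 ≤ ν ∧ ‖a‖ ^ 2 - ‖b‖ ^ 2 = 1 then (exists_discTranslate h.1 h.2).choose else LinearIsometry.id

theorem isTranslate_discTranslate {ν : ℕ} (hν : 2 ≤ ν) (h : ‖a‖ ^ 2 - ‖b‖ ^ 2 = 1) (f : Bergman ν) :
    IsTranslate ν a b f (discTranslate ν a b f) := by
  rw [discTranslate, dif_pos ⟨hν, h⟩]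
  exact (exists_discTranslate hν h).choose_spec f

theorem discTranslate_apply {ν : ℕ} (hν : 2 ≤ ν) (h : ‖a‖ ^ 2 - ‖b‖ ^ 2 = 1) (f : Bergman ν) {z : ℂ}
    (hz : z ∈ disc) : discTranslate ν a b f z = (autFactor a b z ^ ν)⁻¹ * f (mobius a b z) :=
  isTranslate_discTranslate hν h f z hz

theorem IsTranslate.eq_discTranslate {ν : ℕ} (hν : 2 ≤ ν) (h : ‖a‖ ^ 2 - ‖b‖ ^ 2 = 1)
    {f f' : Bergman ν} (hf : IsTranslate ν a b f f') : f' = discTranslate ν a b f :=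
  Bergman.ext fun z hz => (hf z hz).trans (isTranslate_discTranslate hν h f z hz).symm

theorem discTranslate_inv_translate {ν : ℕ} (hν : 2 ≤ ν) (h : ‖a‖ ^ 2 - ‖b‖ ^ 2 = 1) (f : Bergman ν) :
    discTranslate ν (conj a) (-b) (discTranslate ν a b f) = f := by
  refine Bergman.ext fun z hz => ?_
  have hz' := mobius_mem_disc (norm_sq_sub_inv h) hz
  rw [discTranslate_apply hν (norm_sq_sub_inv h) _ hz, discTranslate_apply hν h _ hz',
    mobius_mobius_inv h hz]
  have h2 := autFactor_inv_mobius (norm_sq_sub_inv h) hz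
  simp only [Complex.conj_conj, neg_neg] at h2
  rw [h2]
  have := pow_ne_zero ν (autFactor_ne_zero (norm_sq_sub_inv h) hz)
  rw [inv_pow, inv_inv, inv_mul_cancel_left₀ this]

theorem discTranslate_translate_inv {ν : ℕ} (hν : 2 ≤ ν) (h : ‖a‖ ^ 2 - ‖b‖ ^ 2 = 1) (f : Bergman ν) :
    discTranslate ν a b (discTranslate ν (conj a) (-b) f) = f := by
  simpa using discTranslate_inv_translate hν (norm_sq_sub_inv h) f

theorem inner_discTranslate_right {ν : ℕ} (hν : 2 ≤ ν) (h : ‖a‖ ^ 2 - ‖b‖ ^ 2 = 1) (f g : Bergman ν) :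
    ⟪f, discTranslate ν a b g⟫_ℂ = ⟪discTranslate ν (conj a) (-b) f, g⟫_ℂ := by
  rw [← (discTranslate ν a b).inner_map_map (discTranslate ν (conj a) (-b) f),
    discTranslate_translate_inv hν h]

end mobius

/-! ### The Hilbert space tensor product -/

/-- Pairing with x is a continuous bilinear form on the two factors, so vanishing spreads from the
total sets to all elementary tensors, then to the algebraic tensor product and its completion. -/
theorem completion_tensor_eq_zero {E F : Type*} [NormedAddCommGroup E] [InnerProductSpace ℂ E]
    [NormedAddCommGroup F] [InnerProductSpace ℂ F] {S : Set E} {T : Set F}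
    (hS : Dense (Submodule.span ℂ S : Set E)) (hT : Dense (Submodule.span ℂ T : Set F))
    {x : Completion (E ⊗[ℂ] F)}
    (h : ∀ s ∈ S, ∀ t ∈ T, ⟪x, ((s ⊗ₜ[ℂ] t : E ⊗[ℂ] F) : Completion (E ⊗[ℂ] F))⟫_ℂ = 0) :
    x = 0 := by
  set L : E ⊗[ℂ] F →L[ℂ] ℂ := (innerSL ℂ x) ∘L Completion.toComplL with hL
  have h1 : ∀ s ∈ S, L ∘L (TensorProduct.mkL ℂ E F s) = 0 := fun s hs =>
    ContinuousLinearMap.ext_on hT fun t ht => h s hs t ht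
  have h2 : (ContinuousLinearMap.compL ℂ F (E ⊗[ℂ] F) ℂ L) ∘L (TensorProduct.mkL ℂ E F) = 0 :=
    ContinuousLinearMap.ext_on hS fun s hs => h1 s hs
  have h3 : ∀ u v, L (u ⊗ₜ[ℂ] v) = 0 := fun u v =>
    congrArg (fun M : F →L[ℂ] ℂ => M v)
      (congrArg (fun M : E →L[ℂ] F →L[ℂ] ℂ => M u) h2)
  have h4 : ∀ y : E ⊗[ℂ] F, L y = 0 := fun y => by
    induction y with
    | zero => exact map_zero L
    | tmul u v => exact h3 u v
    | add y z hy hz => rw [map_add, hy, hz, add_zero]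
  have h5 : ∀ y : Completion (E ⊗[ℂ] F), ⟪x, y⟫_ℂ = 0 := fun y => by
    refine Completion.induction_on y ?_ fun y => h4 y
    exact isClosed_eq (continuous_const.inner continuous_id) continuous_const
  exact inner_self_eq_zero.1 (h5 x)

/-- The elementary tensor `u ⊗ v` in the Hilbert space tensor product. -/
noncomputable def pureTensor {μ ν : ℕ} (u : Bergman μ) (v : Bergman ν) : BergmanTensor μ ν :=
  ((u ⊗ₜ[ℂ] v : Bergman μ ⊗[ℂ] Bergman ν) : BergmanTensor μ ν)

section pureTensor

variable {μ ν : ℕ}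

theorem inner_pureTensor (u u' : Bergman μ) (v v' : Bergman ν) :
    ⟪pureTensor u v, pureTensor u' v'⟫_ℂ = ⟪u, u'⟫_ℂ * ⟪v, v'⟫_ℂ := by
  rw [pureTensor, pureTensor, Completion.inner_coe, TensorProduct.inner_tmul]

theorem pureTensor_smul_left (c : ℂ) (u : Bergman μ) (v : Bergman ν) :
    pureTensor (c • u) v = c • pureTensor u v := by
  rw [pureTensor, ← TensorProduct.smul_tmul', Completion.coe_smul]
  rfl

theorem pureTensor_smul_right (c : ℂ) (u : Bergman μ) (v : Bergman ν) :
    pureTensor u (c • v) = c • pureTensor u v := by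
  rw [pureTensor, TensorProduct.tmul_smul, Completion.coe_smul]
  rfl

theorem BergmanTensor.ext_inner {S : Set (Bergman μ)} {T : Set (Bergman ν)}
    (hS : Dense (Submodule.span ℂ S : Set (Bergman μ)))
    (hT : Dense (Submodule.span ℂ T : Set (Bergman ν))) {x y : BergmanTensor μ ν}
    (h : ∀ s ∈ S, ∀ t ∈ T, ⟪x, pureTensor s t⟫_ℂ = ⟪y, pureTensor s t⟫_ℂ) : x = y := by
  refine sub_eq_zero.1 (completion_tensor_eq_zero hS hT fun s hs t ht => ?_)
  rw [inner_sub_left]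
  exact sub_eq_zero.2 (h s hs t ht)

/-- The action of `SU(1,1)` on the tensor product. -/
noncomputable def tensorTranslate (μ ν : ℕ) (a b : ℂ) : BergmanTensor μ ν →L[ℂ] BergmanTensor μ ν :=
  (TensorProduct.mapIsometry (discTranslate μ a b)
    (discTranslate ν a b)).toContinuousLinearMap.completion

theorem tensorTranslate_pureTensor (a b : ℂ) (u : Bergman μ) (v : Bergman ν) :
    tensorTranslate μ ν a b (pureTensor u v) =
      pureTensor (discTranslate μ a b u) (discTranslate ν a b v) := by
  rw [tensorTranslate, pureTensor, ContinuousLinearMap.completion_apply_coe]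
  rfl

theorem inner_tensorTranslate (a b : ℂ) (x y : BergmanTensor μ ν) :
    ⟪tensorTranslate μ ν a b x, tensorTranslate μ ν a b y⟫_ℂ = ⟪x, y⟫_ℂ := by
  refine Completion.induction_on₂ x y ?_ fun x y => ?_
  · exact isClosed_eq (by fun_prop) (by fun_prop)
  · rw [tensorTranslate, ContinuousLinearMap.completion_apply_coe,
      ContinuousLinearMap.completion_apply_coe, Completion.inner_coe, Completion.inner_coe]
    exact (TensorProduct.mapIsometry (discTranslate μ a b) (discTranslate ν a b)).inner_map_map x y

end pureTensor

/-! ### The kernel tensors and the existence of the projection -/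

/-- The function `z ^ i (1 - z w̄) ^ (-ν - k)` in `ℋ_ν`. -/
noncomputable def kernelMonoVec (ν k i : ℕ) (w : ℂ) : Bergman ν :=
  Bergman.ofFun ν fun z => z ^ i * (1 - z * conj w)⁻¹ ^ (ν + k)

theorem kernelMonoVec_apply {ν : ℕ} (hν : 2 ≤ ν) (k i : ℕ) {w z : ℂ} (hw : w ∈ disc)
    (hz : z ∈ disc) : kernelMonoVec ν k i w z = z ^ i * (1 - z * conj w)⁻¹ ^ (ν + k) :=
  Bergman.ofFun_apply hν
    ((isBoundedHolomorphic_pow i).mul ((isBoundedHolomorphic_kernel hw).pow (ν + k))) hz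

theorem kernelMonoVec_zero {ν : ℕ} (hν : 2 ≤ ν) (k i : ℕ) :
    kernelMonoVec ν k i 0 = monoVec ν i :=
  Bergman.ext fun z hz => by
    rw [kernelMonoVec_apply hν k i zero_mem_disc hz, monoVec_apply hν i hz]
    simp

/-- The second function is z^j plus terms of higher degree. With i ≤ j only the leading coefficient
can be seen, so the value is independent of w. -/
theorem inner_monoVec_kernelMonoVec {ν : ℕ} (hν : 2 ≤ ν) (k : ℕ) {i j : ℕ} (hij : i ≤ j) {w : ℂ}
    (hw : w ∈ disc) : ⟪monoVec ν i, kernelMonoVec ν k j w⟫_ℂ =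
      if i = j then (((i + ν - 1).choose i : ℕ) : ℂ)⁻¹ else 0 := by
  rw [inner_monoVec_of_hasSum hν _ (c := fun n => if n < j then 0 else
    (((n - j + (ν + k) - 1).choose (n - j) : ℕ) : ℂ) * conj w ^ (n - j)) ?_ i]
  · rcases hij.eq_or_lt with rfl | h
    · simp
    · simp [h, h.ne]
  · intro z hz
    rw [kernelMonoVec_apply hν k j hw hz, ← hasSum_nat_add_iff' j,
      Finset.sum_eq_zero (fun n hn => by simp [Finset.mem_range.1 hn]), sub_zero]
    have hx : ‖z * conj w‖ < 1 := by
      rw [norm_mul, RCLike.norm_conj]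
      nlinarith [mem_disc_iff.1 hz, mem_disc_iff.1 hw, norm_nonneg z, norm_nonneg w]
    rw [inv_pow]
    refine ((hasSum_choose_mul_pow (ν := ν + k) (by omega) hx).mul_left (z ^ j)).congr_fun
      fun n => ?_
    rw [if_neg (by omega), Nat.add_sub_cancel, mul_pow, pow_add]
    ring

/-- The function `(y - x) ^ k (1 - x w̄) ^ (-μ - k) (1 - y w̄) ^ (-ν - k)` of two variables in the
tensor product, an unnormalised image of the reproducing kernel of `ℋ_{μ+ν+2k}`. -/
noncomputable def kernelTensor (μ ν k : ℕ) (w : ℂ) : BergmanTensor μ ν :=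
  ∑ i ∈ Finset.range (k + 1), ((-1) ^ i * (k.choose i : ℂ)) •
    pureTensor (kernelMonoVec μ k i w) (kernelMonoVec ν k (k - i) w)

/-- The square of the norm of `(y - x) ^ k`. -/
noncomputable def kernelTensorConst (μ ν k : ℕ) : ℝ :=
  ∑ i ∈ Finset.range (k + 1), (k.choose i : ℝ) ^ 2 *
    ((((i + μ - 1).choose i : ℕ) : ℝ)⁻¹ * (((k - i + ν - 1).choose (k - i) : ℕ) : ℝ)⁻¹)

section kernelTensor

variable {μ ν k : ℕ}

theorem kernelTensor_zero (hμ : 2 ≤ μ) (hν : 2 ≤ ν) : kernelTensor μ ν k 0 =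
    ∑ i ∈ Finset.range (k + 1), ((-1) ^ i * (k.choose i : ℂ)) •
      pureTensor (monoVec μ i) (monoVec ν (k - i)) := by
  simp only [kernelTensor, kernelMonoVec_zero hμ, kernelMonoVec_zero hν]

theorem kernelTensorConst_pos (hμ : 2 ≤ μ) (hν : 2 ≤ ν) : 0 < kernelTensorConst μ ν k := by
  refine Finset.sum_pos (fun i hi => ?_) ⟨0, by simp⟩
  have h1 : 0 < (i + μ - 1).choose i := Nat.choose_pos (by omega)
  have h2 : 0 < (k - i + ν - 1).choose (k - i) := Nat.choose_pos (by omega)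
  have h3 : 0 < k.choose i := Nat.choose_pos (by simpa [Nat.lt_succ_iff] using hi)
  positivity

theorem inner_kernelTensor_zero_left (hμ : 2 ≤ μ) (hν : 2 ≤ ν) {w : ℂ} (hw : w ∈ disc) :
    ⟪kernelTensor μ ν k 0, kernelTensor μ ν k w⟫_ℂ = kernelTensorConst μ ν k := by
  rw [kernelTensor_zero hμ hν, kernelTensor, kernelTensorConst, sum_inner, Complex.ofReal_sum]
  refine Finset.sum_congr rfl fun i hi => ?_
  have hik : i ≤ k := by simpa [Nat.lt_succ_iff] using hi
  rw [inner_sum, Finset.sum_eq_single_of_mem i hi]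
  · rw [inner_smul_left, inner_smul_right, inner_pureTensor,
      inner_monoVec_kernelMonoVec hμ k le_rfl hw, inner_monoVec_kernelMonoVec hν k le_rfl hw,
      if_pos rfl, if_pos rfl]
    have h1 : ((-1 : ℂ) ^ i) * (-1) ^ i = 1 := by rw [← mul_pow]; simp
    simp only [map_mul, map_pow, map_neg, map_one, Complex.conj_natCast]
    push_cast
    linear_combination ((k.choose i : ℂ) ^ 2 * ((((i + μ - 1).choose i : ℕ) : ℂ)⁻¹ *
      (((k - i + ν - 1).choose (k - i) : ℕ) : ℂ)⁻¹)) * h1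
  · intro j hj hji
    have hjk : j ≤ k := by simpa [Nat.lt_succ_iff] using hj
    rw [inner_smul_left, inner_smul_right, inner_pureTensor]
    -- The exponents in the two factors add up to k, so for i ≠ j the right-hand exponent is the
    -- larger one in exactly one factor, and that factor vanishes.
    rcases lt_or_gt_of_ne hji with h | h
    · rw [inner_monoVec_kernelMonoVec hν k (by omega : k - i ≤ k - j) hw, if_neg (by omega)]
      simp
    · rw [inner_monoVec_kernelMonoVec hμ k h.le hw, if_neg h.ne]
      simp

/-- Pairing with a tensor of kernels is evaluation at (s, t); the binomial theorem recovers the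
closed form of the function of two variables. -/
theorem inner_kernelTensor_pureTensor_kernelVec (hμ : 2 ≤ μ) (hν : 2 ≤ ν) {w s t : ℂ}
    (hw : w ∈ disc) (hs : s ∈ disc) (ht : t ∈ disc) :
    ⟪pureTensor (kernelVec μ s) (kernelVec ν t), kernelTensor μ ν k w⟫_ℂ =
      (t - s) ^ k * (1 - s * conj w)⁻¹ ^ (μ + k) * (1 - t * conj w)⁻¹ ^ (ν + k) := by
  rw [kernelTensor, inner_sum, show t - s = -s + t by ring, add_pow, Finset.sum_mul, Finset.sum_mul]
  refine Finset.sum_congr rfl fun i _ => ?_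
  rw [inner_smul_right, inner_pureTensor, inner_kernelVec hμ hs, inner_kernelVec hν ht,
    kernelMonoVec_apply hμ k i hw hs, kernelMonoVec_apply hν k _ hw ht, neg_pow s]
  ring

theorem mobius_sub_mobius {a b : ℂ} (h : ‖a‖ ^ 2 - ‖b‖ ^ 2 = 1) {s t : ℂ} (hs : s ∈ disc)
    (ht : t ∈ disc) : mobius a b t - mobius a b s =
      (t - s) / (autFactor a b s * autFactor a b t) := by
  have h1 := autFactor_ne_zero h hs
  have h2 := autFactor_ne_zero h ht
  have h4 : mobius a b t = (a * t - conj b) / autFactor a b t := rfl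
  have h5 : mobius a b s = (a * s - conj b) / autFactor a b s := rfl
  rw [h4, h5, div_sub_div _ _ h2 h1, mul_comm (autFactor a b t) (autFactor a b s)]
  congr 1
  simp only [autFactor]
  linear_combination (t - s) * conj_mul_sub_conj_mul h

/-- Evaluated at (s, t), the automorphy factors at s and t from (y - x)^k, from the two kernel
factors and from the action cancel; only the factors at w remain, with exponent (μ + k) + (ν + k).
-/
theorem tensorTranslate_kernelTensor (hμ : 2 ≤ μ) (hν : 2 ≤ ν) {a b : ℂ}
    (h : ‖a‖ ^ 2 - ‖b‖ ^ 2 = 1) {w : ℂ} (hw : w ∈ disc) :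
    tensorTranslate μ ν a b (kernelTensor μ ν k (mobius a b w)) =
      conj (autFactor a b w) ^ (μ + ν + 2 * k) • kernelTensor μ ν k w := by
  refine BergmanTensor.ext_inner (dense_span_kernelVec hμ) (dense_span_kernelVec hν) ?_
  rintro _ ⟨s, hs, rfl⟩ _ ⟨t, ht, rfl⟩
  rw [← inner_conj_symm, ← inner_conj_symm (_ • _)]
  congr 1
  rw [inner_smul_right, inner_kernelTensor_pureTensor_kernelVec hμ hν hw hs ht]
  have hs' := autFactor_ne_zero h hs
  have ht' := autFactor_ne_zero h ht
  have hw' : conj (autFactor a b w) ≠ 0 := by simpa using autFactor_ne_zero h hw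
  have hsw := one_sub_mul_conj_ne_zero hs hw
  have htw := one_sub_mul_conj_ne_zero ht hw
  have h1 : ⟪pureTensor (kernelVec μ s) (kernelVec ν t),
      tensorTranslate μ ν a b (kernelTensor μ ν k (mobius a b w))⟫_ℂ =
      (autFactor a b s ^ μ)⁻¹ * (autFactor a b t ^ ν)⁻¹ *
      ⟪pureTensor (kernelVec μ (mobius a b s)) (kernelVec ν (mobius a b t)),
        kernelTensor μ ν k (mobius a b w)⟫_ℂ := by
    rw [kernelTensor, map_sum, inner_sum, inner_sum, Finset.mul_sum]
    refine Finset.sum_congr rfl fun i _ => ?_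
    rw [map_smul, tensorTranslate_pureTensor, inner_smul_right, inner_smul_right, inner_pureTensor,
      inner_pureTensor, inner_kernelVec hμ hs, inner_kernelVec hν ht,
      inner_kernelVec hμ (mobius_mem_disc h hs), inner_kernelVec hν (mobius_mem_disc h ht),
      discTranslate_apply hμ h _ hs, discTranslate_apply hν h _ ht]
    ring
  rw [h1, inner_kernelTensor_pureTensor_kernelVec hμ hν (mobius_mem_disc h hw)
    (mobius_mem_disc h hs) (mobius_mem_disc h ht), mobius_sub_mobius h hs ht,
    one_sub_mobius_mul_conj h hs hw, one_sub_mobius_mul_conj h ht hw, inv_div, inv_div,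
    div_pow, div_pow, div_pow, mul_pow, mul_pow, mul_pow, inv_pow, inv_pow,
    show μ + ν + 2 * k = (μ + k) + (ν + k) by ring, pow_add (conj _) (μ + k),
    pow_add (autFactor a b s) μ, pow_add (autFactor a b t) ν]
  field_simp

theorem exists_mobius_eq_zero {z : ℂ} (hz : z ∈ disc) :
    ∃ a b : ℂ, ‖a‖ ^ 2 - ‖b‖ ^ 2 = 1 ∧ mobius a b z = 0 := by
  have h0 := one_sub_pos hz
  -- The numerator a z - b̄ must vanish at z, which gives b = a z̄ for real a, and the determinant
  -- condition then fixes |a|.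
  refine ⟨((√(1 - ‖z‖ ^ 2))⁻¹ : ℝ), ((√(1 - ‖z‖ ^ 2))⁻¹ : ℝ) * conj z, ?_, ?_⟩
  · rw [norm_mul, RCLike.norm_conj, Complex.norm_real, mul_pow, Real.norm_eq_abs, sq_abs, inv_pow,
      Real.sq_sqrt h0.le]
    field_simp
  · simp [mobius]

theorem autFactor_mul_conj_of_mobius_eq_zero {a b : ℂ} (h : ‖a‖ ^ 2 - ‖b‖ ^ 2 = 1) {z w : ℂ}
    (hz : z ∈ disc) (hw : w ∈ disc) (h0 : mobius a b z = 0) :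
    autFactor a b z * conj (autFactor a b w) = 1 - z * conj w := by
  have h1 := one_sub_mobius_mul_conj h hz hw
  have h2 : autFactor a b z * conj (autFactor a b w) ≠ 0 :=
    mul_ne_zero (autFactor_ne_zero h hz) (by simpa using autFactor_ne_zero h hw)
  rw [h0, zero_mul, sub_zero, eq_div_iff h2, one_mul] at h1
  exact h1

theorem kernelTensor_eq (hμ : 2 ≤ μ) (hν : 2 ≤ ν) {a b : ℂ}
    (h : ‖a‖ ^ 2 - ‖b‖ ^ 2 = 1) {w : ℂ} (hw : w ∈ disc) :
    kernelTensor μ ν k w = (conj (autFactor a b w) ^ (μ + ν + 2 * k))⁻¹ •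
      tensorTranslate μ ν a b (kernelTensor μ ν k (mobius a b w)) := by
  rw [tensorTranslate_kernelTensor hμ hν h hw, inv_smul_smul₀]
  exact pow_ne_zero _ (by simpa using autFactor_ne_zero h hw)

/-- Moving z to 0 by an isometry makes the pairing constant, and the two automorphy factors multiply
to 1 - z w̄. -/
theorem inner_kernelTensor (hμ : 2 ≤ μ) (hν : 2 ≤ ν) {z w : ℂ} (hz : z ∈ disc) (hw : w ∈ disc) :
    ⟪kernelTensor μ ν k z, kernelTensor μ ν k w⟫_ℂ =
      kernelTensorConst μ ν k * ((1 - z * conj w) ^ (μ + ν + 2 * k))⁻¹ := by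
  obtain ⟨a, b, h, h0⟩ := exists_mobius_eq_zero hz
  rw [kernelTensor_eq hμ hν h hz, kernelTensor_eq hμ hν h hw, inner_smul_left, inner_smul_right,
    inner_tensorTranslate, h0, inner_kernelTensor_zero_left hμ hν (mobius_mem_disc h hw),
    ← autFactor_mul_conj_of_mobius_eq_zero h hz hw h0]
  simp only [map_inv₀, map_pow, Complex.conj_conj, mul_pow, mul_inv]
  ring

/-- After division by √γ the kernel tensors have the Gram matrix of the reproducing kernels, so they
define an isometry W, and P is its adjoint. -/
theorem exists_isTensorProjection (hμ : 2 ≤ μ) (hν : 2 ≤ ν) : ∃ P, IsTensorProjection μ ν k P := by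
  have hN : 2 ≤ μ + ν + 2 * k := by omega
  set γ := kernelTensorConst μ ν k with hγ
  have hγ0 : 0 < γ := kernelTensorConst_pos hμ hν
  have hc : (((√γ)⁻¹ : ℝ) : ℂ) * ((√γ)⁻¹ : ℝ) * γ = 1 := by
    rw [← Complex.ofReal_mul, ← Complex.ofReal_mul, ← mul_inv, Real.mul_self_sqrt hγ0.le,
      inv_mul_cancel₀ hγ0.ne', Complex.ofReal_one]
  obtain ⟨W, hW⟩ := exists_linearIsometry_of_inner_eq (E := Bergman (μ + ν + 2 * k))
    (fun t : disc => kernelVec (μ + ν + 2 * k) t)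
    (fun t : disc => (((√γ)⁻¹ : ℝ) : ℂ) • kernelTensor μ ν k t) (by
      rw [← Set.image_eq_range]
      exact dense_span_kernelVec hN) (by
      rintro ⟨s, hs⟩ ⟨t, ht⟩
      rw [inner_smul_left, inner_smul_right, inner_kernelTensor hμ hν hs ht,
        inner_kernelVec_kernelVec hN hs ht, Complex.conj_ofReal]
      linear_combination ((1 - s * conj t) ^ (μ + ν + 2 * k))⁻¹ * hc)
  -- Pointwise, the adjoint pairs with kernel tensors, so equivariance follows from their
  -- transformation law.
  have hP : ∀ x, ∀ z ∈ disc, ContinuousLinearMap.adjoint W.toContinuousLinearMap x z =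
      (((√γ)⁻¹ : ℝ) : ℂ) * ⟪kernelTensor μ ν k z, x⟫_ℂ := by
    intro x z hz
    rw [← inner_kernelVec hN hz, ContinuousLinearMap.adjoint_inner_right]
    have : W.toContinuousLinearMap (kernelVec (μ + ν + 2 * k) z) =
      (((√γ)⁻¹ : ℝ) : ℂ) • kernelTensor μ ν k z := hW ⟨z, hz⟩
    rw [this, inner_smul_left, Complex.conj_ofReal]
  refine ⟨ContinuousLinearMap.adjoint W.toContinuousLinearMap, ⟨?_, ?_⟩⟩
  · rw [ContinuousLinearMap.adjoint_adjoint]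
    ext1 x
    refine ext_inner_left ℂ fun y => ?_
    rw [ContinuousLinearMap.comp_apply, ContinuousLinearMap.adjoint_inner_right]
    exact W.inner_map_map y x
  · intro a b h u u' v v' hu hv z hz
    rw [hP _ z hz]
    refine Eq.trans ?_ (congrArg _ (hP _ _ (mobius_mem_disc h hz)).symm)
    rw [hu.eq_discTranslate hμ h, hv.eq_discTranslate hν h, kernelTensor_eq hμ hν h hz]
    have h1 := tensorTranslate_pureTensor a b u v
    rw [pureTensor, pureTensor] at h1
    rw [← h1, inner_smul_left, inner_tensorTranslate]
    simp only [map_inv₀, map_pow, Complex.conj_conj, autFactor]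
    ring

end kernelTensor

/-! ### Rotations and degree restrictions on an equivariant projection -/

theorem measureReal_weightMeasure_univ {ν : ℕ} (hν : 2 ≤ ν) : (weightMeasure ν).real Set.univ = 1 := by
  have h1 := Bergman.norm_sq_eq (monoVec ν 0)
  have h2 : ‖monoVec ν 0‖ ^ 2 = 1 := by
    have h := inner_self_eq_norm_sq_to_K (𝕜 := ℂ) (monoVec ν 0)
    rw [inner_monoVec_monoVec hν, if_pos rfl] at h
    apply Complex.ofReal_injective
    rw [Complex.ofReal_pow]
    refine h.symm.trans ?_
    simp
  have h3 : (fun z => ‖monoVec ν 0 z‖ ^ 2) =ᵐ[weightMeasure ν] fun _ => (1 : ℝ) := by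
    refine (ae_weight_iff ν _).2 ?_
    filter_upwards [ae_restrict_mem isOpen_disc.measurableSet] with z hz
    rw [monoVec_apply hν 0 hz]
    simp
  rw [h2, integral_congr_ae h3] at h1
  simpa using h1.symm

theorem Bergman.norm_le_of_forall_le {ν : ℕ} (hν : 2 ≤ ν) {f : Bergman ν} {C : ℝ} (hC : 0 ≤ C)
    (h : ∀ z ∈ disc, ‖f z‖ ≤ C) : ‖f‖ ≤ C := by
  have := isFiniteMeasure_weightMeasure hν
  refine le_of_sq_le_sq ?_ hC
  rw [Bergman.norm_sq_eq]
  calc ∫ z, ‖f z‖ ^ 2 ∂weightMeasure ν ≤ ∫ _z, C ^ 2 ∂weightMeasure ν := by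
        refine integral_mono_ae (f.memLp.integrable_norm_pow (by simp)) (integrable_const _) ?_
        refine (ae_weight_iff ν _).2 ?_
        filter_upwards [ae_restrict_mem isOpen_disc.measurableSet] with z hz
        exact pow_le_pow_left₀ (norm_nonneg _) (h z hz) 2
    _ = C ^ 2 := by
        rw [integral_const, measureReal_weightMeasure_univ hν, one_smul]

theorem discTranslate_rotation_monoVec {ν : ℕ} (hν : 2 ≤ ν) {a : ℂ} (ha : ‖a‖ = 1) (n : ℕ) :
    discTranslate ν a 0 (monoVec ν n) = a ^ (ν + 2 * n) • monoVec ν n := by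
  have h : ‖a‖ ^ 2 - ‖(0 : ℂ)‖ ^ 2 = 1 := by simp [ha]
  have h1 : conj a * a = 1 := by
    rw [mul_comm, Complex.mul_conj, Complex.normSq_eq_norm_sq, ha]
    simp
  have h2 : conj a = a⁻¹ := eq_inv_of_mul_eq_one_left h1
  refine Bergman.ext fun z hz => ?_
  rw [discTranslate_apply hν h _ hz, Bergman.smul_apply,
    monoVec_apply hν n (mobius_mem_disc h hz), monoVec_apply hν n hz, mobius, autFactor, h2]
  simp only [neg_zero, zero_mul, zero_add, map_zero, sub_zero, inv_pow, inv_inv, div_inv_eq_mul]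
  ring

theorem exists_unit_pow_ne {m n : ℕ} (hmn : m ≠ n) : ∃ a : ℂ, ‖a‖ = 1 ∧ a ^ m ≠ a ^ n := by
  -- The rotation by one radian has infinite order because π is irrational.
  refine ⟨Complex.exp Complex.I, by simpa using Complex.norm_exp_ofReal_mul_I 1, fun h => ?_⟩
  rw [← Complex.exp_nat_mul, ← Complex.exp_nat_mul, Complex.exp_eq_exp_iff_exists_int] at h
  obtain ⟨l, hl⟩ := h
  have h1 : ((m : ℂ) - n) = l * (2 * Real.pi) := by
    have h2 : (((m : ℂ) - n) - l * (2 * Real.pi)) * Complex.I = 0 := by linear_combination hl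
    have := (mul_eq_zero.1 h2).resolve_right Complex.I_ne_zero
    linear_combination this
  have h3 : ((m : ℝ) - n) = l * (2 * Real.pi) := by exact_mod_cast h1
  have hl0 : (l : ℝ) ≠ 0 := by
    intro h0
    rw [h0, zero_mul, sub_eq_zero] at h3
    exact hmn (by exact_mod_cast h3)
  refine irrational_pi ⟨((m : ℚ) - n) / (2 * l), ?_⟩
  push_cast
  field_simp
  linarith

section IsTensorProjection

variable {μ ν k : ℕ} {P : BergmanTensor μ ν →L[ℂ] Bergman (μ + ν + 2 * k)}

theorem IsTensorProjection.apply_pureTensor_discTranslate (hP : IsTensorProjection μ ν k P)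
    (hμ : 2 ≤ μ) (hν : 2 ≤ ν) {a b : ℂ} (h : ‖a‖ ^ 2 - ‖b‖ ^ 2 = 1) (u : Bergman μ)
    (v : Bergman ν) : P (pureTensor (discTranslate μ a b u) (discTranslate ν a b v)) =
      discTranslate (μ + ν + 2 * k) a b (P (pureTensor u v)) :=
  IsTranslate.eq_discTranslate (by omega) h (hP.equivariant a b h u _ v _
    (isTranslate_discTranslate hμ h u) (isTranslate_discTranslate hν h v))

/-- Monomials are weight vectors for the rotations, with weights μ + ν + 2(i + j) on the source and
μ + ν + 2k + 2n on the target; vectors of different weight cannot be paired by an equivariant map.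
-/
theorem IsTensorProjection.inner_monoVec_apply (hP : IsTensorProjection μ ν k P)
    (hμ : 2 ≤ μ) (hν : 2 ≤ ν) {i j n : ℕ} (hn : i + j ≠ k + n) :
    ⟪monoVec (μ + ν + 2 * k) n, P (pureTensor (monoVec μ i) (monoVec ν j))⟫_ℂ = 0 := by
  have hN : 2 ≤ μ + ν + 2 * k := by omega
  obtain ⟨a, ha, hne⟩ := exists_unit_pow_ne (m := μ + 2 * i + (ν + 2 * j))
    (n := μ + ν + 2 * k + 2 * n) (by omega)
  have h : ‖a‖ ^ 2 - ‖(0 : ℂ)‖ ^ 2 = 1 := by simp [ha]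
  have h1 := hP.apply_pureTensor_discTranslate hμ hν h (monoVec μ i) (monoVec ν j)
  rw [discTranslate_rotation_monoVec hμ ha, discTranslate_rotation_monoVec hν ha,
    pureTensor_smul_left, pureTensor_smul_right, smul_smul, ← pow_add, map_smul] at h1
  have h2 := congrArg (fun f => ⟪monoVec (μ + ν + 2 * k) n, f⟫_ℂ) h1
  simp only [inner_smul_right] at h2
  rw [inner_discTranslate_right hN h, neg_zero,
    discTranslate_rotation_monoVec hN (a := conj a) (by simpa using ha), inner_smul_left, map_pow,
    Complex.conj_conj, ← sub_eq_zero, ← sub_mul] at h2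
  exact (mul_eq_zero.1 h2).resolve_left (sub_ne_zero.2 hne)

/-- Below total degree k no monomial of the target has the same weight. -/
theorem IsTensorProjection.apply_monoVec_eq_zero (hP : IsTensorProjection μ ν k P)
    (hμ : 2 ≤ μ) (hν : 2 ≤ ν) {i j : ℕ} (h : i + j < k) :
    P (pureTensor (monoVec μ i) (monoVec ν j)) = 0 := by
  refine (dense_span_monoVec (ν := μ + ν + 2 * k) (by omega)).eq_zero_of_inner_right ℂ ?_
  set F := P (pureTensor (monoVec μ i) (monoVec ν j)) with hF
  have h1 : Submodule.span ℂ (Set.range (monoVec (μ + ν + 2 * k))) ≤ (ℂ ∙ F)ᗮ := by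
    refine Submodule.span_le.2 ?_
    rintro _ ⟨n, rfl⟩
    exact Submodule.mem_orthogonal_singleton_iff_inner_left.2
      (hP.inner_monoVec_apply hμ hν (by omega))
  exact fun f hf => Submodule.mem_orthogonal_singleton_iff_inner_left.1 (h1 hf)

end IsTensorProjection

/-! ### First order expansion of hyperbolic elements -/

/-- `F r = A + r B + O(r²)` as `r → 0+`, uniformly on the disc, with `A` and `B` bounded. -/
def HasFirstOrderExpansion (F : ℝ → ℂ → ℂ) (A B : ℂ → ℂ) : Prop :=
  ∃ C : ℝ, 0 ≤ C ∧ ∀ r ∈ Set.Ioc (0 : ℝ) (1 / 2), ∀ z ∈ disc,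
    ‖A z‖ ≤ C ∧ ‖B z‖ ≤ C ∧ ‖F r z - A z - r * B z‖ ≤ C * r ^ 2

theorem HasFirstOrderExpansion.mul {F G : ℝ → ℂ → ℂ} {A B A' B' : ℂ → ℂ}
    (hF : HasFirstOrderExpansion F A B) (hG : HasFirstOrderExpansion G A' B') :
    HasFirstOrderExpansion (fun r z => F r z * G r z) (fun z => A z * A' z)
      (fun z => A z * B' z + B z * A' z) := by
  obtain ⟨C, hC, hF⟩ := hF
  obtain ⟨D, hD, hG⟩ := hG
  -- The remainder splits into the error of F times G, the linear part of F times the error of G,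
  -- and the r² cross term, contributing 3, 2 and 1 times C D.
  refine ⟨6 * (C * D), by positivity, fun r hr z hz => ?_⟩
  obtain ⟨h1, h2, h3⟩ := hF r hr z hz
  obtain ⟨h4, h5, h6⟩ := hG r hr z hz
  have hCD : 0 ≤ C * D := mul_nonneg hC hD
  have hr0 : 0 < r := hr.1
  have hr1 : r ≤ 1 := hr.2.trans (by norm_num)
  have hrn : ‖(r : ℂ)‖ = r := by simp [abs_of_pos hr0]
  have hG3 : ‖G r z‖ ≤ 3 * D := by
    have h7 : G r z = (G r z - A' z - r * B' z) + A' z + r * B' z := by ring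
    have h8 : ‖(r : ℂ) * B' z‖ ≤ D := by
      rw [norm_mul, hrn]
      nlinarith [norm_nonneg (B' z)]
    have h9 : D * r ^ 2 ≤ D := mul_le_of_le_one_right hD (pow_le_one₀ hr0.le hr1)
    rw [h7]
    refine (norm_add₃_le).trans ?_
    linarith
  have hAB : ‖A z + r * B z‖ ≤ 2 * C := by
    refine (norm_add_le _ _).trans ?_
    rw [norm_mul, hrn]
    nlinarith [norm_nonneg (B z)]
  refine ⟨?_, ?_, ?_⟩
  · rw [norm_mul]
    nlinarith [mul_le_mul h1 h4 (norm_nonneg _) hC]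
  · refine (norm_add_le _ _).trans ?_
    rw [norm_mul, norm_mul]
    nlinarith [mul_le_mul h1 h5 (norm_nonneg _) hC, mul_le_mul h2 h4 (norm_nonneg _) hC]
  · have h7 : F r z * G r z - A z * A' z - r * (A z * B' z + B z * A' z) =
        (F r z - A z - r * B z) * G r z + (A z + r * B z) * (G r z - A' z - r * B' z) +
          (r : ℂ) ^ 2 * (B z * B' z) := by ring
    rw [h7]
    refine (norm_add₃_le).trans ?_
    rw [norm_mul, norm_mul, norm_mul, norm_mul, norm_pow, hrn]
    have h8 := mul_le_mul h3 hG3 (norm_nonneg _) (by positivity)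
    have h9 := mul_le_mul hAB h6 (norm_nonneg _) (by positivity)
    have h10 := mul_le_mul_of_nonneg_left (mul_le_mul h2 h5 (norm_nonneg _) hC) (sq_nonneg r)
    nlinarith

theorem HasFirstOrderExpansion.congr {F F' : ℝ → ℂ → ℂ} {A B A' B' : ℂ → ℂ}
    (h : HasFirstOrderExpansion F A B) (hF : F = F') (hA : A = A') (hB : B = B') :
    HasFirstOrderExpansion F' A' B' := by rwa [← hF, ← hA, ← hB]

theorem HasFirstOrderExpansion.pow {F : ℝ → ℂ → ℂ} {A B : ℂ → ℂ}
    (hF : HasFirstOrderExpansion F A B) (n : ℕ) :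
    HasFirstOrderExpansion (fun r z => F r z ^ n) (fun z => A z ^ n)
      (fun z => n * A z ^ (n - 1) * B z) := by
  induction n with
  | zero => exact ⟨1, zero_le_one, fun r _ z _ => by simp [sq_nonneg]⟩
  | succ n ih =>
    refine (ih.mul hF).congr ?_ ?_ ?_
    · simp only [pow_succ]
    · simp only [pow_succ]
    · funext z
      rcases n with _ | n
      · simp
      · simp only [Nat.add_sub_cancel]
        push_cast
        ring

theorem hasFirstOrderExpansion_sub : HasFirstOrderExpansion (fun r z => z - r) (fun z => z)
    (fun _ => -1) :=
  ⟨1, zero_le_one, fun r _ z hz => ⟨(mem_disc_iff.1 hz).le, by simp, by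
    rw [show z - (r : ℂ) - z - r * -1 = 0 by ring, norm_zero]
    positivity⟩⟩

theorem hasFirstOrderExpansion_inv :
    HasFirstOrderExpansion (fun r z => (1 - r * z)⁻¹) (fun _ => 1) (fun z => z) := by
  refine ⟨2, by norm_num, fun r hr z hz => ?_⟩
  have hz1 := (mem_disc_iff.1 hz).le
  have hrn : ‖(r : ℂ)‖ = r := by simp [abs_of_pos hr.1]
  -- The restriction r ≤ 1/2 keeps the denominator away from 0 uniformly on the disc.
  have h1 : 1 / 2 ≤ ‖1 - (r : ℂ) * z‖ := by
    have h2 : ‖(1 : ℂ)‖ - ‖(r : ℂ) * z‖ ≤ ‖1 - (r : ℂ) * z‖ := norm_sub_norm_le _ _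
    rw [norm_one, norm_mul, hrn] at h2
    nlinarith [hr.1, hr.2, norm_nonneg z]
  have h0 : 1 - (r : ℂ) * z ≠ 0 := by
    intro h
    rw [h, norm_zero] at h1
    norm_num at h1
  refine ⟨by simp, by linarith, ?_⟩
  have h3 : (1 - (r : ℂ) * z)⁻¹ - 1 - r * z = (r : ℂ) ^ 2 * z ^ 2 / (1 - r * z) := by
    field_simp
    ring
  rw [h3, norm_div, norm_mul, norm_pow, norm_pow, hrn, div_le_iff₀ (by linarith)]
  have h4 : ‖z‖ ^ 2 ≤ 1 := pow_le_one₀ (norm_nonneg z) hz1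
  nlinarith [sq_nonneg r]

/-- The expansion of the action of a small hyperbolic element on a monomial. -/
theorem hasFirstOrderExpansion_translate_pow (m i : ℕ) :
    HasFirstOrderExpansion (fun r z => (z - r) ^ i * (1 - r * z)⁻¹ ^ m) (fun z => z ^ i)
      (fun z => m * z ^ (i + 1) - i * z ^ (i - 1)) := by
  refine ((hasFirstOrderExpansion_sub.pow i).mul (hasFirstOrderExpansion_inv.pow m)).congr rfl ?_ ?_
  · funext z
    simp
  · funext z
    simp
    ring

/-- The parameter `(1 - r²)^{-1/2}` of a hyperbolic element. -/
noncomputable def boostFactor (r : ℝ) : ℝ := (√(1 - r ^ 2))⁻¹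

theorem boostFactor_sq {r : ℝ} (hr : r ∈ Set.Ioc (0 : ℝ) (1 / 2)) :
    ‖(boostFactor r : ℂ)‖ ^ 2 - ‖((boostFactor r * r : ℝ) : ℂ)‖ ^ 2 = 1 := by
  have h0 : 0 < 1 - r ^ 2 := by nlinarith [hr.1, hr.2]
  rw [Complex.norm_real, Complex.norm_real, Real.norm_eq_abs, Real.norm_eq_abs, sq_abs, sq_abs,
    mul_pow, boostFactor, inv_pow, Real.sq_sqrt h0.le]
  field_simp

theorem boostFactor_ne_zero {r : ℝ} (hr : r ∈ Set.Ioc (0 : ℝ) (1 / 2)) : boostFactor r ≠ 0 := by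
  have h0 : 0 < 1 - r ^ 2 := by nlinarith [hr.1, hr.2]
  exact inv_ne_zero (Real.sqrt_ne_zero'.2 h0)

/-- A multiple of the translate of a monomial by a hyperbolic element. -/
noncomputable def boostMonoVec (ν i : ℕ) (r : ℝ) : Bergman ν :=
  (boostFactor r : ℂ) ^ ν • discTranslate ν (boostFactor r) (boostFactor r * r : ℝ) (monoVec ν i)

/-- The scalar in `boostMonoVec` cancels the boost factor in the automorphy factor, leaving a
function rational in r; rescaling is harmless because only the vanishing of P on translates will be
used. -/
theorem boostMonoVec_apply {ν : ℕ} (hν : 2 ≤ ν) (i : ℕ) {r : ℝ} (hr : r ∈ Set.Ioc (0 : ℝ) (1 / 2))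
    {z : ℂ} (hz : z ∈ disc) :
    boostMonoVec ν i r z = (z - r) ^ i * (1 - r * z)⁻¹ ^ (ν + i) := by
  have h := boostFactor_sq hr
  have h1 : (boostFactor r : ℂ) ≠ 0 := by exact_mod_cast boostFactor_ne_zero hr
  rw [boostMonoVec, Bergman.smul_apply, discTranslate_apply hν h _ hz,
    monoVec_apply hν i (mobius_mem_disc h hz)]
  have h2 : autFactor (boostFactor r) (boostFactor r * r : ℝ) z = boostFactor r * (1 - r * z) := by
    rw [autFactor, Complex.conj_ofReal]
    push_cast
    ring
  have h3 : mobius (boostFactor r) (boostFactor r * r : ℝ) z = (z - r) * (1 - r * z)⁻¹ := by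
    rw [mobius, ← autFactor, h2, Complex.conj_ofReal, ← div_eq_mul_inv,
      ← mul_div_mul_left (z - (r : ℂ)) _ h1]
    push_cast
    ring
  rw [h2, h3, mul_pow, mul_pow, pow_add, inv_pow _ ν]
  field_simp

/-- The uniform expansion on the disc is an expansion in norm because the weight measure has mass
one. -/
theorem exists_norm_boostMonoVec_sub_le {ν : ℕ} (hν : 2 ≤ ν) (i : ℕ) :
    ∃ C : ℝ, ∀ r ∈ Set.Ioc (0 : ℝ) (1 / 2), ‖boostMonoVec ν i r - monoVec ν i -
      (r : ℂ) • (((ν + i : ℕ) : ℂ) • monoVec ν (i + 1) - (i : ℂ) • monoVec ν (i - 1))‖ ≤ C * r ^ 2 := by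
  obtain ⟨C, hC, h⟩ := hasFirstOrderExpansion_translate_pow (ν + i) i
  refine ⟨C, fun r hr => Bergman.norm_le_of_forall_le hν (by positivity) fun z hz => ?_⟩
  have h1 := (h r hr z hz).2.2
  rw [Bergman.sub_apply, Bergman.sub_apply, Bergman.smul_apply, Bergman.sub_apply,
    Bergman.smul_apply, Bergman.smul_apply, boostMonoVec_apply hν i hr hz, monoVec_apply hν _ hz,
    monoVec_apply hν _ hz, monoVec_apply hν _ hz]
  exact h1

theorem tendsto_quotient_of_norm_le {E : Type*} [NormedAddCommGroup E] [NormedSpace ℂ E]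
    {w : ℝ → E} {e u : E} {C : ℝ}
    (h : ∀ r ∈ Set.Ioc (0 : ℝ) (1 / 2), ‖w r - e - (r : ℂ) • u‖ ≤ C * r ^ 2) :
    Tendsto (fun r : ℝ => (r : ℂ)⁻¹ • (w r - e)) (𝓝[>] 0) (𝓝 u) := by
  rw [tendsto_iff_norm_sub_tendsto_zero]
  have h1 : Tendsto (fun r : ℝ => C * r) (𝓝[>] 0) (𝓝 0) := by
    have : Tendsto (fun r : ℝ => C * r) (𝓝 0) (𝓝 (C * 0)) := tendsto_id.const_mul C
    rw [mul_zero] at this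
    exact this.mono_left nhdsWithin_le_nhds
  refine squeeze_zero' (Eventually.of_forall fun _ => norm_nonneg _) ?_ h1
  filter_upwards [Ioc_mem_nhdsGT (show (0 : ℝ) < 1 / 2 by norm_num)] with r hr
  have hr0 : (r : ℂ) ≠ 0 := by exact_mod_cast hr.1.ne'
  have h2 : (r : ℂ)⁻¹ • (w r - e) - u = (r : ℂ)⁻¹ • (w r - e - (r : ℂ) • u) := by
    rw [smul_sub _ (w r - e), inv_smul_smul₀ hr0]
  rw [h2, norm_smul, norm_inv, Complex.norm_real, Real.norm_eq_abs, abs_of_pos hr.1,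
    inv_mul_le_iff₀ hr.1]
  refine (h r hr).trans (le_of_eq (by ring))

/-- The derivative at `0` of a bilinear expression that vanishes for small positive parameters. -/
theorem bilin_deriv_eq_zero {E F : Type*} [NormedAddCommGroup E] [NormedSpace ℂ E]
    [NormedAddCommGroup F] [NormedSpace ℂ F] (M : E →L[ℂ] F →L[ℂ] ℂ) {w : ℝ → E} {w' : ℝ → F}
    {e u : E} {e' u' : F} {C C' : ℝ}
    (hw : ∀ r ∈ Set.Ioc (0 : ℝ) (1 / 2), ‖w r - e - (r : ℂ) • u‖ ≤ C * r ^ 2)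
    (hw' : ∀ r ∈ Set.Ioc (0 : ℝ) (1 / 2), ‖w' r - e' - (r : ℂ) • u'‖ ≤ C' * r ^ 2)
    (h0 : ∀ r ∈ Set.Ioc (0 : ℝ) (1 / 2), M (w r) (w' r) = 0) (he : M e e' = 0) :
    M u e' + M e u' = 0 := by
  have h1 := tendsto_quotient_of_norm_le hw
  have h2 := tendsto_quotient_of_norm_le hw'
  have hr : Tendsto (fun r : ℝ => (r : ℂ)) (𝓝[>] 0) (𝓝 0) := by
    have : Tendsto (fun r : ℝ => (r : ℂ)) (𝓝 0) (𝓝 ((0 : ℝ) : ℂ)) :=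
      Complex.continuous_ofReal.tendsto 0
    exact (by simpa using this : Tendsto (fun r : ℝ => (r : ℂ)) (𝓝 0) (𝓝 0)).mono_left
      nhdsWithin_le_nhds
  have h3 : Tendsto (fun r : ℝ => e' + (r : ℂ) • ((r : ℂ)⁻¹ • (w' r - e'))) (𝓝[>] 0)
      (𝓝 (e' + (0 : ℂ) • u')) := (hr.smul h2).const_add e'
  rw [zero_smul, add_zero] at h3
  -- This is the product rule: M(w, w') - M(e, e') = M(w - e, w') + M(e, w' - e'), divided by r,
  -- with w' written as e' plus r times its difference quotient.
  have h4 : Tendsto (fun r : ℝ => M ((r : ℂ)⁻¹ • (w r - e))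
      (e' + (r : ℂ) • ((r : ℂ)⁻¹ • (w' r - e'))) + M e ((r : ℂ)⁻¹ • (w' r - e'))) (𝓝[>] 0)
      (𝓝 (M u e' + M e u')) :=
    ((M.continuous₂.tendsto (u, e')).comp (h1.prodMk_nhds h3)).add
      (((M e).continuous.tendsto u').comp h2)
  refine tendsto_nhds_unique h4 (tendsto_const_nhds.congr' ?_)
  filter_upwards [Ioc_mem_nhdsGT (show (0 : ℝ) < 1 / 2 by norm_num)] with r hr
  have hr0 : (r : ℂ) ≠ 0 := by exact_mod_cast hr.1.ne'
  have h5 := h0 r hr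
  rw [smul_inv_smul₀ hr0, add_sub_cancel, map_smul, map_smul, map_sub, map_sub,
    _root_.smul_apply, _root_.sub_apply, h5, he]
  simp

/-! ### Uniqueness: the adjoint of any projection on reproducing kernels -/

section IsTensorProjection

variable {μ ν k : ℕ} {P : BergmanTensor μ ν →L[ℂ] Bergman (μ + ν + 2 * k)}

/-- The bilinear form `(u, v) ↦ P (u ⊗ v) (0)`. -/
noncomputable def evalTensorForm (P : BergmanTensor μ ν →L[ℂ] Bergman (μ + ν + 2 * k)) :
    Bergman μ →L[ℂ] Bergman ν →L[ℂ] ℂ :=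
  (ContinuousLinearMap.compL ℂ (Bergman ν) (Bergman μ ⊗[ℂ] Bergman ν) ℂ
    (Bergman.evalL _ zero_mem_disc ∘L P ∘L Completion.toComplL)) ∘L
      (TensorProduct.mkL ℂ (Bergman μ) (Bergman ν))

theorem evalTensorForm_apply (P : BergmanTensor μ ν →L[ℂ] Bergman (μ + ν + 2 * k))
    (u : Bergman μ) (v : Bergman ν) : evalTensorForm P u v = P (pureTensor u v) 0 := rfl

theorem IsTensorProjection.evalTensorForm_eq_zero (hP : IsTensorProjection μ ν k P)
    (hμ : 2 ≤ μ) (hν : 2 ≤ ν) {i j : ℕ} (h : i + j ≠ k) :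
    evalTensorForm P (monoVec μ i) (monoVec ν j) = 0 := by
  have hN : 2 ≤ μ + ν + 2 * k := by omega
  rw [evalTensorForm_apply, ← inner_kernelVec hN zero_mem_disc, kernelVec_zero hN]
  exact hP.inner_monoVec_apply hμ hν (by omega)

/-- P kills the monomial tensor of total degree k - 1, hence by equivariance all its hyperbolic
translates. The derivative of this at the identity leaves only the two terms of degree k. -/
theorem IsTensorProjection.evalTensorForm_recursion (hP : IsTensorProjection μ ν k P)
    (hμ : 2 ≤ μ) (hν : 2 ≤ ν) {i j : ℕ} (h : i + j + 1 = k) :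
    ((μ + i : ℕ) : ℂ) * evalTensorForm P (monoVec μ (i + 1)) (monoVec ν j) +
      ((ν + j : ℕ) : ℂ) * evalTensorForm P (monoVec μ i) (monoVec ν (j + 1)) = 0 := by
  have hN : 2 ≤ μ + ν + 2 * k := by omega
  obtain ⟨C, hC⟩ := exists_norm_boostMonoVec_sub_le hμ i
  obtain ⟨D, hD⟩ := exists_norm_boostMonoVec_sub_le hν j
  have h1 := bilin_deriv_eq_zero (evalTensorForm P) hC hD (fun r hr => ?_)
    (hP.evalTensorForm_eq_zero hμ hν (by omega))
  · have h2 : (i : ℂ) * evalTensorForm P (monoVec μ (i - 1)) (monoVec ν j) = 0 := by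
      rw [hP.evalTensorForm_eq_zero hμ hν (by omega), mul_zero]
    have h3 : (j : ℂ) * evalTensorForm P (monoVec μ i) (monoVec ν (j - 1)) = 0 := by
      rw [hP.evalTensorForm_eq_zero hμ hν (by omega), mul_zero]
    simp only [map_sub, map_smul, _root_.sub_apply, _root_.smul_apply,
      smul_eq_mul, h2, h3, sub_zero] at h1
    exact h1
  · rw [boostMonoVec, boostMonoVec, map_smul, map_smul, _root_.smul_apply,
      evalTensorForm_apply, hP.apply_pureTensor_discTranslate hμ hν (boostFactor_sq hr),
      hP.apply_monoVec_eq_zero hμ hν (by omega), map_zero]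
    simp only [smul_eq_mul]
    exact mul_eq_zero_of_right _ (mul_eq_zero_of_right _ rfl)

/-- The coefficients of `(y - x) ^ k` with respect to the monomials. -/
noncomputable def tensorCoeff (μ ν k i : ℕ) : ℂ := (-1) ^ i * (k.choose i : ℂ) *
  ((((i + μ - 1).choose i : ℕ) : ℂ)⁻¹ * (((k - i + ν - 1).choose (k - i) : ℕ) : ℂ)⁻¹)

theorem choose_succ_mul (hμ : 2 ≤ μ) (i : ℕ) :
    (((i + 1 + μ - 1).choose (i + 1) : ℕ) : ℂ) * ((i : ℂ) + 1) =
      ((i + μ - 1).choose i : ℕ) * ((μ + i : ℕ) : ℂ) := by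
  obtain ⟨m, rfl⟩ : ∃ m, μ = m + 1 := ⟨μ - 1, by omega⟩
  have h := Nat.add_one_mul_choose_eq (i + m) i
  rw [show i + 1 + (m + 1) - 1 = i + m + 1 by omega, show i + (m + 1) - 1 = i + m by omega,
    show m + 1 + i = i + m + 1 by ring, mul_comm (((i + m).choose i : ℕ) : ℂ)]
  exact_mod_cast h.symm

/-- The ratios of successive monomial norms absorb μ + i and ν + j into i + 1 and j + 1, and the
identity becomes the ratio of neighbouring binomial coefficients of k with opposite signs. -/
theorem tensorCoeff_recursion (hμ : 2 ≤ μ) (hν : 2 ≤ ν) {i j : ℕ} (h : i + j + 1 = k) :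
    ((μ + i : ℕ) : ℂ) * tensorCoeff μ ν k (i + 1) + ((ν + j : ℕ) : ℂ) * tensorCoeff μ ν k i = 0 := by
  rw [tensorCoeff, tensorCoeff, show k - (i + 1) = j by omega, show k - i = j + 1 by omega]
  have h1 := choose_succ_mul hμ i
  have h2 := choose_succ_mul hν j
  have h3 : (k.choose (i + 1) : ℂ) * ((i : ℂ) + 1) = k.choose i * ((j : ℂ) + 1) := by
    have := Nat.choose_succ_right_eq k i
    rw [show k - i = j + 1 by omega] at this
    exact_mod_cast this
  have n1 : (((i + 1 + μ - 1).choose (i + 1) : ℕ) : ℂ) ≠ 0 := by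
    exact_mod_cast (Nat.choose_pos (by omega)).ne'
  have n2 : (((i + μ - 1).choose i : ℕ) : ℂ) ≠ 0 := by
    exact_mod_cast (Nat.choose_pos (by omega)).ne'
  have n3 : (((j + 1 + ν - 1).choose (j + 1) : ℕ) : ℂ) ≠ 0 := by
    exact_mod_cast (Nat.choose_pos (by omega)).ne'
  have n4 : (((j + ν - 1).choose j : ℕ) : ℂ) ≠ 0 := by
    exact_mod_cast (Nat.choose_pos (by omega)).ne'
  have n5 : ((i : ℂ) + 1) ≠ 0 := by exact_mod_cast i.succ_ne_zero
  have n6 : ((j : ℂ) + 1) ≠ 0 := by exact_mod_cast j.succ_ne_zero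
  have e1 : ((μ + i : ℕ) : ℂ) * (((i + 1 + μ - 1).choose (i + 1) : ℕ) : ℂ)⁻¹ =
      ((i : ℂ) + 1) * (((i + μ - 1).choose i : ℕ) : ℂ)⁻¹ := by
    field_simp
    linear_combination -h1
  have e2 : ((ν + j : ℕ) : ℂ) * (((j + 1 + ν - 1).choose (j + 1) : ℕ) : ℂ)⁻¹ =
      ((j : ℂ) + 1) * (((j + ν - 1).choose j : ℕ) : ℂ)⁻¹ := by
    field_simp
    linear_combination -h2
  rw [pow_succ]
  linear_combination ((-1) ^ i * (-1) * (k.choose (i + 1) : ℂ) * (((j + ν - 1).choose j : ℕ) : ℂ)⁻¹) * e1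
    + ((-1) ^ i * (k.choose i : ℂ) * (((i + μ - 1).choose i : ℕ) : ℂ)⁻¹) * e2
    - (-1) ^ i * (((i + μ - 1).choose i : ℕ) : ℂ)⁻¹ * (((j + ν - 1).choose j : ℕ) : ℂ)⁻¹ * h3

/-- Since μ + i ≠ 0, the shared recursion determines each side from its value at i = 0. -/
theorem IsTensorProjection.exists_evalTensorForm_eq (hP : IsTensorProjection μ ν k P)
    (hμ : 2 ≤ μ) (hν : 2 ≤ ν) : ∃ κ : ℂ, ∀ i ≤ k,
      evalTensorForm P (monoVec μ i) (monoVec ν (k - i)) = κ * tensorCoeff μ ν k i := by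
  have h0 : tensorCoeff μ ν k 0 ≠ 0 := by
    have : (((k - 0 + ν - 1).choose (k - 0) : ℕ) : ℂ) ≠ 0 := by
      exact_mod_cast (Nat.choose_pos (by omega)).ne'
    simpa [tensorCoeff] using this
  refine ⟨evalTensorForm P (monoVec μ 0) (monoVec ν (k - 0)) / tensorCoeff μ ν k 0, fun i hi => ?_⟩
  induction i with
  | zero => rw [div_mul_cancel₀ _ h0]
  | succ i ih =>
    have h1 := ih (by omega)
    have h2 := hP.evalTensorForm_recursion hμ hν (i := i) (j := k - (i + 1)) (by omega)
    have h3 := tensorCoeff_recursion (k := k) hμ hν (i := i) (j := k - (i + 1)) (by omega)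
    rw [show k - (i + 1) + 1 = k - i by omega, h1] at h2
    have h4 : ((μ + i : ℕ) : ℂ) ≠ 0 := by
      have : μ + i ≠ 0 := by omega
      exact_mod_cast this
    refine mul_left_cancel₀ h4 ?_
    linear_combination h2 - (evalTensorForm P (monoVec μ 0) (monoVec ν (k - 0)) /
      tensorCoeff μ ν k 0) * h3

theorem inner_kernelTensor_zero_monoVec (hμ : 2 ≤ μ) (hν : 2 ≤ ν) (i j : ℕ) :
    ⟪kernelTensor μ ν k 0, pureTensor (monoVec μ i) (monoVec ν j)⟫_ℂ =
      if i + j = k then tensorCoeff μ ν k i else 0 := by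
  rw [kernelTensor_zero hμ hν, sum_inner]
  have h1 : ∀ l ∈ Finset.range (k + 1), ⟪((-1) ^ l * (k.choose l : ℂ)) •
      pureTensor (monoVec μ l) (monoVec ν (k - l)), pureTensor (monoVec μ i) (monoVec ν j)⟫_ℂ =
      if l = i then (if i + j = k then tensorCoeff μ ν k i else 0) else 0 := by
    intro l hl
    have hlk : l ≤ k := by simpa [Nat.lt_succ_iff] using hl
    rw [inner_smul_left, inner_pureTensor, inner_monoVec_monoVec hμ, inner_monoVec_monoVec hν]
    by_cases hli : l = i
    · subst hli
      by_cases hj : l + j = k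
      · rw [if_pos rfl, if_pos (by omega : k - l = j), if_pos rfl, if_pos hj, tensorCoeff]
        simp
      · rw [if_neg (by omega : ¬ k - l = j), if_pos rfl, if_pos rfl, if_neg hj]
        simp
    · rw [if_neg hli, if_neg hli]
      simp
  rw [Finset.sum_congr rfl h1, Finset.sum_ite_eq']
  split_ifs with h2 h3 h3
  · rfl
  · rfl
  · exact absurd (Finset.mem_range.2 (by omega)) h2
  · rfl

/-- The adjoint of the projection maps the reproducing kernel to a multiple of `kernelTensor`. -/
theorem IsTensorProjection.exists_adjoint_kernelVec (hP : IsTensorProjection μ ν k P)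
    (hμ : 2 ≤ μ) (hν : 2 ≤ ν) : ∃ κ : ℂ, ‖κ‖ ^ 2 * kernelTensorConst μ ν k = 1 ∧
      ∀ z ∈ disc, ContinuousLinearMap.adjoint P (kernelVec (μ + ν + 2 * k) z) =
        κ • kernelTensor μ ν k z := by
  have hN : 2 ≤ μ + ν + 2 * k := by omega
  obtain ⟨κ, hκ⟩ := hP.exists_evalTensorForm_eq hμ hν
  have hinner : ∀ z ∈ disc, ∀ x, ⟪ContinuousLinearMap.adjoint P (kernelVec (μ + ν + 2 * k) z), x⟫_ℂ =
      P x z := fun z hz x => by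
    rw [ContinuousLinearMap.adjoint_inner_left, inner_kernelVec hN hz]
  have h0 : ContinuousLinearMap.adjoint P (kernelVec (μ + ν + 2 * k) 0) =
      conj κ • kernelTensor μ ν k 0 := by
    refine BergmanTensor.ext_inner (dense_span_monoVec hμ) (dense_span_monoVec hν) ?_
    rintro _ ⟨i, rfl⟩ _ ⟨j, rfl⟩
    rw [hinner 0 zero_mem_disc, ← evalTensorForm_apply, inner_smul_left,
      inner_kernelTensor_zero_monoVec hμ hν, Complex.conj_conj]
    split_ifs with h
    · rw [← hκ i (by omega), show k - i = j by omega]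
    · rw [mul_zero, hP.evalTensorForm_eq_zero hμ hν h]
  have hz : ∀ z ∈ disc, ContinuousLinearMap.adjoint P (kernelVec (μ + ν + 2 * k) z) =
      conj κ • kernelTensor μ ν k z := by
    intro z hz
    obtain ⟨a, b, h, hm⟩ := exists_mobius_eq_zero hz
    refine BergmanTensor.ext_inner (dense_span_kernelVec hμ) (dense_span_kernelVec hν) ?_
    rintro s - t -
    -- Writing s and t as translates turns evaluation of P at z into evaluation at 0, where h0
    -- applies; the automorphy factors match those of the kernel tensor.
    rw [hinner z hz, ← discTranslate_translate_inv hμ h s, ← discTranslate_translate_inv hν h t,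
      hP.apply_pureTensor_discTranslate hμ hν h, discTranslate_apply hN h _ hz, hm,
      ← hinner 0 zero_mem_disc, h0, kernelTensor_eq hμ hν h hz, hm, ← tensorTranslate_pureTensor a b,
      inner_smul_left, inner_smul_left, inner_smul_left, inner_tensorTranslate]
    simp only [map_inv₀, map_pow, Complex.conj_conj]
    ring
  refine ⟨conj κ, ?_, hz⟩
  -- The relation P P^* = 1, tested on the kernel at 0, which has norm one, fixes |κ|.
  have h1 : ⟪ContinuousLinearMap.adjoint P (kernelVec (μ + ν + 2 * k) 0),
      ContinuousLinearMap.adjoint P (kernelVec (μ + ν + 2 * k) 0)⟫_ℂ = 1 := by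
    have h2 : P (ContinuousLinearMap.adjoint P (kernelVec (μ + ν + 2 * k) 0)) =
        kernelVec (μ + ν + 2 * k) 0 :=
      congrArg (fun L : Bergman (μ + ν + 2 * k) →L[ℂ] Bergman (μ + ν + 2 * k) =>
        L (kernelVec (μ + ν + 2 * k) 0)) hP.comp_adjoint
    rw [ContinuousLinearMap.adjoint_inner_left, h2,
      inner_kernelVec_kernelVec hN zero_mem_disc zero_mem_disc]
    simp
  rw [h0, inner_smul_left, inner_smul_right, inner_kernelTensor_zero_left hμ hν zero_mem_disc,
    ← mul_assoc, Complex.conj_conj, Complex.mul_conj, Complex.normSq_eq_norm_sq] at h1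
  rw [RCLike.norm_conj]
  exact_mod_cast h1

end IsTensorProjection

/-! ### Symbols of rank one operators and existence of the symbol adjoint -/

theorem measurable_invDensity : Measurable fun z : ℂ =>
    ENNReal.ofReal (1 / (Real.pi * (1 - ‖z‖ ^ 2) ^ 2)) := by
  fun_prop

theorem ae_mem_disc : ∀ᵐ z ∂invMeasure, z ∈ disc :=
  (withDensity_absolutelyContinuous _ _).ae_le (ae_restrict_mem isOpen_disc.measurableSet)

theorem weightMeasure_eq_withDensity (m : ℕ) : weightMeasure m =
    invMeasure.withDensity fun z => ENNReal.ofReal (weightConst m * (1 - ‖z‖ ^ 2) ^ m) := by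
  rw [weightMeasure, invMeasure, ← withDensity_mul _ measurable_invDensity (by fun_prop)]
  refine withDensity_congr_ae ?_
  filter_upwards [ae_restrict_mem isOpen_disc.measurableSet] with z hz
  have h0 := one_sub_pos hz
  have h1 := Real.pi_pos
  rw [Pi.mul_apply, ← ENNReal.ofReal_mul (by positivity)]
  congr 1
  field_simp

instance : SFinite invMeasure := by
  unfold invMeasure
  infer_instance

theorem MeasureTheory.Integrable.conj {α : Type*} {mα : MeasurableSpace α} {κ : Measure α}
    {f : α → ℂ} (hf : Integrable f κ) : Integrable (fun z => conj (f z)) κ :=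
  (Complex.conjCLE : ℂ →L[ℝ] ℂ).integrable_comp hf

theorem norm_kernelVec_sq {ν : ℕ} (hν : 2 ≤ ν) {z : ℂ} (hz : z ∈ disc) :
    ‖kernelVec ν z‖ ^ 2 = ((1 - ‖z‖ ^ 2) ^ ν)⁻¹ := by
  have h := inner_self_eq_norm_sq_to_K (𝕜 := ℂ) (kernelVec ν z)
  rw [inner_kernelVec_kernelVec hν hz hz, Complex.mul_conj, Complex.normSq_eq_norm_sq] at h
  apply Complex.ofReal_injective
  rw [Complex.ofReal_pow]
  refine h.symm.trans ?_
  push_cast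
  rfl

theorem Bergman.norm_sq_mul_le {ν : ℕ} (hν : 2 ≤ ν) (f : Bergman ν) {z : ℂ} (hz : z ∈ disc) :
    ‖f z‖ ^ 2 * (1 - ‖z‖ ^ 2) ^ ν ≤ ‖f‖ ^ 2 := by
  have h0 := pow_pos (one_sub_pos hz) ν
  have h1 : ‖f z‖ ≤ ‖kernelVec ν z‖ * ‖f‖ := by
    rw [← inner_kernelVec hν hz]
    exact norm_inner_le_norm _ _
  have h2 : ‖f z‖ ^ 2 ≤ ((1 - ‖z‖ ^ 2) ^ ν)⁻¹ * ‖f‖ ^ 2 := by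
    rw [← norm_kernelVec_sq hν hz, ← mul_pow]
    exact pow_le_pow_left₀ (norm_nonneg _) h1 2
  calc ‖f z‖ ^ 2 * (1 - ‖z‖ ^ 2) ^ ν ≤ ((1 - ‖z‖ ^ 2) ^ ν)⁻¹ * ‖f‖ ^ 2 * (1 - ‖z‖ ^ 2) ^ ν := by
        gcongr
    _ = ‖f‖ ^ 2 := by field_simp

/-- The covariant symbol `conj(h) g (1 - |z|²)^m` of the rank one operator `g ⊗ h^*`. -/
noncomputable def rankOneSymbol {m : ℕ} (h g : Bergman m) (z : ℂ) : ℂ :=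
  conj (h z) * g z * (1 - (‖z‖ : ℂ) ^ 2) ^ m

section rankOneSymbol

variable {m : ℕ}

theorem covSymbol_rankOne (hm : 2 ≤ m) (g h : Bergman m) {z : ℂ} (hz : z ∈ disc) :
    covSymbol m (InnerProductSpace.rankOne ℂ g h) z = rankOneSymbol h g z := by
  rw [covSymbol, opKernel, InnerProductSpace.rankOne_apply, Bergman.smul_apply, ← inner_conj_symm,
    inner_kernelVec hm hz, rankOneSymbol]

theorem measurable_rankOneSymbol (h g : Bergman m) : Measurable (rankOneSymbol h g) :=
  ((Complex.continuous_conj.measurable.comp h.measurable).mul g.measurable).mul (by fun_prop)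

theorem norm_rankOneSymbol (h g : Bergman m) {z : ℂ} (hz : z ∈ disc) :
    ‖rankOneSymbol h g z‖ = ‖h z‖ * ‖g z‖ * (1 - ‖z‖ ^ 2) ^ m := by
  have h1 : (1 - (‖z‖ : ℂ) ^ 2) = ((1 - ‖z‖ ^ 2 : ℝ) : ℂ) := by push_cast; rfl
  rw [rankOneSymbol, h1, norm_mul, norm_mul, RCLike.norm_conj, norm_pow, Complex.norm_real,
    Real.norm_eq_abs, abs_of_pos (one_sub_pos hz)]

/-- The L^∞ endpoint, from the reproducing property and Cauchy–Schwarz; it controls pairings with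
integrable functions. -/
theorem norm_rankOneSymbol_le (hm : 2 ≤ m) (h g : Bergman m) {z : ℂ} (hz : z ∈ disc) :
    ‖rankOneSymbol h g z‖ ≤ ‖h‖ * ‖g‖ := by
  rw [norm_rankOneSymbol h g hz]
  have h0 := pow_pos (one_sub_pos hz) m
  refine le_of_sq_le_sq ?_ (by positivity)
  have h1 := mul_le_mul (h.norm_sq_mul_le hm hz) (g.norm_sq_mul_le hm hz) (by positivity)
    (by positivity)
  calc (‖h z‖ * ‖g z‖ * (1 - ‖z‖ ^ 2) ^ m) ^ 2
      = ‖h z‖ ^ 2 * (1 - ‖z‖ ^ 2) ^ m * (‖g z‖ ^ 2 * (1 - ‖z‖ ^ 2) ^ m) := by ring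
    _ ≤ _ := h1
    _ = _ := by ring

/-- The L^1 endpoint, from Cauchy–Schwarz for the weight measure, whose density relative to dι is
`weightConst m` times (1 - |z|²)^m; it controls pairings with bounded functions. -/
theorem lintegral_norm_rankOneSymbol_le (h g : Bergman m) :
    ∫⁻ z, ‖rankOneSymbol h g z‖ₑ ∂invMeasure ≤
      ENNReal.ofReal (‖h‖ * ‖g‖ / weightConst m) := by
  have hc := weightConst_pos m
  have h1 : ∫⁻ z, ‖h z‖ₑ * ‖g z‖ₑ ∂weightMeasure m ≤ ENNReal.ofReal (‖h‖ * ‖g‖) := by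
    refine (ENNReal.lintegral_mul_le_Lp_mul_Lq _ Real.HolderConjugate.two_two
      h.measurable.enorm.aemeasurable g.measurable.enorm.aemeasurable).trans ?_
    have h2 : ∀ f : Bergman m, (∫⁻ z, ‖f z‖ₑ ^ (2 : ℝ) ∂weightMeasure m) ^ (1 / 2 : ℝ) =
        ENNReal.ofReal ‖f‖ := by
      intro f
      have h3 : ∫⁻ z, ‖f z‖ₑ ^ (2 : ℝ) ∂weightMeasure m = ENNReal.ofReal (‖f‖ ^ 2) := by
        rw [Bergman.ofReal_norm_sq]
        refine lintegral_congr fun z => ?_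
        rw [enorm_pow, ENNReal.rpow_two]
      rw [h3, ENNReal.ofReal_rpow_of_nonneg (by positivity) (by norm_num), ← Real.sqrt_eq_rpow,
        Real.sqrt_sq (norm_nonneg _)]
    rw [h2, h2, ENNReal.ofReal_mul (norm_nonneg _)]
  rw [weightMeasure_eq_withDensity] at h1
  have h5 := (lintegral_withDensity_eq_lintegral_mul invMeasure
    (f := fun z => ENNReal.ofReal (weightConst m * (1 - ‖z‖ ^ 2) ^ m)) (by fun_prop)
    (h.measurable.enorm.mul g.measurable.enorm)).symm.le.trans h1
  have h4 : ∫⁻ z, ‖rankOneSymbol h g z‖ₑ ∂invMeasure = ENNReal.ofReal (weightConst m)⁻¹ *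
      ∫⁻ z, ENNReal.ofReal (weightConst m * (1 - ‖z‖ ^ 2) ^ m) * (‖h z‖ₑ * ‖g z‖ₑ) ∂invMeasure := by
    rw [← lintegral_const_mul' _ _ ENNReal.ofReal_ne_top]
    refine lintegral_congr_ae ?_
    filter_upwards [ae_mem_disc] with z hz
    have h0 := pow_pos (one_sub_pos hz) m
    rw [← ofReal_norm, norm_rankOneSymbol h g hz, ← ofReal_norm, ← ofReal_norm,
      ← ENNReal.ofReal_mul (norm_nonneg _), ← ENNReal.ofReal_mul (by positivity),
      ← ENNReal.ofReal_mul (by positivity)]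
    congr 1
    field_simp
  rw [h4, div_eq_inv_mul, ENNReal.ofReal_mul (by positivity)]
  gcongr
  exact h5

theorem integrable_rankOneSymbol (h g : Bergman m) : Integrable (rankOneSymbol h g) invMeasure :=
  ⟨(measurable_rankOneSymbol h g).aestronglyMeasurable,
    (lintegral_norm_rankOneSymbol_le h g).trans_lt ENNReal.ofReal_lt_top⟩

theorem integral_norm_rankOneSymbol_le (h g : Bergman m) :
    ∫ z, ‖rankOneSymbol h g z‖ ∂invMeasure ≤ ‖h‖ * ‖g‖ / weightConst m := by
  rw [integral_norm_eq_lintegral_enorm (measurable_rankOneSymbol h g).aestronglyMeasurable]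
  refine ENNReal.toReal_le_of_le_ofReal ?_ (lintegral_norm_rankOneSymbol_le h g)
  have := weightConst_pos m
  positivity

end rankOneSymbol

/-- A function in `L^p` is the sum of an integrable and an essentially bounded function. -/
theorem MeasureTheory.MemLp.exists_add_eq {α : Type*} {mα : MeasurableSpace α} {κ : Measure α}
    {p : ℝ≥0∞} (hp : 1 ≤ p) {f : α → ℂ} (hfm : StronglyMeasurable f) (hf : MemLp f p κ) :
    ∃ f₁ f₂ : α → ℂ, f = f₁ + f₂ ∧ Integrable f₁ κ ∧ AEStronglyMeasurable f₂ κ ∧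
      ∃ C : ℝ, ∀ᵐ z ∂κ, ‖f₂ z‖ ≤ C := by
  rcases eq_or_ne p ∞ with rfl | hp'
  · refine ⟨0, f, by simp, integrable_zero _ _ _, hfm.aestronglyMeasurable,
      (eLpNorm f ∞ κ).toReal, ?_⟩
    have h1 := ae_le_eLpNormEssSup (f := f) (μ := κ)
    rw [← eLpNorm_exponent_top] at h1
    filter_upwards [h1] with z hz
    rw [← toReal_enorm]
    exact ENNReal.toReal_mono hf.2.ne hz
  -- Cut at height 1: where |f| > 1 it is dominated by |f|^p, since p ≥ 1, and elsewhere it is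
  -- bounded.
  · set S : Set α := {z | 1 < ‖f z‖} with hS
    have hSm : MeasurableSet S := measurableSet_lt measurable_const hfm.measurable.norm
    refine ⟨S.indicator f, Sᶜ.indicator f, (Set.indicator_self_add_compl S f).symm, ?_,
      (hfm.indicator hSm.compl).aestronglyMeasurable, 1, ae_of_all _ fun z => ?_⟩
    · have h1 : Integrable (fun z => ‖f z‖ ^ p.toReal) κ :=
        hf.integrable_norm_rpow (by positivity) hp'
      refine h1.mono (hfm.indicator hSm).aestronglyMeasurable (ae_of_all _ fun z => ?_)
      rw [Real.norm_of_nonneg (by positivity)]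
      by_cases hz : z ∈ S
      · rw [Set.indicator_of_mem hz]
        have h2 : 1 ≤ p.toReal := by
          rw [← ENNReal.toReal_one]
          exact ENNReal.toReal_mono hp' hp
        simpa using Real.rpow_le_rpow_of_exponent_le (le_of_lt hz) h2
      · rw [Set.indicator_of_notMem hz, norm_zero]
        positivity
    · by_cases hz : z ∈ S
      · rw [Set.indicator_of_notMem (by simpa using hz), norm_zero]
        exact zero_le_one
      · rw [Set.indicator_of_mem hz]
        simpa [hS] using hz

section symbolAdjoint

variable {m : ℕ} {f : ℂ → ℂ}

/-- The right-hand side of the adjoint relation is a bounded sesquilinear form in (h, g), and the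
Riesz representation theorem supplies its operator. -/
theorem exists_isSymbolAdjoint_of_bound (hm : 2 ≤ m) {C : ℝ}
    (hi : ∀ h g : Bergman m, Integrable (fun z => rankOneSymbol h g z * conj (f z)) invMeasure)
    (hb : ∀ h g : Bergman m, ‖∫ z, rankOneSymbol h g z * conj (f z) ∂invMeasure‖ ≤ C * ‖h‖ * ‖g‖) :
    ∃ A, IsSymbolAdjoint m f A := by
  let B₀ : Bergman m →ₗ⋆[ℂ] Bergman m →ₗ[ℂ] ℂ := LinearMap.mk₂'ₛₗ (starRingEnd ℂ) (RingHom.id ℂ)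
    (fun h g => ∫ z, rankOneSymbol h g z * conj (f z) ∂invMeasure)
    (fun h h' g => by
      rw [← integral_add (hi h g) (hi h' g)]
      congr 1
      funext z
      rw [rankOneSymbol, rankOneSymbol, rankOneSymbol, Bergman.add_apply, map_add]
      ring)
    (fun c h g => by
      rw [smul_eq_mul, ← integral_const_mul]
      congr 1
      funext z
      rw [rankOneSymbol, rankOneSymbol, Bergman.smul_apply, map_mul]
      ring)
    (fun h g g' => by
      rw [← integral_add (hi h g) (hi h g')]
      congr 1
      funext z
      rw [rankOneSymbol, rankOneSymbol, rankOneSymbol, Bergman.add_apply]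
      ring)
    (fun c h g => by
      rw [smul_eq_mul, ← integral_const_mul]
      congr 1
      funext z
      rw [rankOneSymbol, rankOneSymbol, Bergman.smul_apply, RingHom.id_apply]
      ring)
  let B : Bergman m →L⋆[ℂ] Bergman m →L[ℂ] ℂ := B₀.mkContinuous₂ C hb
  refine ⟨InnerProductSpace.continuousLinearMapOfBilin B, fun g h => ?_⟩
  have hae : (fun z => covSymbol m (InnerProductSpace.rankOne ℂ g h) z * conj (f z)) =ᵐ[invMeasure]
      fun z => rankOneSymbol h g z * conj (f z) := by
    filter_upwards [ae_mem_disc] with z hz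
    rw [covSymbol_rankOne hm g h hz]
  refine ⟨(hi h g).congr hae.symm, ?_⟩
  rw [InnerProductSpace.continuousLinearMapOfBilin_apply, integral_congr_ae hae]
  rfl

theorem exists_isSymbolAdjoint (hm : 2 ≤ m) {p : ℝ≥0∞} [Fact (1 ≤ p)] (f : DiscLp p) :
    ∃ A, IsSymbolAdjoint m f A := by
  obtain ⟨f₁, f₂, hf, hf₁, hf₂, C, hC⟩ :=
    (Lp.memLp f).exists_add_eq Fact.out (Lp.stronglyMeasurable f)
  have hi₁ : ∀ h g : Bergman m, Integrable (fun z => rankOneSymbol h g z * conj (f₁ z)) invMeasure :=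
    fun h g => hf₁.conj.bdd_mul (c := ‖h‖ * ‖g‖) (measurable_rankOneSymbol h g).aestronglyMeasurable
      (ae_mem_disc.mono fun z hz => norm_rankOneSymbol_le hm h g hz)
  have hi₂ : ∀ h g : Bergman m, Integrable (fun z => rankOneSymbol h g z * conj (f₂ z)) invMeasure :=
    fun h g => (integrable_rankOneSymbol h g).mul_bdd (c := C) hf₂.star
      (hC.mono fun z hz => by simpa using hz)
  have hsum : ∀ h g : Bergman m, (fun z => rankOneSymbol h g z * conj (f z)) =
      fun z => rankOneSymbol h g z * conj (f₁ z) + rankOneSymbol h g z * conj (f₂ z) :=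
    fun h g => by
      funext z
      rw [hf, Pi.add_apply, map_add, mul_add]
  refine exists_isSymbolAdjoint_of_bound hm
    (C := ∫ z, ‖f₁ z‖ ∂invMeasure + |C| / weightConst m) (fun h g => ?_) (fun h g => ?_)
  · rw [hsum]
    exact (hi₁ h g).add (hi₂ h g)
  · rw [hsum, integral_add (hi₁ h g) (hi₂ h g)]
    have h1 : ‖∫ z, rankOneSymbol h g z * conj (f₁ z) ∂invMeasure‖ ≤
        ‖h‖ * ‖g‖ * ∫ z, ‖f₁ z‖ ∂invMeasure := by
      rw [← integral_const_mul]
      refine norm_integral_le_of_norm_le (hf₁.norm.const_mul _) ?_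
      filter_upwards [ae_mem_disc] with z hz
      rw [norm_mul, RCLike.norm_conj]
      exact mul_le_mul_of_nonneg_right (norm_rankOneSymbol_le hm h g hz) (norm_nonneg _)
    have h2 : ‖∫ z, rankOneSymbol h g z * conj (f₂ z) ∂invMeasure‖ ≤
        |C| * (‖h‖ * ‖g‖ / weightConst m) := by
      refine (norm_integral_le_of_norm_le ((integrable_rankOneSymbol h g).norm.const_mul |C|)
        ?_).trans ?_
      · filter_upwards [hC] with z hz
        rw [norm_mul, RCLike.norm_conj, mul_comm]
        exact mul_le_mul_of_nonneg_right (hz.trans (le_abs_self C)) (norm_nonneg _)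
      · rw [integral_const_mul]
        exact mul_le_mul_of_nonneg_left (integral_norm_rankOneSymbol_le h g) (abs_nonneg C)
    refine (norm_add_le _ _).trans ((add_le_add h1 h2).trans (le_of_eq ?_))
    ring

theorem isSymbolAdjoint_symbolAdjoint (hm : 2 ≤ m) {p : ℝ≥0∞} [Fact (1 ≤ p)] (f : DiscLp p) :
    IsSymbolAdjoint m f (symbolAdjoint m f) := by
  have h := exists_isSymbolAdjoint hm f
  rw [symbolAdjoint, dif_pos h]
  exact h.choose_spec

theorem IsSymbolAdjoint.integrable (hm : 2 ≤ m) {A : Bergman m →L[ℂ] Bergman m}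
    (hA : IsSymbolAdjoint m f A) (h : Bergman m) :
    Integrable (fun z => ((‖h z‖ ^ 2 * (1 - ‖z‖ ^ 2) ^ m : ℝ) : ℂ) * f z) invMeasure := by
  refine (hA h h).1.conj.congr ?_
  filter_upwards [ae_mem_disc] with z hz
  rw [covSymbol_rankOne hm h h hz, rankOneSymbol, mul_comm (conj (h z)),
    Complex.mul_conj, Complex.normSq_eq_norm_sq]
  simp

/-- Only diagonal coefficients of `R_m^*(f)` enter the Berezin transform and the channel symbol, so
the adjoint relation with g = h suffices. -/
theorem IsSymbolAdjoint.inner_apply_self (hm : 2 ≤ m) {A : Bergman m →L[ℂ] Bergman m}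
    (hA : IsSymbolAdjoint m f A) (h : Bergman m) :
    ⟪h, A h⟫_ℂ = ∫ z, ((‖h z‖ ^ 2 * (1 - ‖z‖ ^ 2) ^ m : ℝ) : ℂ) * f z ∂invMeasure := by
  rw [← inner_conj_symm, (hA h h).2, ← integral_conj]
  refine integral_congr_ae ?_
  filter_upwards [ae_mem_disc] with z hz
  rw [covSymbol_rankOne hm h h hz, rankOneSymbol, mul_comm (conj (h z)),
    Complex.mul_conj, Complex.normSq_eq_norm_sq]
  simp

end symbolAdjoint

/-! ### The Schur test and the Berezin transform on L^p -/

/-- The Schur test: an integral operator whose kernel has marginals bounded by `C` is bounded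
by `C` on `L^p`. -/
theorem eLpNorm_le_of_schur {X : Type*} [MeasurableSpace X] {κ : Measure X} [SFinite κ]
    {K : X → X → ℝ≥0∞} (hK : Measurable (Function.uncurry K)) {C : ℝ≥0∞}
    (h1 : ∀ᵐ z ∂κ, ∫⁻ w, K z w ∂κ ≤ C) (h2 : ∀ᵐ w ∂κ, ∫⁻ z, K z w ∂κ ≤ C)
    {p : ℝ≥0∞} (hp : 1 ≤ p) {f g : X → ℂ} (hf : StronglyMeasurable f)
    (hg : ∀ᵐ z ∂κ, ‖g z‖ₑ ≤ ∫⁻ w, K z w * ‖f w‖ₑ ∂κ) :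
    eLpNorm g p κ ≤ C * eLpNorm f p κ := by
  have hKz : ∀ z, Measurable (K z) := fun z => hK.comp measurable_prodMk_left
  have hfe : Measurable fun w => ‖f w‖ₑ := hf.measurable.enorm
  rcases eq_or_ne p ∞ with rfl | hp'
  · rw [eLpNorm_exponent_top, eLpNorm_exponent_top]
    refine essSup_le_of_ae_le _ ?_
    filter_upwards [h1, hg] with z hz1 hz2
    refine hz2.trans ?_
    calc ∫⁻ w, K z w * ‖f w‖ₑ ∂κ ≤ ∫⁻ w, K z w * eLpNormEssSup f κ ∂κ := by
          refine lintegral_mono_ae ?_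
          filter_upwards [ae_le_eLpNormEssSup (f := f) (μ := κ)] with w hw
          gcongr
      _ = (∫⁻ w, K z w ∂κ) * eLpNormEssSup f κ := lintegral_mul_const _ (hKz z)
      _ ≤ C * eLpNormEssSup f κ := by gcongr
  · have hp0 : p ≠ 0 := (zero_lt_one.trans_le hp).ne'
    have hq : 1 ≤ p.toReal := by
      rw [← ENNReal.toReal_one]
      exact ENNReal.toReal_mono hp' hp
    have hq0 : 0 < p.toReal := by linarith
    have key : ∀ᵐ z ∂κ, ‖g z‖ₑ ^ p.toReal ≤
        C ^ (p.toReal - 1) * ∫⁻ w, K z w * ‖f w‖ₑ ^ p.toReal ∂κ := by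
      filter_upwards [h1, hg] with z hz1 hz2
      -- For fixed z the kernel defines a measure of mass at most C, on which the L^1 norm is
      -- bounded by the L^p norm through Hölder.
      set σ := κ.withDensity (K z) with hσ
      have hu : σ Set.univ ≤ C := by
        rw [hσ, withDensity_apply _ MeasurableSet.univ, setLIntegral_univ]
        exact hz1
      have e1 : eLpNorm f 1 σ = ∫⁻ w, K z w * ‖f w‖ₑ ∂κ := by
        rw [eLpNorm_one_eq_lintegral_enorm, hσ, lintegral_withDensity_eq_lintegral_mul _ (hKz z) hfe]
        rfl
      have e2 : eLpNorm f p σ ^ p.toReal = ∫⁻ w, K z w * ‖f w‖ₑ ^ p.toReal ∂κ := by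
        rw [eLpNorm_eq_lintegral_rpow_enorm_toReal hp0 hp', ← ENNReal.rpow_mul, one_div,
          inv_mul_cancel₀ hq0.ne', ENNReal.rpow_one, hσ,
          lintegral_withDensity_eq_lintegral_mul _ (hKz z) (hfe.pow_const _)]
        rfl
      have e3 := eLpNorm_le_eLpNorm_mul_rpow_measure_univ hp
        (hf.aestronglyMeasurable (μ := σ))
      rw [e1] at e3
      calc ‖g z‖ₑ ^ p.toReal
          ≤ (eLpNorm f p σ * σ Set.univ ^ (1 / (1 : ℝ≥0∞).toReal - 1 / p.toReal)) ^ p.toReal := by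
            gcongr
            exact hz2.trans e3
        _ = σ Set.univ ^ (p.toReal - 1) * eLpNorm f p σ ^ p.toReal := by
            rw [ENNReal.mul_rpow_of_nonneg _ _ hq0.le, ← ENNReal.rpow_mul, mul_comm]
            congr 2
            rw [ENNReal.toReal_one]
            field_simp
        _ ≤ _ := by
            rw [e2]
            have : 0 ≤ p.toReal - 1 := by linarith
            gcongr
    rw [eLpNorm_eq_lintegral_rpow_enorm_toReal hp0 hp', eLpNorm_eq_lintegral_rpow_enorm_toReal hp0 hp']
    -- Tonelli's theorem brings in the other marginal and supplies the last factor C.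
    have hsw : ∫⁻ z, ∫⁻ w, K z w * ‖f w‖ₑ ^ p.toReal ∂κ ∂κ ≤
        C * ∫⁻ w, ‖f w‖ₑ ^ p.toReal ∂κ := by
      rw [lintegral_lintegral_swap (hK.mul
        ((hfe.pow_const p.toReal).comp measurable_snd)).aemeasurable,
        ← lintegral_const_mul _ (hfe.pow_const _)]
      refine lintegral_mono_ae ?_
      filter_upwards [h2] with w hw
      have hKw : Measurable fun z => K z w := hK.comp measurable_prodMk_right
      rw [lintegral_mul_const _ hKw]
      gcongr
    calc (∫⁻ z, ‖g z‖ₑ ^ p.toReal ∂κ) ^ (1 / p.toReal)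
        ≤ (C ^ (p.toReal - 1) * (C * ∫⁻ w, ‖f w‖ₑ ^ p.toReal ∂κ)) ^ (1 / p.toReal) := by
          gcongr
          refine (lintegral_mono_ae key).trans ?_
          rw [lintegral_const_mul'' _ (Measurable.aemeasurable ?_)]
          · gcongr
          · exact (hK.mul ((hfe.pow_const p.toReal).comp measurable_snd)).lintegral_prod_right'
      _ = C * (∫⁻ w, ‖f w‖ₑ ^ p.toReal ∂κ) ^ (1 / p.toReal) := by
          have hC : C ^ (p.toReal - 1) * C = C ^ p.toReal := by
            nth_rewrite 2 [← ENNReal.rpow_one C]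
            rw [← ENNReal.rpow_add_of_nonneg _ _ (by linarith) zero_le_one, sub_add_cancel]
          rw [← mul_assoc, hC, ENNReal.mul_rpow_of_nonneg _ _ (by positivity), ← ENNReal.rpow_mul,
            mul_one_div_cancel hq0.ne', ENNReal.rpow_one]

/-- The invariant kernel `(1 - |z|²)(1 - |w|²) / |1 - z w̄|²`. -/
noncomputable def berezinKernel (z w : ℂ) : ℝ :=
  (1 - ‖z‖ ^ 2) * (1 - ‖w‖ ^ 2) / ‖1 - z * conj w‖ ^ 2

theorem measurable_berezinKernel : Measurable (Function.uncurry berezinKernel) := by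
  have : Measurable fun q : ℂ × ℂ => conj q.2 :=
    Complex.continuous_conj.measurable.comp measurable_snd
  unfold berezinKernel Function.uncurry
  fun_prop

theorem berezinKernel_comm (z w : ℂ) : berezinKernel z w = berezinKernel w z := by
  have h : ‖1 - z * conj w‖ = ‖1 - w * conj z‖ := by
    rw [← RCLike.norm_conj (1 - z * conj w)]
    simp [mul_comm]
  rw [berezinKernel, berezinKernel, h, mul_comm (1 - ‖z‖ ^ 2)]

theorem berezinKernel_pos {z w : ℂ} (hz : z ∈ disc) (hw : w ∈ disc) : 0 < berezinKernel z w := by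
  have := one_sub_pos hz
  have := one_sub_pos hw
  have := norm_pos_iff.2 (one_sub_mul_conj_ne_zero hz hw)
  unfold berezinKernel
  positivity

theorem berezinKernel_pow_eq {m : ℕ} (hm : 2 ≤ m) {z w : ℂ} (hz : z ∈ disc) (hw : w ∈ disc) :
    berezinKernel z w ^ m =
      (1 - ‖z‖ ^ 2) ^ m * (‖kernelVec m z w‖ ^ 2 * (1 - ‖w‖ ^ 2) ^ m) := by
  rw [berezinKernel_comm, kernelVec_apply hm hz hw, berezinKernel, norm_inv, norm_pow]
  have := norm_pos_iff.2 (one_sub_mul_conj_ne_zero hw hz)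
  rw [div_pow, mul_pow]
  field_simp
  ring

theorem rankOneSymbol_kernelVec {m : ℕ} (hm : 2 ≤ m) {z w : ℂ} (hz : z ∈ disc) (hw : w ∈ disc) :
    ‖rankOneSymbol (kernelVec m z) (kernelVec m z) w‖ * (1 - ‖z‖ ^ 2) ^ m =
      berezinKernel z w ^ m := by
  rw [norm_rankOneSymbol _ _ hw, berezinKernel_pow_eq hm hz hw]
  ring

/-- The kernel is the symbol of the projection onto the normalised kernel vector at z, so the L^1
endpoint bound for rank one symbols applies. -/
theorem lintegral_berezinKernel_pow_le {m : ℕ} (hm : 2 ≤ m) {z : ℂ} (hz : z ∈ disc) :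
    ∫⁻ w, ENNReal.ofReal (berezinKernel z w ^ m) ∂invMeasure ≤
      ENNReal.ofReal (weightConst m)⁻¹ := by
  have h0 := pow_pos (one_sub_pos hz) m
  have h1 := lintegral_norm_rankOneSymbol_le (kernelVec m z) (kernelVec m z)
  rw [← sq, norm_kernelVec_sq hm hz] at h1
  calc ∫⁻ w, ENNReal.ofReal (berezinKernel z w ^ m) ∂invMeasure
      = ENNReal.ofReal ((1 - ‖z‖ ^ 2) ^ m) *
        ∫⁻ w, ‖rankOneSymbol (kernelVec m z) (kernelVec m z) w‖ₑ ∂invMeasure := by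
        rw [← lintegral_const_mul' _ _ ENNReal.ofReal_ne_top]
        refine lintegral_congr_ae ?_
        filter_upwards [ae_mem_disc] with w hw
        rw [← ofReal_norm, ← ENNReal.ofReal_mul h0.le, mul_comm, rankOneSymbol_kernelVec hm hz hw]
    _ ≤ _ := mul_le_mul_right h1 _
    _ = _ := by
        rw [← ENNReal.ofReal_mul h0.le]
        congr 1
        field_simp

section berezin

variable {m : ℕ} {p : ℝ≥0∞} [Fact (1 ≤ p)]

theorem integrable_berezinKernel_mul (hm : 2 ≤ m) (f : DiscLp p) {z : ℂ} (hz : z ∈ disc) :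
    Integrable (fun w => ((berezinKernel z w ^ m : ℝ) : ℂ) * f w) invMeasure := by
  refine (((isSymbolAdjoint_symbolAdjoint hm f).integrable hm (kernelVec m z)).const_mul
    (((1 - ‖z‖ ^ 2) ^ m : ℝ) : ℂ)).congr ?_
  filter_upwards [ae_mem_disc] with w hw
  rw [berezinKernel_pow_eq hm hz hw]
  push_cast
  ring

theorem berezin_eq_integral (hm : 2 ≤ m) (f : DiscLp p) {z : ℂ} (hz : z ∈ disc) :
    berezin m f z = ∫ w, ((berezinKernel z w ^ m : ℝ) : ℂ) * f w ∂invMeasure := by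
  rw [berezin, covSymbol, opKernel, ← inner_kernelVec hm hz,
    (isSymbolAdjoint_symbolAdjoint hm f).inner_apply_self hm, mul_comm, ← integral_const_mul]
  refine integral_congr_ae ?_
  filter_upwards [ae_mem_disc] with w hw
  rw [berezinKernel_pow_eq hm hz hw]
  push_cast
  ring

/-- The kernel is symmetric, so one marginal estimate provides both hypotheses of the Schur test. -/
theorem memLp_berezin (hm : 2 ≤ m) (f : DiscLp p) :
    MemLp (berezin m f) p invMeasure ∧ eLpNorm (berezin m f) p invMeasure ≤
      ENNReal.ofReal (weightConst m)⁻¹ * eLpNorm f p invMeasure := by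
  have hKm : Measurable (Function.uncurry fun z w => berezinKernel z w ^ m) :=
    measurable_berezinKernel.pow_const m
  have h1 : eLpNorm (berezin m f) p invMeasure ≤
      ENNReal.ofReal (weightConst m)⁻¹ * eLpNorm f p invMeasure := by
    refine eLpNorm_le_of_schur (K := fun z w => ENNReal.ofReal (berezinKernel z w ^ m))
      (ENNReal.measurable_ofReal.comp hKm) ?_ ?_ Fact.out (Lp.stronglyMeasurable f) ?_
    · filter_upwards [ae_mem_disc] with z hz using lintegral_berezinKernel_pow_le hm hz
    · filter_upwards [ae_mem_disc] with z hz
      simpa only [berezinKernel_comm z] using lintegral_berezinKernel_pow_le hm hz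
    · filter_upwards [ae_mem_disc] with z hz
      rw [berezin_eq_integral hm f hz]
      refine (enorm_integral_le_lintegral_enorm _).trans (lintegral_mono_ae ?_)
      filter_upwards [ae_mem_disc] with w hw
      rw [enorm_mul, ← ofReal_norm, Complex.norm_real,
        Real.norm_of_nonneg (pow_pos (berezinKernel_pos hz hw) m).le]
  refine ⟨⟨?_, h1.trans_lt (ENNReal.mul_lt_top ENNReal.ofReal_lt_top (Lp.memLp f).2)⟩, h1⟩
  have h2 : StronglyMeasurable fun z =>
      ∫ w, ((berezinKernel z w ^ m : ℝ) : ℂ) * f w ∂invMeasure := by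
    refine StronglyMeasurable.integral_prod_right (f := fun z w =>
      ((berezinKernel z w ^ m : ℝ) : ℂ) * f w) ?_
    exact ((Complex.measurable_ofReal.comp hKm).stronglyMeasurable).mul
      ((Lp.stronglyMeasurable f).comp_measurable measurable_snd)
  refine h2.aestronglyMeasurable.congr ?_
  filter_upwards [ae_mem_disc] with z hz using (berezin_eq_integral hm f hz).symm

/-- The Berezin transform on `L^p`, for `m ≥ 2`. -/
noncomputable def berezinL (hm : 2 ≤ m) : DiscLp p →L[ℂ] DiscLp p :=
  LinearMap.mkContinuous
    { toFun := fun f => (memLp_berezin hm f).1.toLp (berezin m f)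
      map_add' := fun f g => by
        rw [← MemLp.toLp_add]
        refine MemLp.toLp_congr _ _ ?_
        filter_upwards [ae_mem_disc] with z hz
        rw [Pi.add_apply, berezin_eq_integral hm _ hz, berezin_eq_integral hm _ hz,
          berezin_eq_integral hm _ hz, ← integral_add (integrable_berezinKernel_mul hm f hz)
            (integrable_berezinKernel_mul hm g hz)]
        refine integral_congr_ae ?_
        filter_upwards [Lp.coeFn_add f g] with w hw
        rw [hw, Pi.add_apply, mul_add]
      map_smul' := fun c f => by
        rw [RingHom.id_apply, ← MemLp.toLp_const_smul]
        refine MemLp.toLp_congr _ _ ?_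
        filter_upwards [ae_mem_disc] with z hz
        rw [Pi.smul_apply, berezin_eq_integral hm _ hz, berezin_eq_integral hm _ hz, smul_eq_mul,
          ← integral_const_mul]
        refine integral_congr_ae ?_
        filter_upwards [Lp.coeFn_smul c f] with w hw
        rw [hw, Pi.smul_apply, smul_eq_mul]
        ring }
    (weightConst m)⁻¹ (fun f => by
      have h0 := weightConst_pos m
      have h1 := ENNReal.toReal_mono (ENNReal.mul_ne_top ENNReal.ofReal_ne_top (Lp.memLp f).2.ne)
        (memLp_berezin hm f).2
      rw [ENNReal.toReal_mul, ENNReal.toReal_ofReal (by positivity)] at h1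
      refine (le_of_eq ?_).trans h1
      exact Lp.norm_toLp _ (memLp_berezin hm f).1)

theorem isGivenBy_berezinL (hm : 2 ≤ m) : IsGivenBy p (berezinL hm) (berezin m) :=
  fun f => (memLp_berezin hm f).1.coeFn_toLp

end berezin

/-! ### The channel symbol as a combination of Berezin transforms -/

section channelSymbol

variable {μ ν k : ℕ}

theorem rTensor_completion_pureTensor (A : Bergman μ →L[ℂ] Bergman μ) (u : Bergman μ)
    (v : Bergman ν) : (A.rTensor (Bergman ν)).completion (pureTensor u v) = pureTensor (A u) v := by
  rw [pureTensor, ContinuousLinearMap.completion_apply_coe]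
  rfl

/-- When g moves z to 0, invariance gives 1 - |g(w)|² = `berezinKernel z w`; the automorphy factor
and weight produce its μ-th power, and the monomial produces |g(w)|^(2i). -/
theorem norm_discTranslate_monoVec_sq (hμ : 2 ≤ μ) {a b : ℂ} (h : ‖a‖ ^ 2 - ‖b‖ ^ 2 = 1)
    {z w : ℂ} (hz : z ∈ disc) (hw : w ∈ disc) (h0 : mobius a b z = 0) (i : ℕ) :
    ‖discTranslate μ a b (monoVec μ i) w‖ ^ 2 * (1 - ‖w‖ ^ 2) ^ μ =
      berezinKernel z w ^ μ * (1 - berezinKernel z w) ^ i := by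
  have hjw := norm_pos_iff.2 (autFactor_ne_zero h hw)
  have hjz := norm_pos_iff.2 (autFactor_ne_zero h hz)
  have e1 : berezinKernel z w = (1 - ‖w‖ ^ 2) / ‖autFactor a b w‖ ^ 2 := by
    have e2 := autFactor_mul_conj_of_mobius_eq_zero h hz hw h0
    have e3 := one_sub_norm_mobius_sq h hz
    rw [h0, norm_zero, eq_div_iff (by positivity)] at e3
    have e4 : 1 - ‖z‖ ^ 2 = ‖autFactor a b z‖ ^ 2 := by rw [← e3]; ring
    rw [berezinKernel, ← e2, norm_mul, RCLike.norm_conj, e4]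
    field_simp
  have e5 : ‖mobius a b w‖ ^ 2 = 1 - berezinKernel z w := by
    rw [e1, ← one_sub_norm_mobius_sq h hw]
    ring
  rw [discTranslate_apply hμ h _ hw, monoVec_apply hμ i (mobius_mem_disc h hw), norm_mul,
    norm_inv, norm_pow, norm_pow, mul_pow, ← e5, e1, div_pow]
  field_simp
  ring

theorem integral_discTranslate_monoVec (hμ : 2 ≤ μ) {p : ℝ≥0∞} [Fact (1 ≤ p)] (f : DiscLp p)
    {a b : ℂ} (h : ‖a‖ ^ 2 - ‖b‖ ^ 2 = 1) {z : ℂ} (hz : z ∈ disc) (h0 : mobius a b z = 0)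
    {i : ℕ} (hi : i ≤ k) :
    ⟪discTranslate μ a b (monoVec μ i),
      symbolAdjoint μ f (discTranslate μ a b (monoVec μ i))⟫_ℂ =
      ∑ l ∈ Finset.range (k + 1), ((-1) ^ l * (i.choose l : ℂ)) * berezin (μ + l) f z := by
  rw [(isSymbolAdjoint_symbolAdjoint hμ f).inner_apply_self hμ]
  have h1 : ∀ w ∈ disc, ((‖discTranslate μ a b (monoVec μ i) w‖ ^ 2 * (1 - ‖w‖ ^ 2) ^ μ : ℝ) : ℂ) *
      f w = ∑ l ∈ Finset.range (k + 1), ((-1) ^ l * (i.choose l : ℂ)) *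
        (((berezinKernel z w ^ (μ + l) : ℝ) : ℂ) * f w) := by
    intro w hw
    rw [norm_discTranslate_monoVec_sq hμ h hz hw h0]
    -- The binomial expansion is padded with zero terms up to k so that the range of l does not
    -- depend on i and the sums can later be exchanged.
    have h2 : (1 - berezinKernel z w) ^ i = ∑ l ∈ Finset.range (k + 1),
        (-1) ^ l * (i.choose l : ℝ) * berezinKernel z w ^ l := by
      have h3 : Finset.range (i + 1) ⊆ Finset.range (k + 1) :=
        Finset.range_subset_range.2 (by omega)
      rw [← Finset.sum_subset h3, sub_eq_neg_add, add_pow]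
      · refine Finset.sum_congr rfl fun l _ => ?_
        rw [neg_pow]
        ring
      · intro l _ hl
        rw [Nat.choose_eq_zero_of_lt (by simpa using hl)]
        simp
    rw [h2, Finset.mul_sum, Complex.ofReal_sum, Finset.sum_mul]
    refine Finset.sum_congr rfl fun l _ => ?_
    push_cast
    ring
  have h4 : ∀ l ∈ Finset.range (k + 1), Integrable (fun w => ((-1) ^ l * (i.choose l : ℂ)) *
      (((berezinKernel z w ^ (μ + l) : ℝ) : ℂ) * f w)) invMeasure :=
    fun l _ => (integrable_berezinKernel_mul (by omega) f hz).const_mul _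
  rw [integral_congr_ae (ae_mem_disc.mono h1), integral_finsetSum _ h4]
  refine Finset.sum_congr rfl fun l _ => ?_
  rw [integral_const_mul, berezin_eq_integral (by omega) f hz]

/-- The kernel tensor at z is a translate of (y - x)^k divided by automorphy factors, which the
power of 1 - |z|² cancels. As A leaves the second factor alone, orthogonality there removes the
cross terms and leaves ‖y^(k-i)‖². -/
theorem inner_kernelTensor_rTensor (hμ : 2 ≤ μ) (hν : 2 ≤ ν) (A : Bergman μ →L[ℂ] Bergman μ)
    {a b : ℂ} (h : ‖a‖ ^ 2 - ‖b‖ ^ 2 = 1) {z : ℂ} (hz : z ∈ disc) (h0 : mobius a b z = 0) :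
    ⟪kernelTensor μ ν k z, (A.rTensor (Bergman ν)).completion (kernelTensor μ ν k z)⟫_ℂ *
      (1 - (‖z‖ : ℂ) ^ 2) ^ (μ + ν + 2 * k) =
    ∑ i ∈ Finset.range (k + 1), (k.choose i : ℂ) ^ 2 *
      (((k - i + ν - 1).choose (k - i) : ℕ) : ℂ)⁻¹ *
        ⟪discTranslate μ a b (monoVec μ i), A (discTranslate μ a b (monoVec μ i))⟫_ℂ := by
  have hj := autFactor_ne_zero h hz
  have hj' : conj (autFactor a b z) ≠ 0 := by simpa using hj
  have e1 : (1 - (‖z‖ : ℂ) ^ 2) = autFactor a b z * conj (autFactor a b z) := by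
    rw [autFactor_mul_conj_of_mobius_eq_zero h hz hz h0, Complex.mul_conj,
      Complex.normSq_eq_norm_sq]
    push_cast
    rfl
  have e2 : ⟪tensorTranslate μ ν a b (kernelTensor μ ν k 0), (A.rTensor (Bergman ν)).completion
      (tensorTranslate μ ν a b (kernelTensor μ ν k 0))⟫_ℂ =
      ∑ i ∈ Finset.range (k + 1), (k.choose i : ℂ) ^ 2 *
      (((k - i + ν - 1).choose (k - i) : ℕ) : ℂ)⁻¹ *
        ⟪discTranslate μ a b (monoVec μ i), A (discTranslate μ a b (monoVec μ i))⟫_ℂ := by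
    rw [kernelTensor_zero hμ hν]
    simp only [map_sum, map_smul, tensorTranslate_pureTensor, rTensor_completion_pureTensor]
    rw [sum_inner]
    refine Finset.sum_congr rfl fun i hi => ?_
    have hik : i ≤ k := by simpa [Nat.lt_succ_iff] using hi
    rw [inner_sum, Finset.sum_eq_single_of_mem i hi]
    · rw [inner_smul_left, inner_smul_right, inner_pureTensor, LinearIsometry.inner_map_map,
        inner_monoVec_monoVec hν, if_pos rfl]
      have h1 : ((-1 : ℂ) ^ i) * (-1) ^ i = 1 := by rw [← mul_pow]; simp
      simp only [map_mul, map_pow, map_neg, map_one, Complex.conj_natCast]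
      linear_combination ((k.choose i : ℂ) ^ 2 * (((k - i + ν - 1).choose (k - i) : ℕ) : ℂ)⁻¹ *
        ⟪discTranslate μ a b (monoVec μ i), A (discTranslate μ a b (monoVec μ i))⟫_ℂ) * h1
    · intro j hj hji
      have hjk : j ≤ k := by simpa [Nat.lt_succ_iff] using hj
      rw [inner_smul_left, inner_smul_right, inner_pureTensor, LinearIsometry.inner_map_map,
        inner_monoVec_monoVec hν, if_neg (by omega)]
      simp
  rw [kernelTensor_eq hμ hν h hz, h0, map_smul, inner_smul_left, inner_smul_right, e2, e1]
  simp only [map_inv₀, map_pow, Complex.conj_conj, mul_pow]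
  field_simp

theorem IsTensorProjection.channelSymbol_eq
    {P : BergmanTensor μ ν →L[ℂ] Bergman (μ + ν + 2 * k)} (hP : IsTensorProjection μ ν k P)
    (hμ : 2 ≤ μ) (hν : 2 ≤ ν) {p : ℝ≥0∞} [Fact (1 ≤ p)] (f : DiscLp p) {z : ℂ} (hz : z ∈ disc) :
    channelSymbol P f z = (kernelTensorConst μ ν k : ℂ)⁻¹ *
      ∑ i ∈ Finset.range (k + 1), (k.choose i : ℂ) ^ 2 *
        (((k - i + ν - 1).choose (k - i) : ℕ) : ℂ)⁻¹ * ∑ l ∈ Finset.range (k + 1),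
          ((-1) ^ l * (i.choose l : ℂ)) * berezin (μ + l) f z := by
  have hN : 2 ≤ μ + ν + 2 * k := by omega
  obtain ⟨κ, hκ, hadj⟩ := hP.exists_adjoint_kernelVec hμ hν
  obtain ⟨a, b, h, h0⟩ := exists_mobius_eq_zero hz
  have e1 : opKernel (μ + ν + 2 * k) (channel P (symbolAdjoint μ f)) z z =
      ((‖κ‖ ^ 2 : ℝ) : ℂ) * ⟪kernelTensor μ ν k z,
        ((symbolAdjoint μ f).rTensor (Bergman ν)).completion (kernelTensor μ ν k z)⟫_ℂ := by
    rw [opKernel, ← inner_kernelVec hN hz, channel, ContinuousLinearMap.comp_apply,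
      ContinuousLinearMap.comp_apply, ← ContinuousLinearMap.adjoint_inner_left, hadj z hz,
      map_smul, inner_smul_left, inner_smul_right, ← mul_assoc, mul_comm (conj κ),
      Complex.mul_conj, Complex.normSq_eq_norm_sq]
  have e2 : ((‖κ‖ ^ 2 : ℝ) : ℂ) = (kernelTensorConst μ ν k : ℂ)⁻¹ := by
    rw [← Complex.ofReal_inv, eq_inv_of_mul_eq_one_left hκ]
  rw [channelSymbol, covSymbol, e1, mul_assoc, inner_kernelTensor_rTensor hμ hν _ h hz h0, e2]
  congr 1
  refine Finset.sum_congr rfl fun i hi => ?_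
  rw [integral_discTranslate_monoVec hμ f h hz h0 (by simpa [Nat.lt_succ_iff] using hi)]

end channelSymbol

/-! ### Binomial sums and the limit of the coefficients -/

section poch

theorem poch_natCast (n k : ℕ) :
    poch n k = (k.factorial : ℂ) * ((n + k - 1).choose k : ℕ) := by
  rw [poch, ← ascPochhammer_eval_cast, ascPochhammer_nat_eq_ascFactorial,
    Nat.ascFactorial_eq_factorial_mul_choose']
  push_cast
  rfl

theorem poch_natCast_ne_zero {n : ℕ} (hn : 1 ≤ n) (k : ℕ) : poch n k ≠ 0 := by
  rw [poch_natCast]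
  have h1 : (n + k - 1).choose k ≠ 0 := (Nat.choose_pos (by omega)).ne'
  have h2 := k.factorial_ne_zero
  exact mul_ne_zero (by exact_mod_cast h2) (by exact_mod_cast h1)

theorem factorial_mul_factorial_mul_choose {k i : ℕ} (hi : i ≤ k) :
    (k.choose i : ℂ) * (i.factorial * (k - i).factorial) = k.factorial := by
  rw [← mul_assoc]
  exact_mod_cast Nat.choose_mul_factorial_mul_factorial hi

/-- This replaces the reciprocal binomial of a monomial norm by a genuine binomial coefficient,
which makes Vandermonde's identity applicable. -/
theorem inv_choose_mul_poch {n : ℕ} (hn : 1 ≤ n) {k i : ℕ} (hi : i ≤ k) :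
    (((i + n - 1).choose i : ℕ) : ℂ)⁻¹ * poch n k =
      i.factorial * (k - i).factorial * ((n + k - 1).choose (k - i) : ℕ) := by
  have h1 : (((i + n - 1).choose i : ℕ) : ℂ) ≠ 0 := by
    exact_mod_cast (Nat.choose_pos (by omega)).ne'
  have h2 := Nat.choose_mul (n := n + k - 1) (k := k) (s := k - i) (by omega)
  rw [Nat.choose_symm hi, show n + k - 1 - (k - i) = i + n - 1 by omega,
    show k - (k - i) = i by omega] at h2
  have h3 : (((n + k - 1).choose k : ℕ) : ℂ) * (k.choose i : ℂ) =
      ((n + k - 1).choose (k - i) : ℕ) * ((i + n - 1).choose i : ℕ) := by exact_mod_cast h2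
  rw [inv_mul_eq_iff_eq_mul₀ h1, poch_natCast, ← factorial_mul_factorial_mul_choose hi]
  linear_combination ((i.factorial : ℂ) * (k - i).factorial) * h3

theorem sum_choose_mul_choose (m n k : ℕ) :
    ∑ i ∈ Finset.range (k + 1), ((m.choose (k - i) : ℕ) : ℂ) * (n.choose i : ℕ) =
      ((m + n).choose k : ℕ) := by
  rw [add_comm m n, Nat.add_choose_eq, Finset.Nat.sum_antidiagonal_eq_sum_range_succ_mk]
  push_cast
  exact Finset.sum_congr rfl fun i _ => mul_comm _ _

/-- Once the denominators are cleared, each term is k!² times a product of two binomials, and the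
sum is Vandermonde's. -/
theorem kernelTensorConst_mul_poch {μ ν : ℕ} (hμ : 2 ≤ μ) (hν : 2 ≤ ν) (k : ℕ) :
    (kernelTensorConst μ ν k : ℂ) * (poch μ k * poch ν k) =
      k.factorial * poch ((μ : ℂ) + ν + k - 1) k := by
  have h1 : (μ : ℂ) + ν + k - 1 = ((μ + ν + k - 1 : ℕ) : ℂ) := by
    rw [Nat.cast_sub (by omega)]
    push_cast
    ring
  rw [h1, poch_natCast (μ + ν + k - 1),
    show μ + ν + k - 1 + k - 1 = (μ + k - 1) + (ν + k - 1) by omega, ← sum_choose_mul_choose,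
    kernelTensorConst, Complex.ofReal_sum, Finset.sum_mul, Finset.mul_sum, Finset.mul_sum]
  refine Finset.sum_congr rfl fun i hi => ?_
  have hik : i ≤ k := by simpa [Nat.lt_succ_iff] using hi
  have h2 := inv_choose_mul_poch (n := μ) (by omega) hik
  have h3 := inv_choose_mul_poch (n := ν) (by omega) (Nat.sub_le k i)
  rw [show k - (k - i) = i by omega] at h3
  have h4 := factorial_mul_factorial_mul_choose hik
  push_cast
  calc _ = (k.choose i : ℂ) ^ 2 * (((((i + μ - 1).choose i : ℕ) : ℂ)⁻¹ * poch μ k) *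
        ((((k - i + ν - 1).choose (k - i) : ℕ) : ℂ)⁻¹ * poch ν k)) := by ring
    _ = _ := by
      rw [h2, h3, ← h4]
      ring

theorem sum_choose_mul_poch {ν : ℕ} (hν : 2 ≤ ν) {k l : ℕ} (hl : l ≤ k) :
    (∑ i ∈ Finset.range (k + 1), (k.choose i : ℂ) ^ 2 *
      (((k - i + ν - 1).choose (k - i) : ℕ) : ℂ)⁻¹ * (i.choose l : ℂ)) * poch ν k =
      k.choose l * poch ((ν : ℂ) + k - l) k := by
  have h1 : (ν : ℂ) + k - l = ((ν + k - l : ℕ) : ℂ) := by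
    rw [Nat.cast_sub (by omega)]
    push_cast
    rfl
  rw [h1, poch_natCast (ν + k - l),
    show ν + k - l + k - 1 = (k - l) + (ν + k - 1) by omega, ← sum_choose_mul_choose,
    Finset.sum_mul, Finset.mul_sum, Finset.mul_sum]
  refine Finset.sum_congr rfl fun i hi => ?_
  have hik : i ≤ k := by simpa [Nat.lt_succ_iff] using hi
  have h3 := inv_choose_mul_poch (n := ν) (by omega) (Nat.sub_le k i)
  rw [show k - (k - i) = i by omega] at h3
  have h4 := factorial_mul_factorial_mul_choose hik
  -- Trinomial revision pulls the dependence on l out of the sum and leaves a Vandermonde sum; both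
  -- sides vanish when i < l.
  have h5 : (k.choose i : ℂ) * (i.choose l : ℂ) = k.choose l * ((k - l).choose (k - i) : ℕ) := by
    rcases lt_or_ge i l with hil | hil
    · rw [Nat.choose_eq_zero_of_lt hil, Nat.choose_eq_zero_of_lt (show k - l < k - i by omega)]
      simp
    · have := Nat.choose_mul (n := k) hil
      rw [← Nat.choose_symm (show i - l ≤ k - l by omega),
        show k - l - (i - l) = k - i by omega] at this
      exact_mod_cast this
  calc _ = (k.choose i : ℂ) * ((k.choose i : ℂ) * (i.choose l : ℂ)) *
        ((((k - i + ν - 1).choose (k - i) : ℕ) : ℂ)⁻¹ * poch ν k) := by ring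
    _ = _ := by
      rw [h3, h5, ← h4]
      ring

theorem channel_coefficient_eq {μ ν : ℕ} (hμ : 2 ≤ μ) (hν : 2 ≤ ν) {k l : ℕ} (hl : l ≤ k) :
    (kernelTensorConst μ ν k : ℂ)⁻¹ * ∑ i ∈ Finset.range (k + 1), (k.choose i : ℂ) ^ 2 *
      (((k - i + ν - 1).choose (k - i) : ℕ) : ℂ)⁻¹ * (i.choose l : ℂ) =
    (poch μ k * poch ν k / ((k.factorial : ℂ) * poch ((μ : ℂ) + ν + k - 1) k)) *
      ((k.choose l : ℂ) * (poch ((ν : ℂ) + k - l) k / poch ν k)) := by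
  have h1 := sum_choose_mul_poch hν hl
  have h2 := kernelTensorConst_mul_poch hμ hν k
  have n1 : poch ν k ≠ 0 := poch_natCast_ne_zero (by omega) k
  have n2 : poch μ k ≠ 0 := poch_natCast_ne_zero (by omega) k
  have n3 : (kernelTensorConst μ ν k : ℂ) ≠ 0 := by
    exact_mod_cast (kernelTensorConst_pos hμ hν).ne'
  rw [← h2, ← mul_div_assoc, ← h1]
  field_simp

/-- The quotient is a product of k factors (ν + c + i)/(ν + i), each tending to 1. -/
theorem tendsto_poch_div_poch (c : ℂ) (k : ℕ) :
    Tendsto (fun ν : ℕ => poch ((ν : ℂ) + c) k / poch ν k) atTop (𝓝 1) := by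
  have hinv : Tendsto (fun ν : ℕ => ((ν : ℂ))⁻¹) atTop (𝓝 0) := tendsto_inv_atTop_nhds_zero_nat
  induction k with
  | zero => simp [poch]
  | succ k ih =>
    have h1 : Tendsto (fun ν : ℕ => (1 + (c + k) * ((ν : ℂ))⁻¹) / (1 + (k : ℂ) * ((ν : ℂ))⁻¹))
        atTop (𝓝 ((1 + (c + k) * 0) / (1 + (k : ℂ) * 0))) :=
      ((hinv.const_mul _).const_add _).div ((hinv.const_mul _).const_add _) (by simp)
    have h2 := ih.mul h1
    simp only [mul_zero, add_zero, div_one, mul_one] at h2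
    refine h2.congr' ?_
    filter_upwards [eventually_ge_atTop 1] with ν hν
    have hν0 : (ν : ℂ) ≠ 0 := by
      have : ν ≠ 0 := by omega
      exact_mod_cast this
    have e1 : (1 + (c + k) * ((ν : ℂ))⁻¹) / (1 + (k : ℂ) * ((ν : ℂ))⁻¹) =
        ((ν : ℂ) + c + k) / (ν + k) := by
      rw [← mul_div_mul_left _ _ hν0]
      congr 1
      · field_simp
        ring
      · field_simp
    rw [e1, poch, poch, poch, poch, ascPochhammer_succ_eval, ascPochhammer_succ_eval,
      mul_div_mul_comm]

end poch

/-! ### Assembly on L^p -/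

theorem coeFn_sum_smul_apply {p : ℝ≥0∞} [Fact (1 ≤ p)] {ι : Type*} (s : Finset ι) (c : ι → ℂ)
    (B : ι → DiscLp p →L[ℂ] DiscLp p) (f : DiscLp p) :
    (((∑ j ∈ s, c j • B j) f : DiscLp p) : ℂ → ℂ) =ᵐ[invMeasure]
      fun z => ∑ j ∈ s, c j * (B j f : ℂ → ℂ) z := by
  classical
  induction s using Finset.induction_on with
  | empty =>
    simp only [Finset.sum_empty]
    exact Lp.coeFn_zero ℂ p invMeasure
  | insert j s hj ih =>
    have h1 : (∑ i ∈ insert j s, c i • B i) f = c j • B j f + (∑ i ∈ s, c i • B i) f := by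
      rw [Finset.sum_insert hj]
      rfl
    rw [h1]
    filter_upwards [ih, Lp.coeFn_add (c j • B j f) ((∑ i ∈ s, c i • B i) f),
      Lp.coeFn_smul (c j) (B j f)] with z h2 h3 h4
    rw [h3, Pi.add_apply, h4, h2, Finset.sum_insert hj, Pi.smul_apply, smul_eq_mul]

theorem tendsto_channel_coefficient (μ k j : ℕ) :
    Tendsto (fun ν : ℕ => (poch μ k * poch ν k / ((k.factorial : ℂ) * poch ((μ : ℂ) + ν + k - 1) k)) *
      ((-1) ^ j * (k.choose j : ℂ) * (poch ((ν : ℂ) + k - j) k / poch ν k))) atTop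
      (𝓝 ((poch μ k / (k.factorial : ℂ)) * ((-1) ^ j * (k.choose j : ℂ)))) := by
  have h1 := (tendsto_poch_div_poch ((μ : ℂ) + k - 1) k).inv₀ one_ne_zero
  have h2 := tendsto_poch_div_poch ((k : ℂ) - j) k
  have h3 := (h1.const_mul (poch μ k / (k.factorial : ℂ))).mul
    (h2.const_mul ((-1) ^ j * (k.choose j : ℂ)))
  simp only [inv_one, mul_one] at h3
  refine h3.congr fun ν => ?_
  rw [show (ν : ℂ) + ((μ : ℂ) + k - 1) = (μ : ℂ) + ν + k - 1 by ring,
    show (ν : ℂ) + ((k : ℂ) - j) = (ν : ℂ) + k - j by ring, inv_div, div_mul_div_comm]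

theorem mainTheorem8 (μ k : ℕ) (hμ : 2 ≤ μ) (p : ℝ≥0∞) [Fact (1 ≤ p)] :
    -- the objects exist: `R_m^*(f)` for `f` in `L^p`, and the projections
    (∀ m : ℕ, 2 ≤ m → ∀ f : DiscLp p, IsSymbolAdjoint m f (symbolAdjoint m f)) ∧
    (∀ ν : ℕ, 2 ≤ ν → ∃ P, IsTensorProjection μ ν k P) ∧
    ∀ P : (ν : ℕ) → BergmanTensor μ ν →L[ℂ] Bergman (μ + ν + 2 * k),
      (∀ ν : ℕ, 2 ≤ ν → IsTensorProjection μ ν k (P ν)) →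
      ∃ (B : ℕ → DiscLp p →L[ℂ] DiscLp p) (E : ℕ → DiscLp p →L[ℂ] DiscLp p),
        (∀ m : ℕ, 2 ≤ m → IsGivenBy p (B m) (berezin m)) ∧
        (∀ ν : ℕ, 2 ≤ ν → IsGivenBy p (E ν) (channelSymbol (P ν))) ∧
        (∀ ν : ℕ, 2 ≤ ν →
          E ν = (poch μ k * poch ν k / ((k.factorial : ℂ) * poch ((μ : ℂ) + ν + k - 1) k)) •
            ∑ j ∈ Finset.range (k + 1),
              ((-1) ^ j * (k.choose j : ℂ) * (poch ((ν : ℂ) + k - j) k / poch ν k)) •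
                B (μ + j)) ∧
        Tendsto (fun ν : ℕ =>
          ‖E ν - (poch μ k / (k.factorial : ℂ)) •
            ∑ j ∈ Finset.range (k + 1), ((-1) ^ j * (k.choose j : ℂ)) • B (μ + j)‖)
          atTop (𝓝 0) := by
  refine ⟨fun m hm f => isSymbolAdjoint_symbolAdjoint hm f,
    fun ν hν => exists_isTensorProjection hμ hν, fun P hP => ?_⟩
  -- The value 0 for m < 2 never enters, since μ + j ≥ 2.
  set B : ℕ → DiscLp p →L[ℂ] DiscLp p := fun m => if hm : 2 ≤ m then berezinL hm else 0 with hBdef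
  have hB : ∀ m, 2 ≤ m → IsGivenBy p (B m) (berezin m) := fun m hm => by
    rw [hBdef]
    simp only [dif_pos hm]
    exact isGivenBy_berezinL hm
  -- E ν is defined by the asserted formula, so what remains is that this bounded operator
  -- represents the channel symbol map.
  refine ⟨B, fun ν => (poch μ k * poch ν k / ((k.factorial : ℂ) * poch ((μ : ℂ) + ν + k - 1) k)) •
    ∑ j ∈ Finset.range (k + 1), ((-1) ^ j * (k.choose j : ℂ) *
      (poch ((ν : ℂ) + k - j) k / poch ν k)) • B (μ + j), hB, fun ν hν f => ?_,
    fun ν _ => rfl, ?_⟩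
  · simp only [Finset.smul_sum, smul_smul]
    have hall : ∀ᵐ z ∂invMeasure, ∀ j : ℕ, (B (μ + j) f : ℂ → ℂ) z = berezin (μ + j) f z :=
      ae_all_iff.2 fun j => hB (μ + j) (by omega) f
    refine (coeFn_sum_smul_apply _ _ _ f).trans ?_
    filter_upwards [hall, ae_mem_disc] with z h1 hz
    rw [(hP ν hν).channelSymbol_eq hμ hν f hz]
    simp only [Finset.mul_sum]
    rw [Finset.sum_comm]
    refine Finset.sum_congr rfl fun l hl => ?_
    have hlk : l ≤ k := by simpa [Nat.lt_succ_iff] using hl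
    have h2 := channel_coefficient_eq hμ hν hlk
    rw [Finset.mul_sum] at h2
    rw [h1 l, mul_assoc ((-1 : ℂ) ^ l), mul_left_comm, ← h2, Finset.mul_sum, Finset.sum_mul]
    refine Finset.sum_congr rfl fun i _ => ?_
    ring
  -- The number of terms and the operators B (μ + j) do not depend on ν, so convergence of the
  -- coefficients gives convergence in operator norm.
  · refine tendsto_iff_norm_sub_tendsto_zero.1 ?_
    simp only [Finset.smul_sum, smul_smul]
    exact tendsto_finsetSum _ fun j _ => (tendsto_channel_coefficient μ k j).smul_const _
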